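/- Fix $x_0\ge 1$. Let $\mathcal L$ be the set of functions $\ell:[x_0,\infty)\to[1,\infty)$ of the form $\ell(x)=\exp\big(\int_{x_0}^x \vartheta(t)\frac{dt}{t}\big)$ with $\vartheta\in C^2([x_0,\infty))$ real-valued and $\vartheta(x)\to0$, $x\vartheta'(x)\to0$, $x^2\vartheta''(x)\to0$ as $x\to\infty$. Let $\mathcal L_0$ be the set of functions $\ell:[x_0,\infty)\to[1,\infty)$ of the same form with $\vartheta\in C^2([x_0,\infty))$ positive and decreasing, $\vartheta(x)\to0$, $x\vartheta'(x)/\vartheta(x)\to0$, $x^2\vartheta''(x)/\vartheta(x)\to0$ as $x\to\infty$, such that for every $\varepsilon>0$ there is $C_\varepsilon>0$ with $\vartheta(x)\ge C_\varepsilon x^{-\varepsilon}$ for all $x\ge x_0$, and such that $\ell(x)\to\infty$. For $c>1$ (resp. $c=1$) let $\mathcal R_c$ be the set of strictly increasing convex functions $h:[x_0,\infty)\to[1,\infty)$ of the form $h(x)=x^c\ell(x)$ with $\ell\in\mathcal L$ (resp. $\ell\in\mathcal L_0$). (The number $x_0\ge1$ may be different for different functions $h$.) Let $c_1\in[1,16/15)$,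 $c_2\in[1,17/16)$, $\gamma_i=1/c_i$, $h_i\in\mathcal R_{c_i}$, and let $\varphi_i$ be the inverse function of $h_i$ ($i=1,2$). Let $\psi:[1,\infty)\to(0,1/2]$ be a $C^2$ function with $$\frac{\psi(x)}{\varphi_2'(x)}\to1,\qquad \frac{\psi'(x)}{\varphi_2''(x)}\to1,\qquad \frac{\psi''(x)}{\varphi_2'''(x)}\to1\qquad (x\to\infty).$$ Let $B$ be the set of the $n\in\mathbb N$ in the domain of $\varphi_1$ such that $\{\varphi_1(n)\}<\psi(n)$, where $\{x\}=x-\lfloor x\rfloor$. Then for every $\chi>0$ with $16(1-\gamma_1)+17(1-\gamma_2)+31\chi\le 1$ there are $\chi'>0$ and $C$, depending only on $h_1,h_2,\psi,\chi$, such that $$\Bigg|\sum_{\substack{p\in B,\ p\le N\\ p\equiv a\ (\mathrm{mod}\ q)}}\psi(p)^{-1}\log(p)\,e^{2\pi i p\xi}-\sum_{\substack{p\le N\\ p\equiv a\ (\mathrm{mod}\ q)}}\log(p)\,e^{2\pi i p\xi}\Bigg|\le C\,N^{1-\chi-\chi'}$$ for all $N\in\mathbb N$, all $\xi\in\mathbb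 R$ and all $a,q\in\mathbb Z$ with $0\le a\le q-1$ and $\gcd(a,q)=1$, where the sums run over primes $p$. -/

import Mathlib

open Filter Topology

noncomputable section

namespace PSRoth

/-- `ℓ(x) = exp (∫_{x₀}^x ϑ(t)/t dt)` for all `x ≥ x₀`. -/
def IsExpIntegral (x₀ : ℝ) (ϑ ℓ : ℝ → ℝ) : Prop :=
  ∀ x, x₀ ≤ x → ℓ x = Real.exp (∫ t in x₀..x, ϑ t / t)

/-- The class `𝓛` of slowly varying functions `ℓ : [x₀,∞) → [1,∞)`. Functions on `[x₀,∞)` are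
represented by functions on `ℝ` of which only the values on `[x₀,∞)` are used. -/
def SlowClass (x₀ : ℝ) : Set (ℝ → ℝ) :=
  {ℓ | (∀ x, x₀ ≤ x → 1 ≤ ℓ x) ∧
    ∃ ϑ : ℝ → ℝ, ContDiffOn ℝ 2 ϑ (Set.Ici x₀) ∧ IsExpIntegral x₀ ϑ ℓ ∧
      Tendsto ϑ atTop (𝓝 0) ∧
      Tendsto (fun x => x * deriv ϑ x) atTop (𝓝 0) ∧
      Tendsto (fun x => x ^ 2 * iteratedDeriv 2 ϑ x) atTop (𝓝 0)}

/-- The class `𝓛₀` of slowly varying functions `ℓ : [x₀,∞) → [1,∞)`. -/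
def SlowClassZero (x₀ : ℝ) : Set (ℝ → ℝ) :=
  {ℓ | (∀ x, x₀ ≤ x → 1 ≤ ℓ x) ∧
    (∃ ϑ : ℝ → ℝ, ContDiffOn ℝ 2 ϑ (Set.Ici x₀) ∧ IsExpIntegral x₀ ϑ ℓ ∧
      (∀ x, x₀ ≤ x → 0 < ϑ x) ∧ AntitoneOn ϑ (Set.Ici x₀) ∧
      Tendsto ϑ atTop (𝓝 0) ∧
      Tendsto (fun x => x * deriv ϑ x / ϑ x) atTop (𝓝 0) ∧
      Tendsto (fun x => x ^ 2 * iteratedDeriv 2 ϑ x / ϑ x) atTop (𝓝 0) ∧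
      ∀ ε : ℝ, 0 < ε → ∃ C : ℝ, 0 < C ∧ ∀ x, x₀ ≤ x → C * x ^ (-ε) ≤ ϑ x) ∧
    Tendsto ℓ atTop atTop}

/-- The class `𝓡_c`, `c ≥ 1`, of strictly increasing convex functions
`h(x) = x ^ c ℓ(x)` on `[x₀,∞)`, with `ℓ ∈ 𝓛` if `c > 1` and `ℓ ∈ 𝓛₀` if `c = 1`. -/
def RegClass (x₀ c : ℝ) : Set (ℝ → ℝ) :=
  {h | StrictMonoOn h (Set.Ici x₀) ∧ ConvexOn ℝ (Set.Ici x₀) h ∧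
    ∃ ℓ : ℝ → ℝ, ((1 < c ∧ ℓ ∈ SlowClass x₀) ∨ (c = 1 ∧ ℓ ∈ SlowClassZero x₀)) ∧
      ∀ x, x₀ ≤ x → h x = x ^ c * ℓ x}

/-- The inverse `φ : [h(x₀),∞) → [x₀,∞)` of `h : [x₀,∞) → [h(x₀),∞)`.
Values at points outside `h([x₀,∞))` are not used. -/
def inverseOf (x₀ : ℝ) (h : ℝ → ℝ) : ℝ → ℝ :=
  Function.invFunOn h (Set.Ici x₀)

/-- The paper's relation `f ∼ g` as `x → ∞`: the quotient tends to `1`. -/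
def AsympEq (f g : ℝ → ℝ) : Prop :=
  Tendsto (fun x => f x / g x) atTop (𝓝 1)

/-- The admissible weights: `ψ : [1,∞) → (0,1/2]` of class `C²` with `ψ ∼ φ'`, `ψ' ∼ φ''`,
`ψ'' ∼ φ'''` at infinity. -/
def AdmissibleWeight (φ ψ : ℝ → ℝ) : Prop :=
  (∀ x, 1 ≤ x → 0 < ψ x ∧ ψ x ≤ 1 / 2) ∧ ContDiffOn ℝ 2 ψ (Set.Ici 1) ∧
    AsympEq ψ (deriv φ) ∧ AsympEq (deriv ψ) (iteratedDeriv 2 φ) ∧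
    AsympEq (iteratedDeriv 2 ψ) (iteratedDeriv 3 φ)

/-- The set `B` of the `n` in the domain `[h(x₀),∞)` of the inverse `φ` of `h` such that the
fractional part of `φ(n)` is less than `ψ(n)`. -/
def setB (x₀ : ℝ) (h ψ : ℝ → ℝ) : Set ℕ :=
  {n | h x₀ ≤ n ∧ Int.fract (inverseOf x₀ h n) < ψ n}

open Classical in
/-- `∑ w(p) log(p) e^{2πipξ}` over the primes `p ≤ N` in `S` with `p ≡ a mod q`. -/
def primeExpSum (S : Set ℕ) (w : ℝ → ℝ) (N : ℕ) (a q : ℤ) (ξ : ℝ) : ℂ :=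
  ∑ p ∈ Finset.Icc 1 N with p.Prime ∧ p ∈ S ∧ (p : ℤ) ≡ a [ZMOD q],
    ((w p * Real.log p : ℝ) : ℂ) * Complex.exp (2 * Real.pi * Complex.I * p * ξ)

end PSRoth

end

/-! Put x = 1 - γ₂, y = 1 - γ₁, saw(t) = {t} - 1/2, and let φ be the inverse of h₁. The indicator of
{φ(n)} < ψ(n) equals ψ(n) + saw(φ(n) - ψ(n)) - saw(φ(n)) (`indicator_eq_saw`). Up to a bounded range
of n, the difference of the two sums is therefore the sum of log(p) e(pξ) ψ(p)⁻¹ (saw(φ(p) - ψ(p)) -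
saw(φ(p))).

The sawtooth is replaced by its average over an interval of length about N^(-α), whose Fourier
series converges absolutely and is cut at K ≈ N^(2α). Averaging does real damage only if φ(n) or
φ(n) - ψ(n) lies just below an integer; such n are counted among all integers
(`card_fract_near_one_le`). In the Fourier part the weight ψ⁻¹ is almost free, because (e(mψ) - 1)/ψ
has size and variation at most m times a logarithm (`norm_sum_sawPoly_le`). What remains is to bound
the sum of log(p) e(mφ(p) + ξp) by N^(1-β), uniformly in ξ and in 1 ≤ m ≤ K.

The congruence condition is detected by additive characters, which merely shift ξ. The sum over
primes becomes one with Λ, and Vaughan's identity with cut U ≈ N^(1/6) splits it. Type I sums follow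
from van der Corput's second derivative test (`IsPhase.norm_type_I_le`). Type II sums follow from
Cauchy–Schwarz over blocks of length N^θ and the same test for φ(k₁l) - φ(k₂l)
(`IsPhase.norm_type_II_le`). The test sees second differences only, so ξ, a and q never enter the
bounds. All it needs of φ are bounds for φ'' and for the derivative of u²φ''(u), both of fixed sign;
these are collected in `IsPhase` and proved by regular variation in `RegClass.exists_isPhase`.

The parameters α = x + χ + 4ε, β = x + 2χ + 8ε, θ = 2β + 10ε are chosen in
`IsPhase.exists_eventually_norm_saw_sum_le`; the condition on γ₁, γ₂, χ is what makes them
admissible. -/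

namespace PSRoth

/-! ### The additive character -/

/-- The additive character `e(t) = exp(2πit)`. -/
noncomputable def e (t : ℝ) : ℂ := Complex.exp (2 * Real.pi * t * Complex.I)

lemma e_add (s t : ℝ) : e (s + t) = e s * e t := by
  simp only [e, ← Complex.exp_add]; push_cast; ring_nf

lemma e_eq_exp_ofReal (t : ℝ) : e t = Complex.exp ((2 * Real.pi * t : ℝ) * Complex.I) := by
  simp [e]

@[simp] lemma norm_e (t : ℝ) : ‖e t‖ = 1 := by
  rw [e_eq_exp_ofReal, Complex.norm_exp_ofReal_mul_I]

@[simp] lemma e_zero : e 0 = 1 := by simp [e]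

@[simp] lemma e_int (n : ℤ) : e n = 1 := by
  rw [e, ← Complex.exp_int_mul_two_pi_mul_I n]; push_cast; ring_nf

lemma conj_e (t : ℝ) : (starRingEnd ℂ) (e t) = e (-t) := by
  rw [e_eq_exp_ofReal, e_eq_exp_ofReal, ← Complex.exp_conj, map_mul, Complex.conj_ofReal,
    Complex.conj_I]
  congr 1; push_cast; ring

lemma e_sub_int (t : ℝ) (n : ℤ) : e (t - n) = e t := by
  have := e_add (t - n) n
  rw [e_int, mul_one] at this
  rw [← this]; congr 1; ring

lemma e_eq_cos_add_sin (t : ℝ) :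
    e t = (Real.cos (2 * Real.pi * t) : ℂ) + (Real.sin (2 * Real.pi * t) : ℂ) * Complex.I := by
  rw [e_eq_exp_ofReal, Complex.exp_mul_I]; simp

lemma norm_e_sub_one_le (t : ℝ) : ‖e t - 1‖ ≤ 2 * Real.pi * |t| := by
  rw [e_eq_exp_ofReal, mul_comm]
  refine (Real.norm_exp_I_mul_ofReal_sub_one_le).trans ?_
  rw [Real.norm_eq_abs, abs_mul, abs_of_pos Real.two_pi_pos]

lemma norm_e_sub_e_le (s t : ℝ) : ‖e s - e t‖ ≤ 2 * Real.pi * |s - t| := by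
  have : e s - e t = (e (s - t) - 1) * e t := by
    rw [sub_mul, ← e_add]; simp
  rw [this, norm_mul, norm_e, mul_one]
  exact norm_e_sub_one_le _

/-! ### Summation by parts -/

section Abel

/-- Summation by parts. -/
lemma sum_Ico_mul_eq_sub (w z : ℕ → ℂ) {a b : ℕ} (hab : a ≤ b) :
    ∑ n ∈ Finset.Ico a b, w n * z n = w b * ∑ n ∈ Finset.Ico a b, z n -
      ∑ n ∈ Finset.Ico a b, (w (n + 1) - w n) * ∑ i ∈ Finset.Ico a (n + 1), z i := by
  induction b, hab using Nat.le_induction with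
  | base => simp
  | succ b hab ih =>
    rw [Finset.sum_Ico_succ_top hab, Finset.sum_Ico_succ_top hab (fun n => (w (n + 1) - w n) * _),
      ih, Finset.sum_Ico_succ_top hab]
    ring

/-- Summation by parts in the form used throughout: a weight is removed at the cost of its last
value plus its total variation. -/
lemma norm_sum_mul_le_of_variation (w z : ℕ → ℂ) {a b : ℕ} (hab : a ≤ b) {B V : ℝ}
    (hB : ∀ c, a ≤ c → c ≤ b → ‖∑ n ∈ Finset.Ico a c, z n‖ ≤ B)
    (hV : ‖w b‖ + ∑ n ∈ Finset.Ico a b, ‖w (n + 1) - w n‖ ≤ V) :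
    ‖∑ n ∈ Finset.Ico a b, w n * z n‖ ≤ V * B := by
  have hB0 : 0 ≤ B := (norm_nonneg _).trans (hB a le_rfl hab)
  rw [sum_Ico_mul_eq_sub w z hab]
  refine (norm_sub_le _ _).trans ?_
  have h1 : ‖w b * ∑ n ∈ Finset.Ico a b, z n‖ ≤ ‖w b‖ * B := by
    rw [norm_mul]; gcongr; exact hB b hab le_rfl
  have h2 : ‖∑ n ∈ Finset.Ico a b, (w (n + 1) - w n) * ∑ i ∈ Finset.Ico a (n + 1), z i‖
      ≤ (∑ n ∈ Finset.Ico a b, ‖w (n + 1) - w n‖) * B := by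
    rw [Finset.sum_mul]
    refine norm_sum_le_of_le _ fun n hn => ?_
    rw [Finset.mem_Ico] at hn
    rw [norm_mul]; gcongr; exact hB (n + 1) (by omega) (by omega)
  calc _ ≤ ‖w b‖ * B + (∑ n ∈ Finset.Ico a b, ‖w (n + 1) - w n‖) * B := add_le_add h1 h2
    _ = (‖w b‖ + ∑ n ∈ Finset.Ico a b, ‖w (n + 1) - w n‖) * B := by ring
    _ ≤ V * B := by gcongr

end Abel

/-! ### The Kusmin–Landau inequality -/

section VanDerCorput

/-- The real part is constant, so the variation of (1 - e(t))⁻¹ along a sequence is half that of the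
cotangent, which is monotone. -/
lemma inv_one_sub_e {t : ℝ} (ht : Real.sin (Real.pi * t) ≠ 0) :
    (1 - e t)⁻¹ = 1 / 2 + (Real.cos (Real.pi * t) / Real.sin (Real.pi * t) : ℝ) / 2 * Complex.I := by
  have h1 : e t = (Real.cos (2 * (Real.pi * t)) : ℂ) +
      (Real.sin (2 * (Real.pi * t)) : ℂ) * Complex.I := by
    rw [e_eq_cos_add_sin]; ring_nf
  rw [Real.cos_two_mul', Real.sin_two_mul] at h1
  set s := Real.sin (Real.pi * t) with hs
  set c := Real.cos (Real.pi * t) with hc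
  have hsc : (s : ℂ) ^ 2 + (c : ℂ) ^ 2 = 1 := by
    exact_mod_cast Real.sin_sq_add_cos_sq (Real.pi * t)
  have hs' : (s : ℂ) ≠ 0 := by exact_mod_cast ht
  apply inv_eq_of_mul_eq_one_left
  rw [h1]
  push_cast
  field_simp
  have hI : Complex.I ^ 2 = -1 := Complex.I_sq
  have hc2 : (c : ℂ) ^ 2 = 1 - s ^ 2 := by rw [← hsc]; ring
  ring_nf
  rw [hI]
  ring_nf
  rw [hc2]
  have hc3 : (c : ℂ) ^ 3 = c * (1 - s ^ 2) := by rw [← hc2]; ring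
  rw [hc3]
  ring

lemma cot_sub_cot_nonneg {a b : ℝ} (ha : 0 < a) (hab : a ≤ b) (hb : b < Real.pi) :
    Real.cos b / Real.sin b ≤ Real.cos a / Real.sin a := by
  have h1 : 0 < Real.sin a := Real.sin_pos_of_pos_of_lt_pi ha (by linarith)
  have h2 : 0 < Real.sin b := Real.sin_pos_of_pos_of_lt_pi (by linarith) hb
  rw [div_le_div_iff₀ h2 h1]
  have := Real.sin_nonneg_of_nonneg_of_le_pi (sub_nonneg.2 hab) (by linarith : b - a ≤ Real.pi)
  rw [Real.sin_sub] at this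
  linarith

lemma two_mul_le_sin_pi_mul {θ t : ℝ} (hθ : 0 < θ) (h1 : θ ≤ t) (h2 : t ≤ 1 - θ) :
    2 * θ ≤ Real.sin (Real.pi * t) := by
  have hpi := Real.pi_pos
  rcases le_total t (1 / 2) with h | h
  · have := Real.mul_le_sin (x := Real.pi * t) (mul_nonneg hpi.le (by linarith)) (by nlinarith)
    calc 2 * θ ≤ 2 * t := by linarith
      _ = 2 / Real.pi * (Real.pi * t) := by field_simp
      _ ≤ _ := this
  · have := Real.mul_le_sin (x := Real.pi * (1 - t)) (by nlinarith) (by nlinarith)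
    have h3 : Real.sin (Real.pi * t) = Real.sin (Real.pi * (1 - t)) := by
      rw [← Real.sin_pi_sub]; congr 1; ring
    rw [h3]
    calc 2 * θ ≤ 2 * (1 - t) := by linarith
      _ = 2 / Real.pi * (Real.pi * (1 - t)) := by field_simp
      _ ≤ _ := this

lemma abs_cot_le {θ t : ℝ} (hθ : 0 < θ) (h1 : θ ≤ t) (h2 : t ≤ 1 - θ) :
    |Real.cos (Real.pi * t) / Real.sin (Real.pi * t)| ≤ 1 / (2 * θ) := by
  have h := two_mul_le_sin_pi_mul hθ h1 h2
  have h0 : 0 < Real.sin (Real.pi * t) := by linarith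
  rw [abs_div, abs_of_pos h0]
  exact div_le_div₀ zero_le_one (Real.abs_cos_le_one _) (by positivity) h

/-- Kusmin–Landau, with differences in `[θ, 1 - θ]`. -/
lemma norm_sum_e_le_of_diff_mem (f : ℕ → ℝ) {a b : ℕ} {θ : ℝ} (hθ : 0 < θ) (hθ1 : θ ≤ 1)
    (hmono : ∀ n, a ≤ n → n + 1 < b → f (n + 1) - f n ≤ f (n + 2) - f (n + 1))
    (hlo : ∀ n, a ≤ n → n < b → θ ≤ f (n + 1) - f n)
    (hhi : ∀ n, a ≤ n → n < b → f (n + 1) - f n ≤ 1 - θ) :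
    ‖∑ n ∈ Finset.Ico a b, e (f n)‖ ≤ 4 / θ := by
  rcases le_or_gt b a with hab | hab
  · rw [Finset.Ico_eq_empty (by omega)]; simp; positivity
  obtain ⟨b, rfl⟩ : ∃ k, b = k + 1 := ⟨b - 1, by omega⟩
  have hab' : a ≤ b := by omega
  -- The last term is estimated by 1: summation by parts up to b uses the weight at b, hence the
  -- difference f (b + 1) - f b.
  rw [Finset.sum_Ico_succ_top hab']
  set g : ℕ → ℝ := fun n => f (n + 1) - f n with hg
  set t : ℕ → ℝ := fun n => Real.cos (Real.pi * g n) / Real.sin (Real.pi * g n) with ht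
  have hsin : ∀ n, a ≤ n → n < b + 1 → Real.sin (Real.pi * g n) ≠ 0 := fun n h1 h2 => by
    have := two_mul_le_sin_pi_mul hθ (hlo n h1 h2) (hhi n h1 h2)
    have : 0 < Real.sin (Real.pi * g n) := by linarith
    exact this.ne'
  have habs : ∀ n, a ≤ n → n < b + 1 → |t n| ≤ 1 / (2 * θ) := fun n h1 h2 =>
    abs_cot_le hθ (hlo n h1 h2) (hhi n h1 h2)
  have hanti : ∀ n, a ≤ n → n < b → t (n + 1) ≤ t n := fun n h1 h2 => by
    have hpi := Real.pi_pos
    apply cot_sub_cot_nonneg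
    · have := hlo n h1 (by omega); exact mul_pos hpi (lt_of_lt_of_le hθ this)
    · exact mul_le_mul_of_nonneg_left (hmono n h1 (by omega)) hpi.le
    · have := hhi (n + 1) (by omega) (by omega)
      calc Real.pi * g (n + 1) ≤ Real.pi * (1 - θ) := mul_le_mul_of_nonneg_left this hpi.le
        _ < Real.pi := by nlinarith
  -- w n is (1 - e(g n))⁻¹, so e(f n) = w n * z n with z telescoping, and the variation of w
  -- telescopes because t is antitone.
  set w : ℕ → ℂ := fun n => 1 / 2 + (t n : ℂ) / 2 * Complex.I with hw
  set z : ℕ → ℂ := fun n => e (f n) - e (f (n + 1)) with hz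
  have hzw : ∀ n ∈ Finset.Ico a b, e (f n) = w n * z n := fun n hn => by
    rw [Finset.mem_Ico] at hn
    have h1 := inv_one_sub_e (hsin n hn.1 (by omega))
    have h2 : z n = (1 - e (g n)) * e (f n) := by
      simp only [hz, hg, sub_mul, ← e_add]; simp
    have h3 : 1 - e (g n) ≠ 0 := by
      intro h0
      rw [h0, inv_zero] at h1
      have := congrArg Complex.re h1
      rw [Complex.add_re, Complex.mul_I_re, ← Complex.ofReal_ofNat, ← Complex.ofReal_div,
        Complex.ofReal_im] at this
      norm_num at this
    have h4 : w n = (1 - e (g n))⁻¹ := by rw [h1]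
    rw [h2, h4, inv_mul_cancel_left₀ h3]
  have hz2 : ∀ c, a ≤ c → c ≤ b → ‖∑ n ∈ Finset.Ico a c, z n‖ ≤ 2 := fun c h1 h2 => by
    have : ∑ n ∈ Finset.Ico a c, z n = e (f a) - e (f c) := by
      have := Finset.sum_Ico_sub (fun n => - e (f n)) h1
      simp only [hz]
      rw [← sub_eq_zero] at this ⊢
      rw [← this]
      simp only [neg_sub_neg]
    rw [this]
    refine (norm_sub_le _ _).trans ?_
    simp; norm_num
  have hvar : ‖w b‖ + ∑ n ∈ Finset.Ico a b, ‖w (n + 1) - w n‖ ≤ 1 / 2 + 3 / (4 * θ) := by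
    have h1 : ‖w b‖ ≤ 1 / 2 + 1 / (4 * θ) := by
      refine (norm_add_le _ _).trans ?_
      have := habs b hab' (by omega)
      have h2 : ‖(t b : ℂ) / 2 * Complex.I‖ = |t b| / 2 := by simp
      have h3 : ‖(1 / 2 : ℂ)‖ = 1 / 2 := by simp
      rw [h2, h3]
      have : 1 / (2 * θ) / 2 = 1 / (4 * θ) := by field_simp; norm_num
      linarith
    have h2 : ∑ n ∈ Finset.Ico a b, ‖w (n + 1) - w n‖ ≤ 1 / (2 * θ) := by
      have h3 : ∀ n ∈ Finset.Ico a b, ‖w (n + 1) - w n‖ = - (t (n + 1)) / 2 - - (t n) / 2 :=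
        fun n hn => by
          rw [Finset.mem_Ico] at hn
          have : w (n + 1) - w n = ((t (n + 1) - t n : ℝ) : ℂ) / 2 * Complex.I := by
            simp only [hw]; push_cast; ring
          rw [this]
          simp only [norm_mul, norm_div, Complex.norm_real, Complex.norm_I, mul_one,
            Real.norm_eq_abs, Complex.norm_ofNat]
          rw [abs_of_nonpos (by linarith [hanti n hn.1 hn.2])]
          ring
      rw [Finset.sum_congr rfl h3, Finset.sum_Ico_sub (fun n => - (t n) / 2) hab']
      have h4 := abs_le.1 (habs b hab' (by omega))
      have h5 := abs_le.1 (habs a le_rfl (by omega))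
      linarith
    have h3 : 3 / (4 * θ) = 1 / (4 * θ) + 1 / (2 * θ) := by field_simp; norm_num
    linarith
  have hmain := norm_sum_mul_le_of_variation w z hab' hz2 hvar
  rw [← Finset.sum_congr rfl hzw] at hmain
  refine (norm_add_le _ _).trans ?_
  rw [norm_e]
  have : 4 / θ = 3 / (2 * θ) + 5 / (2 * θ) := by field_simp; norm_num
  have h5 : 2 ≤ 5 / (2 * θ) := by rw [le_div_iff₀ (by positivity)]; linarith
  have h6 : (1 / 2 + 3 / (4 * θ)) * 2 = 1 + 3 / (2 * θ) := by field_simp; ring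
  linarith

lemma exists_eq_Ico_of_convex (s : Finset ℕ)
    (hs : ∀ a ∈ s, ∀ b ∈ s, ∀ c, a ≤ c → c ≤ b → c ∈ s) : ∃ a b, s = Finset.Ico a b := by
  rcases s.eq_empty_or_nonempty with rfl | hne
  · exact ⟨0, 0, by simp⟩
  refine ⟨s.min' hne, s.max' hne + 1, ?_⟩
  ext c
  rw [Finset.mem_Ico]
  constructor
  · intro hc
    exact ⟨s.min'_le c hc, Nat.lt_succ_of_le (s.le_max' c hc)⟩
  · rintro ⟨h1, h2⟩
    exact hs _ (s.min'_mem hne) _ (s.max'_mem hne) c h1 (by omega)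

end VanDerCorput

/-! ### Van der Corput's second derivative test -/

section VanDerCorput

lemma diff_bounds_of_step_bounds (g : ℕ → ℝ) {a b : ℕ} {lam Lam : ℝ}
    (h : ∀ n, a ≤ n → n < b → lam ≤ g (n + 1) - g n ∧ g (n + 1) - g n ≤ Lam)
    {m n : ℕ} (ham : a ≤ m) (hmn : m ≤ n) (hnb : n ≤ b) :
    lam * ((n : ℝ) - m) ≤ g n - g m ∧ g n - g m ≤ Lam * ((n : ℝ) - m) := by
  induction n, hmn using Nat.le_induction with
  | base => simp
  | succ n hmn ih =>
    have h1 := ih (by omega)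
    have h2 := h n (by omega) (by omega)
    push_cast
    constructor
    · linarith [h1.1, h2.1]
    · linarith [h1.2, h2.2]

/-- Consecutive values of g are at least lam apart, so an interval of length θ holds at most θ / lam
+ 1 of them. -/
lemma card_le_of_mem_short_interval (g : ℕ → ℝ) {a b : ℕ} {lam Lam : ℝ} (hlam : 0 < lam)
    (h : ∀ n, a ≤ n → n < b → lam ≤ g (n + 1) - g n ∧ g (n + 1) - g n ≤ Lam)
    {s : Finset ℕ} (hs : s ⊆ Finset.Ico a b) {u θ : ℝ}
    (hu : ∀ n ∈ s, u ≤ g n ∧ g n ≤ u + θ) (hθ : 0 ≤ θ) : (s.card : ℝ) ≤ θ / lam + 1 := by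
  rcases s.eq_empty_or_nonempty with rfl | hne
  · simp; positivity
  have hp := s.min'_mem hne
  have hq := s.max'_mem hne
  have hsub : s ⊆ Finset.Icc (s.min' hne) (s.max' hne) := fun c hc =>
    Finset.mem_Icc.2 ⟨s.min'_le c hc, s.le_max' c hc⟩
  have hpq : s.min' hne ≤ s.max' hne := s.min'_le _ hq
  have hp' := Finset.mem_Ico.1 (hs hp)
  have hq' := Finset.mem_Ico.1 (hs hq)
  have h1 := (diff_bounds_of_step_bounds g h hp'.1 hpq hq'.2.le).1
  have h2 : lam * ((s.max' hne : ℝ) - s.min' hne) ≤ θ := by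
    linarith [(hu _ hp).1, (hu _ hq).2]
  have h3 : (s.card : ℝ) ≤ (s.max' hne : ℝ) + 1 - s.min' hne := by
    have := Finset.card_le_card hsub
    rw [Nat.card_Icc] at this
    have h4 : s.card + s.min' hne ≤ s.max' hne + 1 := by omega
    have h5 : ((s.card + s.min' hne : ℕ) : ℝ) ≤ ((s.max' hne + 1 : ℕ) : ℝ) := by exact_mod_cast h4
    push_cast at h5
    linarith
  have h4 : (s.max' hne : ℝ) - s.min' hne ≤ θ / lam := by
    rw [le_div_iff₀ hlam]; linarith
  linarith

/-- The first differences increase with steps at least lam. Those within θ of j or j + 1 are few and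
are counted trivially. The others belong to an interval of indices, on which Kusmin–Landau applies
after f n is replaced by f n - j n; this does not change e(f n). -/
lemma norm_sum_e_le_of_floor_eq (f : ℕ → ℝ) {a b : ℕ} {lam Lam : ℝ} (hlam : 0 < lam)
    (h : ∀ n, a ≤ n → n < b → lam ≤ f (n + 2) - 2 * f (n + 1) + f n ∧
      f (n + 2) - 2 * f (n + 1) + f n ≤ Lam) {θ : ℝ} (hθ : 0 < θ) (hθ1 : θ ≤ 1 / 2) (j : ℤ) :
    ‖∑ n ∈ Finset.Ico a b with ⌊f (n + 1) - f n⌋ = j, e (f n)‖ ≤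
      2 * (θ / lam + 1) + 4 / θ := by
  set g : ℕ → ℝ := fun n => f (n + 1) - f n with hg
  have hstep : ∀ n, a ≤ n → n < b → lam ≤ g (n + 1) - g n ∧ g (n + 1) - g n ≤ Lam := by
    intro n h1 h2
    have := h n h1 h2
    simp only [hg]
    constructor <;> linarith [this.1, this.2]
  set S := (Finset.Ico a b).filter fun n => ⌊f (n + 1) - f n⌋ = j with hS
  have hSg : ∀ n ∈ S, (j : ℝ) ≤ g n ∧ g n < j + 1 := fun n hn => by
    have := (Finset.mem_filter.1 hn).2
    exact Int.floor_eq_iff.1 this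
  have hSab : S ⊆ Finset.Ico a b := Finset.filter_subset _ _
  set S1 := S.filter fun n => g n < j + θ
  set S2 := (S.filter fun n => ¬ g n < j + θ).filter fun n => g n ≤ j + 1 - θ with hS2
  set S3 := (S.filter fun n => ¬ g n < j + θ).filter fun n => ¬ g n ≤ j + 1 - θ
  have hsplit : ∑ n ∈ S, e (f n) = ∑ n ∈ S1, e (f n) + (∑ n ∈ S2, e (f n) + ∑ n ∈ S3, e (f n)) := by
    rw [Finset.sum_filter_add_sum_filter_not, Finset.sum_filter_add_sum_filter_not]
  have hcard : ∀ s : Finset ℕ, ‖∑ n ∈ s, e (f n)‖ ≤ s.card := fun s => by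
    refine (norm_sum_le _ _).trans ?_
    simp
  have h1 : ‖∑ n ∈ S1, e (f n)‖ ≤ θ / lam + 1 := by
    refine (hcard _).trans (card_le_of_mem_short_interval g hlam hstep
      ((Finset.filter_subset _ _).trans hSab) (u := j) (fun n hn => ?_) hθ.le)
    have h1 := Finset.mem_filter.1 hn
    exact ⟨(hSg n h1.1).1, h1.2.le⟩
  have h3 : ‖∑ n ∈ S3, e (f n)‖ ≤ θ / lam + 1 := by
    refine (hcard _).trans (card_le_of_mem_short_interval g hlam hstep
      (((Finset.filter_subset _ _).trans (Finset.filter_subset _ _)).trans hSab)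
      (u := j + 1 - θ) (fun n hn => ?_) hθ.le)
    have h1 := Finset.mem_filter.1 hn
    have h2 := hSg n (Finset.mem_filter.1 h1.1).1
    have h3 := not_le.1 h1.2
    exact ⟨h3.le, by linarith⟩
  have h2 : ‖∑ n ∈ S2, e (f n)‖ ≤ 4 / θ := by
    have hmem : ∀ n, n ∈ S2 ↔ (a ≤ n ∧ n < b) ∧ (j : ℝ) + θ ≤ g n ∧ g n ≤ j + 1 - θ := by
      intro n
      simp only [hS2, hS, Finset.mem_filter, Finset.mem_Ico, not_lt]
      constructor
      · rintro ⟨⟨⟨h1, -⟩, h2⟩, h3⟩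
        exact ⟨h1, h2, h3⟩
      · rintro ⟨h1, h2, h3⟩
        refine ⟨⟨⟨h1, ?_⟩, h2⟩, h3⟩
        rw [Int.floor_eq_iff]
        simp only [hg] at h2 h3
        constructor <;> linarith
    obtain ⟨p, q, hpq⟩ := exists_eq_Ico_of_convex S2 (by
      intro m hm n hn c hmc hcn
      rw [hmem] at hm hn ⊢
      have h1 := (diff_bounds_of_step_bounds g hstep hm.1.1 hmc (by omega)).1
      have h2 := (diff_bounds_of_step_bounds g hstep (by omega) hcn (by omega)).1
      have h3 : (0 : ℝ) ≤ (c : ℝ) - m := by rw [sub_nonneg]; exact_mod_cast hmc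
      have h4 : (0 : ℝ) ≤ (n : ℝ) - c := by rw [sub_nonneg]; exact_mod_cast hcn
      have h5 := mul_nonneg hlam.le h3
      have h6 := mul_nonneg hlam.le h4
      exact ⟨⟨by omega, by omega⟩, by linarith [hm.2.1], by linarith [hn.2.2]⟩)
    have hin : ∀ n, p ≤ n → n < q → (a ≤ n ∧ n < b) ∧ (j : ℝ) + θ ≤ g n ∧ g n ≤ j + 1 - θ :=
      fun n h1 h2 => by rw [← hmem, hpq, Finset.mem_Ico]; exact ⟨h1, h2⟩
    have heq : ∀ n ∈ Finset.Ico p q, e (f n) = e (f n - j * n) := fun n _ => by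
      have := e_sub_int (f n) (j * n)
      push_cast at this
      exact this.symm
    rw [hpq, Finset.sum_congr rfl heq]
    apply norm_sum_e_le_of_diff_mem (fun n => f n - j * n) hθ (by linarith)
    · intro n h1 h2
      have h3 := hin n h1 (by omega)
      have h4 := (hstep n h3.1.1 h3.1.2).1
      simp only [hg] at h4
      push_cast
      linarith
    · intro n h1 h2
      have := (hin n h1 h2).2
      simp only [hg] at this
      push_cast
      linarith [this.1]
    · intro n h1 h2
      have := (hin n h1 h2).2
      simp only [hg] at this
      push_cast
      linarith [this.2]
  rw [hsplit]
  calc _ ≤ ‖∑ n ∈ S1, e (f n)‖ + (‖∑ n ∈ S2, e (f n)‖ + ‖∑ n ∈ S3, e (f n)‖) :=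
        (norm_add_le _ _).trans (by gcongr; exact norm_add_le _ _)
    _ ≤ _ := by linarith

/-- The second derivative test of van der Corput, in terms of second differences. -/
lemma norm_sum_e_le_of_second_diff (f : ℕ → ℝ) {a b : ℕ} (hab : a ≤ b) {lam Lam : ℝ}
    (hlam : 0 < lam)
    (h : ∀ n, a ≤ n → n < b → lam ≤ f (n + 2) - 2 * f (n + 1) + f n ∧
      f (n + 2) - 2 * f (n + 1) + f n ≤ Lam) :
    ‖∑ n ∈ Finset.Ico a b, e (f n)‖ ≤ 22 * (Lam * (b - a) + 1) / √lam := by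
  have hs : 0 < √lam := Real.sqrt_pos.2 hlam
  have hs2 : √lam * √lam = lam := Real.mul_self_sqrt hlam.le
  rcases hab.eq_or_lt with rfl | hlt
  · simp; positivity
  have hba : (0 : ℝ) < b - a := by rw [sub_pos]; exact_mod_cast hlt
  have hLam : lam ≤ Lam := (h a le_rfl hlt).1.trans (h a le_rfl hlt).2
  -- For lam ≥ 1 the trivial bound b - a suffices, because Lam ≥ lam ≥ √lam.
  rcases le_or_gt 1 lam with h1 | h1
  · have hc : ‖∑ n ∈ Finset.Ico a b, e (f n)‖ ≤ b - a := by
      refine (norm_sum_le _ _).trans ?_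
      simp [Nat.cast_sub hab]
    refine hc.trans ?_
    rw [le_div_iff₀ hs]
    have h2 : √lam ≤ lam := by
      have : 1 ≤ √lam := by rw [Real.one_le_sqrt]; exact h1
      nlinarith
    nlinarith
  · set g : ℕ → ℝ := fun n => f (n + 1) - f n with hg
    have hstep : ∀ n, a ≤ n → n < b → lam ≤ g (n + 1) - g n ∧ g (n + 1) - g n ≤ Lam := by
      intro n h1 h2
      have := h n h1 h2
      simp only [hg]
      constructor <;> linarith [this.1, this.2]
    set J := Finset.Icc ⌊g a⌋ ⌊g a + Lam * (b - a)⌋ with hJ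
    have hmaps : ∀ n ∈ Finset.Ico a b, ⌊f (n + 1) - f n⌋ ∈ J := by
      intro n hn
      rw [Finset.mem_Ico] at hn
      have h2 := diff_bounds_of_step_bounds g hstep le_rfl hn.1 hn.2.le
      have h3 : (0 : ℝ) ≤ (n : ℝ) - a := by rw [sub_nonneg]; exact_mod_cast hn.1
      have h4 : (n : ℝ) ≤ b := by exact_mod_cast hn.2.le
      rw [hJ, Finset.mem_Icc]
      constructor
      · apply Int.floor_le_floor
        have := mul_nonneg hlam.le h3
        simp only [hg] at h2 ⊢
        linarith [h2.1]
      · apply Int.floor_le_floor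
        have : Lam * (n - a) ≤ Lam * (b - a) :=
          mul_le_mul_of_nonneg_left (by linarith) (hlam.le.trans hLam)
        simp only [hg] at h2 ⊢
        linarith [h2.2]
    rw [← Finset.sum_fiberwise_of_maps_to hmaps]
    have hJcard : (J.card : ℝ) ≤ Lam * (b - a) + 2 := by
      rw [hJ, Int.card_Icc]
      have hle : ⌊g a⌋ ≤ ⌊g a + Lam * (b - a)⌋ + 1 := by
        have : ⌊g a⌋ ≤ ⌊g a + Lam * (b - a)⌋ := by
          apply Int.floor_le_floor
          have := mul_nonneg (hlam.le.trans hLam) hba.le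
          linarith
        omega
      have : (((⌊g a + Lam * (b - a)⌋ + 1 - ⌊g a⌋).toNat : ℤ) : ℝ) =
          ((⌊g a + Lam * (b - a)⌋ + 1 - ⌊g a⌋ : ℤ) : ℝ) := by
        rw [Int.toNat_of_nonneg (by omega)]
      rw [Int.cast_natCast] at this
      rw [this]
      push_cast
      linarith [Int.floor_le (g a + Lam * (b - a)), Int.lt_floor_add_one (g a)]
    have hs1 : √lam ≤ 1 := by exact Real.sqrt_le_one.2 h1.le
    have hb : ∀ j ∈ J, ‖∑ n ∈ Finset.Ico a b with ⌊f (n + 1) - f n⌋ = j, e (f n)‖ ≤ 11 / √lam := by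
      intro j _
      -- A multiple of √lam balances θ / lam against 1 / θ; θ ≤ 1/2 holds because lam < 1 here.
      refine (norm_sum_e_le_of_floor_eq f hlam h (θ := √lam / 2) (by positivity)
        (by linarith) j).trans ?_
      have e1 : √lam / 2 / lam = 1 / (2 * √lam) := by
        rw [div_div, div_eq_div_iff (by positivity) (by positivity)]
        nlinarith
      rw [e1]
      have e2 : 1 ≤ 1 / √lam := by rw [le_div_iff₀ hs]; linarith
      have e3 : 2 * (1 / (2 * √lam) + 1) + 4 / (√lam / 2) = 2 + 9 * (1 / √lam) := by
        field_simp; ring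
      have e4 : 11 / √lam = 11 * (1 / √lam) := by ring
      rw [e3, e4]; linarith
    refine (norm_sum_le_of_le _ hb).trans ?_
    rw [Finset.sum_const, nsmul_eq_mul]
    calc (J.card : ℝ) * (11 / √lam) ≤ (Lam * (b - a) + 2) * (11 / √lam) := by gcongr
      _ ≤ (2 * (Lam * (b - a) + 1)) * (11 / √lam) := by
        gcongr
        have := mul_nonneg (hlam.le.trans hLam) hba.le
        linarith
      _ = _ := by ring

lemma norm_sum_e_neg (f : ℕ → ℝ) (s : Finset ℕ) :
    ‖∑ n ∈ s, e (-f n)‖ = ‖∑ n ∈ s, e (f n)‖ := by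
  rw [← RCLike.norm_conj (∑ n ∈ s, e (f n)), map_sum]
  simp_rw [conj_e]

lemma norm_sum_e_le_of_neg_second_diff (f : ℕ → ℝ) {a b : ℕ} (hab : a ≤ b) {lam Lam : ℝ}
    (hlam : 0 < lam)
    (h : ∀ n, a ≤ n → n < b → lam ≤ -(f (n + 2) - 2 * f (n + 1) + f n) ∧
      -(f (n + 2) - 2 * f (n + 1) + f n) ≤ Lam) :
    ‖∑ n ∈ Finset.Ico a b, e (f n)‖ ≤ 22 * (Lam * (b - a) + 1) / √lam := by
  rw [← norm_sum_e_neg]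
  apply norm_sum_e_le_of_second_diff _ hab hlam
  intro n h1 h2
  have := h n h1 h2
  constructor <;> linarith [this.1, this.2]

end VanDerCorput

/-! ### Second differences of the phases m φ(kl) and m (φ(k₁l) - φ(k₂l)) -/

/-- A second difference is a value of the second derivative. -/
lemma exists_second_diff_eq {f f' f'' : ℝ → ℝ} {a : ℝ}
    (h1 : ∀ t, a ≤ t → t ≤ a + 2 → HasDerivAt f (f' t) t)
    (h2 : ∀ t, a ≤ t → t ≤ a + 2 → HasDerivAt f' (f'' t) t) :
    ∃ t, a ≤ t ∧ t ≤ a + 2 ∧ f (a + 2) - 2 * f (a + 1) + f a = f'' t := by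
  -- The mean value theorem is used twice: for t ↦ f (t + 1) - f t on [a, a + 1], then for f' on [t,
  -- t + 1].
  have hD : ∀ t, a ≤ t → t ≤ a + 1 →
      HasDerivAt (fun t => f (t + 1) - f t) (f' (t + 1) - f' t) t := fun t ht ht' =>
    ((h1 (t + 1) (by linarith) (by linarith)).comp_add_const t 1).sub (h1 t ht (by linarith))
  obtain ⟨t, ht, h3⟩ := exists_hasDerivAt_eq_slope (fun t => f (t + 1) - f t)
    (fun t => f' (t + 1) - f' t) (show a < a + 1 by linarith)
    (fun t ht => (hD t ht.1 ht.2).continuousAt.continuousWithinAt)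
    (fun t ht => hD t ht.1.le ht.2.le)
  obtain ⟨s, hs, h4⟩ := exists_hasDerivAt_eq_slope f' f'' (show t < t + 1 by linarith)
    (fun u hu => (h2 u (by linarith [hu.1, ht.1]) (by linarith [hu.2, ht.2])).continuousAt.continuousWithinAt)
    (fun u hu => h2 u (by linarith [hu.1, ht.1]) (by linarith [hu.2, ht.2]))
  refine ⟨s, by linarith [hs.1, ht.1], by linarith [hs.2, ht.2], ?_⟩
  rw [h4]
  have e1 : t + 1 - t = 1 := by ring
  have e2 : a + 1 - a = 1 := by ring
  rw [e1, div_one]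
  rw [e2, div_one] at h3
  rw [h3]
  have : a + 1 + 1 = a + 2 := by ring
  rw [this]
  ring


/-- Bounds, up to factors `u ^ η`, for the derivatives of a phase that behaves like `u ^ (1 - y)`. -/
structure IsPhase (φ φ₁ φ₂ φ₃ : ℝ → ℝ) (X y η : ℝ) : Prop where
  one_le : 1 ≤ X
  y_nonneg : 0 ≤ y
  η_pos : 0 < η
  η_le : η ≤ 1
  hasDerivAt₁ : ∀ u, X ≤ u → HasDerivAt φ (φ₁ u) u
  hasDerivAt₂ : ∀ u, X ≤ u → HasDerivAt φ₁ (φ₂ u) u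
  hasDerivAt₃ : ∀ u, X ≤ u → HasDerivAt φ₂ (φ₃ u) u
  lower : ∀ u, X ≤ u → u ^ (-1 - y - η) ≤ -φ₂ u
  upper : ∀ u, X ≤ u → -φ₂ u ≤ u ^ (-1 + η)
  lower' : ∀ u, X ≤ u → u ^ (-y - η) ≤ -(2 * u * φ₂ u + u ^ 2 * φ₃ u)
  upper' : ∀ u, X ≤ u → -(2 * u * φ₂ u + u ^ 2 * φ₃ u) ≤ u ^ η

section Phase

variable {φ φ₁ φ₂ φ₃ : ℝ → ℝ} {X y η : ℝ}

/-- The linear term ξ l drops out of second differences. These carry a factor m k², and l runs over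
O(P / k) values, so k cancels in Lam (b - a) / √lam and the bound does not depend on it. The range
up to 3 P instead of 2 P accommodates blocks (Q / 2, Q] with the integer quotient. -/
lemma IsPhase.norm_sum_dilate_le (hφ : IsPhase φ φ₁ φ₂ φ₃ X y η) {P k m a b : ℕ} (hP : X ≤ P)
    (hk : 1 ≤ k) (hm : 1 ≤ m) (hl : ∀ l, a ≤ l → l < b → P ≤ k * l ∧ k * l ≤ 3 * P)
    {Y : ℝ} (hY : 9 * (P : ℝ) ≤ Y) (ξ : ℝ) :
    ‖∑ l ∈ Finset.Ico a b, e (m * φ (k * l) + ξ * l)‖ ≤ 132 * √m * Y ^ ((1 + y + 3 * η) / 2) := by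
  have hP1 : (1 : ℝ) ≤ P := hφ.one_le.trans hP
  have hY0 : (0 : ℝ) < Y := by linarith
  rcases le_or_gt b a with hba | hab
  · rw [Finset.Ico_eq_empty (by omega)]; simp; positivity
  have hk1 : (1 : ℝ) ≤ k := by exact_mod_cast hk
  have hm1 : (1 : ℝ) ≤ m := by exact_mod_cast hm
  have hη := hφ.η_pos
  have hy := hφ.y_nonneg
  set lam : ℝ := m * k ^ 2 * Y ^ (-1 - y - η) with hlam_def
  set Lam : ℝ := m * k ^ 2 * (P : ℝ) ^ (-1 + η) with hLam_def
  have hlam : 0 < lam := by positivity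
  have hba1 : (b : ℝ) - a ≤ 5 * P / k := by
    have h1 := (hl a le_rfl hab).1
    have h2 := (hl (b - 1) (by omega) (by omega)).2
    have h3 : k * (b - 1) + k ≤ 3 * P + 3 * P := by
      have : k * 1 ≤ k * (b - 1) := by
        apply Nat.mul_le_mul_left
        by_contra h0
        have : b - 1 = 0 := by omega
        have : a = 0 := by omega
        subst this
        have : (P : ℝ) ≤ 0 := by exact_mod_cast h1
        linarith
      omega
    rw [le_div_iff₀ (by positivity)]
    have h4 : k * (b - 1) + k = k * b := by
      obtain ⟨c, rfl⟩ : ∃ c, b = c + 1 := ⟨b - 1, by omega⟩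
      simp [mul_add]
    rw [h4] at h3
    have h5 : (k : ℝ) * b ≤ 3 * P + 3 * P := by exact_mod_cast h3
    have h6 : (P : ℝ) ≤ k * a := by exact_mod_cast h1
    nlinarith
  have hvdc := norm_sum_e_le_of_neg_second_diff (fun l : ℕ => m * φ (k * l) + ξ * l) hab.le
    (lam := lam) (Lam := Lam) hlam (by
    intro l h1 h2
    have hl' := hl l h1 h2
    have hlo : (P : ℝ) ≤ k * l := by exact_mod_cast hl'.1
    have hhi : (k : ℝ) * l ≤ 3 * P := by exact_mod_cast hl'.2
    have hl0 : (1 : ℝ) ≤ l := by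
      have : l ≠ 0 := by
        rintro rfl
        rw [Nat.cast_zero, mul_zero] at hlo
        linarith
      exact_mod_cast Nat.one_le_iff_ne_zero.2 this
    have hkt : ∀ t : ℝ, (l : ℝ) ≤ t → (P : ℝ) ≤ k * t := fun t ht =>
      hlo.trans (mul_le_mul_of_nonneg_left ht (by linarith))
    obtain ⟨t, ht1, ht2, ht⟩ := exists_second_diff_eq (a := (l : ℝ))
      (f := fun t => m * φ (k * t) + ξ * t)
      (f' := fun t => m * (k * φ₁ (k * t)) + ξ) (f'' := fun t => m * (k * (k * φ₂ (k * t))))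
      (fun t h _ => by
        have h5 := (hφ.hasDerivAt₁ (k * t) (hP.trans (hkt t h))).comp t ((hasDerivAt_id t).const_mul (k : ℝ))
        have h6 := (h5.const_mul (m : ℝ)).add ((hasDerivAt_id t).const_mul ξ)
        refine h6.congr_deriv ?_
        ring)
      (fun t h _ => by
        have h5 := (hφ.hasDerivAt₂ (k * t) (hP.trans (hkt t h))).comp t ((hasDerivAt_id t).const_mul (k : ℝ))
        have h6 := ((h5.const_mul (k : ℝ)).const_mul (m : ℝ)).add_const ξ
        refine h6.congr_deriv ?_
        ring)
    push_cast
    rw [ht]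
    have hu := hkt t ht1
    have huX := hP.trans hu
    have hu0 : (0 : ℝ) < k * t := by linarith
    -- The intermediate point satisfies t ≤ l + 2 ≤ 3 l; together with k l ≤ 3 P this explains the
    -- assumption 9 P ≤ Y.
    have huY : (k : ℝ) * t ≤ Y := by
      calc (k : ℝ) * t ≤ k * (3 * l) := by gcongr; linarith
        _ ≤ 9 * P := by linarith
        _ ≤ Y := hY
    have e1 : -((m : ℝ) * (k * (k * φ₂ (k * t)))) = m * k ^ 2 * -φ₂ (k * t) := by ring
    rw [e1]
    constructor
    · rw [hlam_def]
      gcongr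
      refine le_trans ?_ (hφ.lower _ huX)
      exact Real.rpow_le_rpow_of_nonpos hu0 huY (by linarith)
    · rw [hLam_def]
      gcongr
      refine (hφ.upper _ huX).trans ?_
      exact Real.rpow_le_rpow_of_nonpos (by linarith) hu (by linarith [hφ.η_le]))
  refine hvdc.trans ?_
  have hY1 : 1 ≤ Y := by linarith
  have hsq : √lam = √m * k * Y ^ ((-1 - y - η) / 2) := by
    rw [hlam_def, Real.sqrt_mul (by positivity), Real.sqrt_mul (by positivity),
      Real.sqrt_sq (by positivity), Real.sqrt_eq_rpow (Y ^ _), ← Real.rpow_mul hY0.le]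
    ring_nf
  have hYη : 1 ≤ Y ^ η := Real.one_le_rpow hY1 hη.le
  have hnum : Lam * (b - a) + 1 ≤ 6 * m * k * Y ^ η := by
    have h1 : Lam * (b - a) ≤ 5 * m * k * Y ^ η := by
      calc Lam * (b - a) ≤ Lam * (5 * P / k) := by gcongr
        _ = 5 * m * k * ((P : ℝ) ^ (-1 + η) * P) := by rw [hLam_def]; field_simp
        _ = 5 * m * k * (P : ℝ) ^ η := by
          rw [← Real.rpow_add_one (by linarith)]; ring_nf
        _ ≤ _ := by gcongr; linarith
    have h2 : (1 : ℝ) ≤ m * k * Y ^ η := by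
      have := mul_le_mul hm1 hk1 zero_le_one (by linarith)
      nlinarith
    linarith
  have hsm : √(m : ℝ) * √(m : ℝ) = m := Real.mul_self_sqrt (by positivity)
  rw [div_le_iff₀ (by rw [hsq]; positivity), hsq]
  calc 22 * (Lam * (b - a) + 1) ≤ 22 * (6 * m * k * Y ^ η) := by gcongr
    _ = 132 * (√(m : ℝ) * √(m : ℝ)) * k * Y ^ η := by rw [hsm]; ring
    _ = 132 * (√(m : ℝ) * √(m : ℝ)) * k * (Y ^ ((1 + y + 3 * η) / 2) * Y ^ ((-1 - y - η) / 2)) := by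
      rw [← Real.rpow_add hY0]; congr 2; ring
    _ = _ := by ring

/-- With G(u) = u² φ''(u), the second derivative of φ(k₁t) - φ(k₂t) is (G(k₁t) - G(k₂t)) / t², and
the mean value theorem makes it (k₁ - k₂) G'(u) / t. The fields `lower'` and `upper'` are bounds for
-G', so second differences have size m (k₁ - k₂) / L up to powers Y ^ y and Y ^ η. -/
lemma IsPhase.norm_sum_dilate_sub_le (hφ : IsPhase φ φ₁ φ₂ φ₃ X y η) {L N m h k₁ k₂ a b : ℕ}
    (hL : 1 ≤ L) (hm : 1 ≤ m) (hh : 1 ≤ h) (hk₂ : 1 ≤ k₂) (hk : k₂ < k₁) (hkh : k₁ ≤ k₂ + h)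
    (hl : ∀ l, a ≤ l → l < b → L ≤ l ∧ l ≤ 3 * L ∧ X ≤ k₂ * l ∧ k₁ * l ≤ N)
    {Y : ℝ} (hY : 3 * (N : ℝ) ≤ Y) (hY1 : 1 ≤ Y) (ξ : ℝ) :
    ‖∑ l ∈ Finset.Ico a b, e (m * (φ (k₁ * l) - φ (k₂ * l)) + ξ * l)‖ ≤
      264 * √(m * h * L) * Y ^ ((y + 3 * η) / 2) := by
  have hY0 : (0 : ℝ) < Y := by linarith
  rcases le_or_gt b a with hba | hab
  · rw [Finset.Ico_eq_empty (by omega)]; simp; positivity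
  have hm1 : (1 : ℝ) ≤ m := by exact_mod_cast hm
  have hh1 : (1 : ℝ) ≤ h := by exact_mod_cast hh
  have hL1 : (1 : ℝ) ≤ L := by exact_mod_cast hL
  have hk21 : (1 : ℝ) ≤ k₂ := by exact_mod_cast hk₂
  have hk' : (k₂ : ℝ) < k₁ := by exact_mod_cast hk
  have hη := hφ.η_pos
  have hy := hφ.y_nonneg
  have hX := hφ.one_le
  set d : ℝ := k₁ - k₂ with hd_def
  have hd1 : 1 ≤ d := by
    have : ((k₂ + 1 : ℕ) : ℝ) ≤ k₁ := by exact_mod_cast hk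
    push_cast at this
    linarith
  have hdh : d ≤ h := by
    have : (k₁ : ℝ) ≤ (k₂ + h : ℕ) := by exact_mod_cast hkh
    push_cast at this
    linarith
  set lam : ℝ := m * d * Y ^ (-y - η) / (5 * L) with hlam_def
  set Lam : ℝ := m * d * Y ^ η / L with hLam_def
  have hlam : 0 < lam := by positivity
  have hba1 : (b : ℝ) - a ≤ 3 * L := by
    have h1 := (hl a le_rfl hab).1
    have h2 := (hl (b - 1) (by omega) (by omega)).2.1
    have : (b : ℝ) ≤ (3 * L + a : ℕ) := by exact_mod_cast (by omega)
    push_cast at this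
    linarith
  have hvdc := norm_sum_e_le_of_neg_second_diff
    (fun l : ℕ => m * (φ (k₁ * l) - φ (k₂ * l)) + ξ * l) hab.le (lam := lam) (Lam := Lam) hlam (by
    intro l h1 h2
    obtain ⟨hlL, hl3, hlX, hlN⟩ := hl l h1 h2
    have hlL' : (L : ℝ) ≤ l := by exact_mod_cast hlL
    have hl3' : (l : ℝ) ≤ 3 * L := by exact_mod_cast hl3
    have hlN' : (k₁ : ℝ) * l ≤ N := by exact_mod_cast hlN
    have hkt : ∀ t : ℝ, (l : ℝ) ≤ t → X ≤ k₂ * t := fun t ht =>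
      hlX.trans (mul_le_mul_of_nonneg_left ht (by linarith))
    have hkt' : ∀ t : ℝ, (l : ℝ) ≤ t → X ≤ k₁ * t := fun t ht =>
      (hkt t ht).trans (mul_le_mul_of_nonneg_right hk'.le (by linarith))
    obtain ⟨t, ht1, ht2, ht⟩ := exists_second_diff_eq (a := (l : ℝ))
      (f := fun t => m * (φ (k₁ * t) - φ (k₂ * t)) + ξ * t)
      (f' := fun t => m * (k₁ * φ₁ (k₁ * t) - k₂ * φ₁ (k₂ * t)) + ξ)
      (f'' := fun t => m * (k₁ * (k₁ * φ₂ (k₁ * t)) - k₂ * (k₂ * φ₂ (k₂ * t))))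
      (fun t h _ => by
        have h5 := (hφ.hasDerivAt₁ (k₁ * t) (hkt' t h)).comp t
          ((hasDerivAt_id t).const_mul (k₁ : ℝ))
        have h5' := (hφ.hasDerivAt₁ (k₂ * t) (hkt t h)).comp t
          ((hasDerivAt_id t).const_mul (k₂ : ℝ))
        have h6 := ((h5.sub h5').const_mul (m : ℝ)).add ((hasDerivAt_id t).const_mul ξ)
        refine h6.congr_deriv ?_
        ring)
      (fun t h _ => by
        have h5 := (hφ.hasDerivAt₂ (k₁ * t) (hkt' t h)).comp t
          ((hasDerivAt_id t).const_mul (k₁ : ℝ))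
        have h5' := (hφ.hasDerivAt₂ (k₂ * t) (hkt t h)).comp t
          ((hasDerivAt_id t).const_mul (k₂ : ℝ))
        have h6 := (((h5.const_mul (k₁ : ℝ)).sub (h5'.const_mul (k₂ : ℝ))).const_mul
          (m : ℝ)).add_const ξ
        refine h6.congr_deriv ?_
        ring)
    have ht0 : 0 < t := by linarith
    have hlt : (k₂ : ℝ) * t < k₁ * t := mul_lt_mul_of_pos_right hk' ht0
    have hder : ∀ u, k₂ * t ≤ u → HasDerivAt (fun u => u ^ 2 * φ₂ u)
        (2 * u * φ₂ u + u ^ 2 * φ₃ u) u := fun u hu => by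
      have := (hasDerivAt_pow 2 u).mul (hφ.hasDerivAt₃ u ((hkt t ht1).trans hu))
      refine this.congr_deriv ?_
      simp
    obtain ⟨u, hu, hu3⟩ := exists_hasDerivAt_eq_slope (fun u => u ^ 2 * φ₂ u)
      (fun u => 2 * u * φ₂ u + u ^ 2 * φ₃ u) hlt
      (fun u hu => (hder u hu.1).continuousAt.continuousWithinAt)
      (fun u hu => hder u hu.1.le)
    push_cast
    rw [ht]
    have huX : X ≤ u := (hkt t ht1).trans hu.1.le
    have hu0 : 0 < u := by linarith
    have huY : u ≤ Y := by
      calc u ≤ k₁ * t := hu.2.le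
        _ ≤ k₁ * (3 * l) := by gcongr; linarith
        _ ≤ 3 * N := by linarith
        _ ≤ Y := hY
    have e1 : -((m : ℝ) * (k₁ * (k₁ * φ₂ (k₁ * t)) - k₂ * (k₂ * φ₂ (k₂ * t)))) =
        m * d * -(2 * u * φ₂ u + u ^ 2 * φ₃ u) / t := by
      have hd0 : (k₁ : ℝ) - k₂ ≠ 0 := by linarith
      rw [hu3, hd_def, show (k₁ : ℝ) * t - k₂ * t = (k₁ - k₂) * t by ring]
      field_simp
    rw [e1]
    constructor
    · rw [hlam_def]
      have hb : Y ^ (-y - η) ≤ -(2 * u * φ₂ u + u ^ 2 * φ₃ u) :=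
        (Real.rpow_le_rpow_of_nonpos hu0 huY (by linarith)).trans (hφ.lower' u huX)
      have h0 : (0 : ℝ) < Y ^ (-y - η) := by positivity
      exact div_le_div₀ (mul_nonneg (by positivity) (h0.le.trans hb)) (by gcongr) ht0 (by linarith)
    · rw [hLam_def]
      have hb : -(2 * u * φ₂ u + u ^ 2 * φ₃ u) ≤ Y ^ η :=
        (hφ.upper' u huX).trans (Real.rpow_le_rpow hu0.le huY hη.le)
      apply div_le_div₀ (by positivity) (by gcongr) (by positivity) (by linarith))
  refine hvdc.trans ?_
  have hYη : 1 ≤ Y ^ η := Real.one_le_rpow hY1 hη.le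
  have hnum : Lam * (b - a) + 1 ≤ 4 * (m * d) * Y ^ η := by
    have h1 : Lam * (b - a) ≤ 3 * (m * d) * Y ^ η := by
      calc Lam * (b - a) ≤ Lam * (3 * L) := by gcongr
        _ = 3 * (m * d) * Y ^ η := by rw [hLam_def]; field_simp
    have h2 : (1 : ℝ) ≤ m * d := by nlinarith
    nlinarith
  have hsq : √lam * (√(5 * L) * Y ^ ((y + η) / 2)) = √(m * d) := by
    have e2 : Y ^ ((y + η) / 2) = √(Y ^ (y + η)) := by
      rw [Real.sqrt_eq_rpow, ← Real.rpow_mul hY0.le]; ring_nf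
    rw [e2, ← Real.sqrt_mul (by positivity), ← Real.sqrt_mul hlam.le]
    congr 1
    rw [hlam_def]
    have : Y ^ (-y - η) * Y ^ (y + η) = 1 := by rw [← Real.rpow_add hY0]; simp
    field_simp
    linear_combination this
  have hmd : √((m : ℝ) * d) * √((m : ℝ) * d) = m * d := Real.mul_self_sqrt (by positivity)
  have hsl : 0 < √lam := Real.sqrt_pos.2 hlam
  rw [div_le_iff₀ hsl]
  have h5 : √(5 * (L : ℝ)) ≤ 3 * √L := by
    rw [Real.sqrt_mul (by norm_num)]
    gcongr
    rw [Real.sqrt_le_left (by norm_num)]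
    norm_num
  calc 22 * (Lam * (b - a) + 1) ≤ 22 * (4 * (m * d) * Y ^ η) := by gcongr
    _ = 88 * √(m * d) * (√lam * (√(5 * L) * Y ^ ((y + η) / 2))) * Y ^ η := by
      rw [hsq, mul_assoc 88, hmd]; ring
    _ = 88 * √(m * d) * √(5 * L) * (Y ^ ((y + η) / 2) * Y ^ η) * √lam := by ring
    _ = 88 * √(m * d) * √(5 * L) * Y ^ ((y + 3 * η) / 2) * √lam := by
      rw [← Real.rpow_add hY0]; congr 3; ring
    _ ≤ 88 * √(m * h) * (3 * √L) * Y ^ ((y + 3 * η) / 2) * √lam := by gcongr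
    _ = 264 * √(m * h * L) * Y ^ ((y + 3 * η) / 2) * √lam := by
      rw [Real.sqrt_mul (by positivity) (L : ℝ)]; ring

end Phase

/-! ### Type II sums over a dyadic block -/

/-- The twisted exponential `e(m φ(n) + ξ n)`. -/
noncomputable def phase (φ : ℝ → ℝ) (m : ℕ) (ξ : ℝ) (n : ℕ) : ℂ := e (m * φ n + ξ * n)

@[simp] lemma norm_phase (φ : ℝ → ℝ) (m : ℕ) (ξ : ℝ) (n : ℕ) : ‖phase φ m ξ n‖ = 1 := norm_e _

/-- Opening the square and exchanging the sums puts the long variable l innermost, where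
cancellation is available. -/
lemma sum_norm_sq_sum_le {ι κ : Type*} (s : Finset ι) (t : Finset κ) (c : κ → ι → ℂ) :
    ∑ l ∈ s, ‖∑ k ∈ t, c k l‖ ^ 2 ≤
      ∑ k₁ ∈ t, ∑ k₂ ∈ t, ‖∑ l ∈ s, c k₁ l * (starRingEnd ℂ) (c k₂ l)‖ := by
  have h1 : ((∑ l ∈ s, ‖∑ k ∈ t, c k l‖ ^ 2 : ℝ) : ℂ) =
      ∑ k₁ ∈ t, ∑ k₂ ∈ t, ∑ l ∈ s, c k₁ l * (starRingEnd ℂ) (c k₂ l) := by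
    push_cast
    simp_rw [← Complex.mul_conj', map_sum, Finset.sum_mul_sum]
    rw [Finset.sum_comm]
    refine Finset.sum_congr rfl fun k₁ _ => ?_
    rw [Finset.sum_comm]
  have h2 : 0 ≤ ∑ l ∈ s, ‖∑ k ∈ t, c k l‖ ^ 2 := Finset.sum_nonneg fun _ _ => by positivity
  rw [← abs_of_nonneg h2, ← Real.norm_eq_abs, ← Complex.norm_real, h1]
  refine (norm_sum_le _ _).trans (Finset.sum_le_sum fun k₁ _ => norm_sum_le _ _)

/-- Cauchy–Schwarz after cutting the range of `k` into blocks of length `H`. -/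
lemma norm_sq_bilinear_le (s : Finset ℕ) {R H : ℕ} (hH : 1 ≤ H) (hHR : H ≤ R) (a : ℕ → ℂ)
    (c : ℕ → ℕ → ℂ) {A D W : ℝ} (ha : ∀ l ∈ s, ‖a l‖ ≤ A) (hW0 : 0 ≤ W)
    (hD : ∀ k, ‖∑ l ∈ s, c k l * (starRingEnd ℂ) (c k l)‖ ≤ D)
    (hW : ∀ k₁ k₂, 1 ≤ k₂ → k₂ < k₁ → k₁ ≤ R → k₁ ≤ k₂ + H →
      ‖∑ l ∈ s, c k₁ l * (starRingEnd ℂ) (c k₂ l)‖ ≤ W) :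
    ‖∑ l ∈ s, a l * ∑ k ∈ Finset.Ioc 0 R, c k l‖ ^ 2 ≤
      A ^ 2 * s.card * (2 * R / H) * (R * (D + H * W)) := by
  have hHpos : (0 : ℝ) < H := by exact_mod_cast hH
  -- Two members of one block k / H = j differ by less than H. After the square is opened, the
  -- diagonal is bounded by D and every other pair by W, with no pair of distant k to treat.
  set J := Finset.range (R / H + 1) with hJ
  set blk : ℕ → Finset ℕ := fun j => (Finset.Ioc 0 R).filter fun k => k / H = j with hblk
  have hmaps : ∀ k ∈ Finset.Ioc 0 R, k / H ∈ J := fun k hk => by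
    rw [hJ, Finset.mem_range, Nat.lt_succ_iff]
    exact Nat.div_le_div_right (Finset.mem_Ioc.1 hk).2
  have hsplit : ∑ l ∈ s, a l * ∑ k ∈ Finset.Ioc 0 R, c k l =
      ∑ p ∈ s ×ˢ J, a p.1 * ∑ k ∈ blk p.2, c k p.1 := by
    rw [Finset.sum_product]
    refine Finset.sum_congr rfl fun l _ => ?_
    change _ = ∑ j ∈ J, a l * ∑ k ∈ blk j, c k l
    rw [← Finset.mul_sum, Finset.sum_fiberwise_of_maps_to hmaps]
  have hcs : ‖∑ l ∈ s, a l * ∑ k ∈ Finset.Ioc 0 R, c k l‖ ^ 2 ≤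
      (∑ p ∈ s ×ˢ J, ‖a p.1‖ ^ 2) * ∑ p ∈ s ×ˢ J, ‖∑ k ∈ blk p.2, c k p.1‖ ^ 2 := by
    rw [hsplit]
    refine le_trans ?_ (Finset.sum_mul_sq_le_sq_mul_sq _ _ _)
    gcongr
    refine (norm_sum_le _ _).trans (le_of_eq ?_)
    exact Finset.sum_congr rfl fun p _ => norm_mul _ _
  have hJcard : (J.card : ℝ) ≤ 2 * R / H := by
    rw [hJ, Finset.card_range]
    have h1 : (((R / H : ℕ) : ℝ)) ≤ R / H := Nat.cast_div_le
    have h2 : (1 : ℝ) ≤ R / H := by rw [le_div_iff₀ hHpos, one_mul]; exact_mod_cast hHR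
    have h3 : (2 : ℝ) * R / H = R / H + R / H := by ring
    push_cast
    linarith
  have hfirst : ∑ p ∈ s ×ˢ J, ‖a p.1‖ ^ 2 ≤ A ^ 2 * s.card * (2 * R / H) := by
    calc ∑ p ∈ s ×ˢ J, ‖a p.1‖ ^ 2 ≤ ∑ p ∈ s ×ˢ J, A ^ 2 := by
          refine Finset.sum_le_sum fun p hp => ?_
          have := ha p.1 (Finset.mem_product.1 hp).1
          gcongr
      _ = A ^ 2 * s.card * J.card := by
          rw [Finset.sum_const, Finset.card_product, nsmul_eq_mul]; push_cast; ring
      _ ≤ _ := by gcongr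
  have hD0 : 0 ≤ D := (norm_nonneg _).trans (hD 0)
  have hoff : ∀ j, ∀ k₁ ∈ blk j, ∀ k₂ ∈ blk j, k₁ ≠ k₂ →
      ‖∑ l ∈ s, c k₁ l * (starRingEnd ℂ) (c k₂ l)‖ ≤ W := by
    intro j k₁ h1 k₂ h2 hne
    simp only [hblk, Finset.mem_filter, Finset.mem_Ioc] at h1 h2
    have hd1 := Nat.div_add_mod k₁ H
    have hd2 := Nat.div_add_mod k₂ H
    have hm1 := Nat.mod_lt k₁ hH
    have hm2 := Nat.mod_lt k₂ hH
    rw [h1.2] at hd1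
    rw [h2.2] at hd2
    rcases lt_or_gt_of_ne hne with hlt | hlt
    · rw [← RCLike.norm_conj, map_sum]
      simp_rw [map_mul, Complex.conj_conj, mul_comm ((starRingEnd ℂ) _)]
      exact hW k₂ k₁ (by omega) hlt (by omega) (by omega)
    · exact hW k₁ k₂ (by omega) hlt (by omega) (by omega)
  have hblkcard : ∀ j, ((blk j).card : ℝ) ≤ H := by
    intro j
    have : blk j ⊆ Finset.Ico (j * H) (j * H + H) := by
      intro k hk
      simp only [hblk, Finset.mem_filter, Finset.mem_Ioc] at hk
      have h1 := Nat.div_add_mod k H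
      have h2 := Nat.mod_lt k hH
      rw [hk.2, mul_comm] at h1
      rw [Finset.mem_Ico]
      omega
    have := Finset.card_le_card this
    rw [Nat.card_Ico, Nat.add_sub_cancel_left] at this
    exact_mod_cast this
  have hsecond : ∑ p ∈ s ×ˢ J, ‖∑ k ∈ blk p.2, c k p.1‖ ^ 2 ≤ R * (D + H * W) := by
    rw [Finset.sum_product_right]
    calc ∑ j ∈ J, ∑ l ∈ s, ‖∑ k ∈ blk j, c k l‖ ^ 2
        ≤ ∑ j ∈ J, ((blk j).card : ℝ) * (D + H * W) := by
          refine Finset.sum_le_sum fun j _ => (sum_norm_sq_sum_le s (blk j) c).trans ?_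
          rw [← nsmul_eq_mul]
          refine Finset.sum_le_card_nsmul _ _ _ fun k₁ hk₁ => ?_
          rw [← Finset.add_sum_erase _ _ hk₁]
          refine add_le_add (hD k₁) ?_
          refine (Finset.sum_le_card_nsmul _ _ W fun k₂ hk₂ => ?_).trans ?_
          · rw [Finset.mem_erase] at hk₂
            exact hoff j k₁ hk₁ k₂ hk₂.2 hk₂.1.symm
          · rw [nsmul_eq_mul]
            refine mul_le_mul_of_nonneg_right (le_trans ?_ (hblkcard j)) hW0
            exact_mod_cast Finset.card_erase_le
      _ = R * (D + H * W) := by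
          rw [← Finset.sum_mul]
          congr 1
          have := Finset.card_eq_sum_card_fiberwise hmaps
          rw [Nat.card_Ioc] at this
          rw [← Nat.cast_sum, ← this]; simp
  calc _ ≤ _ := hcs
    _ ≤ _ := by gcongr

section Bilinear

variable {φ φ₁ φ₂ φ₃ : ℝ → ℝ} {X y η : ℝ}

/-- Type II sums over a dyadic range of the long variable `l`. -/
lemma IsPhase.norm_sq_type_II_le (hφ : IsPhase φ φ₁ φ₂ φ₃ X y η) {L Q R H P P' N m : ℕ}
    (hL : 1 ≤ L) (hQ : Q ≤ 2 * L + 1) (hH : 1 ≤ H) (hHR : H ≤ R) (hm : 1 ≤ m) (hP : X ≤ P)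
    (hP' : P' ≤ N) (a b : ℕ → ℂ) {A : ℝ} (ha : ∀ l, 1 ≤ l → l ≤ N → ‖a l‖ ≤ A)
    (hb : ∀ k, 1 ≤ k → k ≤ N → ‖b k‖ ≤ A) {Y : ℝ} (hY : 3 * (N : ℝ) ≤ Y) (hY1 : 1 ≤ Y) (ξ : ℝ) :
    ‖∑ l ∈ Finset.Ioc L Q, ∑ k ∈ Finset.Ioc 0 R,
        if P < k * l ∧ k * l ≤ P' then a l * b k * phase φ m ξ (k * l) else 0‖ ^ 2 ≤
      8 * A ^ 4 * ((R * L) ^ 2 / H + R ^ 2 * L * (264 * √(m * H * L) * Y ^ ((y + 3 * η) / 2))) := by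
  set W : ℝ := 264 * √(m * H * L) * Y ^ ((y + 3 * η) / 2) with hWdef
  have hW0 : 0 ≤ W := by positivity
  have hHpos : (0 : ℝ) < H := by exact_mod_cast hH
  set c : ℕ → ℕ → ℂ := fun k l =>
    if 1 ≤ k ∧ P < k * l ∧ k * l ≤ P' then b k * phase φ m ξ (k * l) else 0 with hc
  -- The range of l may go past N, where a is not controlled; the summation condition fails there,
  -- since l ≤ k l ≤ P' ≤ N.
  set a' : ℕ → ℂ := fun l => if l ≤ N then a l else 0 with ha'
  have hrew : ∑ l ∈ Finset.Ioc L Q, ∑ k ∈ Finset.Ioc 0 R,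
        (if P < k * l ∧ k * l ≤ P' then a l * b k * phase φ m ξ (k * l) else 0) =
      ∑ l ∈ Finset.Ioc L Q, a' l * ∑ k ∈ Finset.Ioc 0 R, c k l := by
    refine Finset.sum_congr rfl fun l hl => ?_
    rw [Finset.mul_sum]
    refine Finset.sum_congr rfl fun k hk => ?_
    have hk1 : 1 ≤ k := (Finset.mem_Ioc.1 hk).1
    simp only [hc, ha', hk1, true_and]
    split_ifs with h1 h2
    · ring
    · exfalso
      have : l ≤ k * l := Nat.le_mul_of_pos_left l hk1
      omega
    · simp
    · simp
  rw [hrew]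
  have hA0 : P' = 0 ∨ 0 ≤ A := by
    rcases Nat.eq_zero_or_pos P' with h | h
    · exact Or.inl h
    · exact Or.inr ((norm_nonneg _).trans (ha 1 le_rfl (by omega)))
  have hX := hφ.one_le
  rcases hA0 with h0 | hA0
  · have : ∀ k l, c k l = 0 := fun k l => by
      simp only [hc]
      rw [if_neg]
      rintro ⟨-, h1, h2⟩
      omega
    simp [this]
    positivity
  have hcn : ∀ k l, ‖c k l‖ ≤ A := by
    intro k l
    simp only [hc]
    split_ifs with h
    · rw [norm_mul, norm_phase, mul_one]
      refine hb k h.1 ?_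
      have : l ≠ 0 := by rintro rfl; simp at h
      have : k ≤ k * l := Nat.le_mul_of_pos_right k (by omega)
      omega
    · simpa using hA0
  have ha'n : ∀ l ∈ Finset.Ioc L Q, ‖a' l‖ ≤ A := by
    intro l hl
    have := Finset.mem_Ioc.1 hl
    simp only [ha']
    split_ifs with h
    · exact ha l (by omega) h
    · simpa using hA0
  have hcard : ((Finset.Ioc L Q).card : ℝ) ≤ 2 * L := by
    rw [Nat.card_Ioc]
    exact_mod_cast (by omega : Q - L ≤ 2 * L)
  have hD : ∀ k, ‖∑ l ∈ Finset.Ioc L Q, c k l * (starRingEnd ℂ) (c k l)‖ ≤ 2 * L * A ^ 2 := by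
    intro k
    refine (norm_sum_le _ _).trans ?_
    calc ∑ l ∈ Finset.Ioc L Q, ‖c k l * (starRingEnd ℂ) (c k l)‖
        ≤ ∑ l ∈ Finset.Ioc L Q, A ^ 2 := by
          refine Finset.sum_le_sum fun l _ => ?_
          rw [norm_mul, RCLike.norm_conj, pow_two]
          exact mul_le_mul (hcn k l) (hcn k l) (norm_nonneg _) hA0
      _ ≤ _ := by rw [Finset.sum_const, nsmul_eq_mul]; gcongr
  have hW : ∀ k₁ k₂, 1 ≤ k₂ → k₂ < k₁ → k₁ ≤ R → k₁ ≤ k₂ + H →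
      ‖∑ l ∈ Finset.Ioc L Q, c k₁ l * (starRingEnd ℂ) (c k₂ l)‖ ≤ A ^ 2 * W := by
    intro k₁ k₂ h1 h2 h3 h4
    -- As k₂ < k₁, the four range conditions on k₁ l and k₂ l reduce to these two, which cut out an
    -- interval of l.
    set S := (Finset.Ioc L Q).filter fun l => P < k₂ * l ∧ k₁ * l ≤ P' with hS
    have hmono : ∀ l, k₂ * l ≤ k₁ * l := fun l => Nat.mul_le_mul_right l h2.le
    have e1 : ∑ l ∈ Finset.Ioc L Q, c k₁ l * (starRingEnd ℂ) (c k₂ l) =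
        b k₁ * (starRingEnd ℂ) (b k₂) *
          ∑ l ∈ S, e (m * (φ (k₁ * l) - φ (k₂ * l)) + ξ * (k₁ - k₂) * l) := by
      rw [hS, Finset.sum_filter, Finset.mul_sum]
      refine Finset.sum_congr rfl fun l _ => ?_
      have := hmono l
      by_cases hcond : P < k₂ * l ∧ k₁ * l ≤ P'
      · rw [if_pos hcond]
        simp only [hc]
        rw [if_pos ⟨by omega, by omega, hcond.2⟩, if_pos ⟨h1, hcond.1, by omega⟩, map_mul, phase,
          phase, conj_e]
        have : e (m * (φ (k₁ * l) - φ (k₂ * l)) + ξ * (k₁ - k₂) * l) =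
            e (m * φ ((k₁ * l : ℕ) : ℝ) + ξ * ((k₁ * l : ℕ) : ℝ)) *
              e (-(m * φ ((k₂ * l : ℕ) : ℝ) + ξ * ((k₂ * l : ℕ) : ℝ))) := by
          rw [← e_add]; congr 1; push_cast; ring
        rw [this]; ring
      · rw [if_neg hcond, mul_zero]
        by_cases h5 : P < k₂ * l
        · have : ¬ (1 ≤ k₁ ∧ P < k₁ * l ∧ k₁ * l ≤ P') := by
            rintro ⟨-, -, h⟩; exact hcond ⟨h5, h⟩
          simp only [hc, if_neg this, zero_mul]
        · have : ¬ (1 ≤ k₂ ∧ P < k₂ * l ∧ k₂ * l ≤ P') := by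
            rintro ⟨-, h, -⟩; exact h5 h
          simp only [hc, if_neg this, map_zero, mul_zero]
    have hmem : ∀ l, l ∈ S ↔ (L < l ∧ l ≤ Q) ∧ P < k₂ * l ∧ k₁ * l ≤ P' := fun l => by
      rw [hS, Finset.mem_filter, Finset.mem_Ioc]
    rcases S.eq_empty_or_nonempty with hemp | ⟨l₀, hl₀⟩
    · rw [e1, hemp]; simp; positivity
    obtain ⟨p, q, hpq⟩ := exists_eq_Ico_of_convex S (by
      intro u hu v hv w huw hwv
      rw [hmem] at hu hv ⊢
      have h5 : k₂ * u ≤ k₂ * w := Nat.mul_le_mul_left _ huw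
      have h6 : k₁ * w ≤ k₁ * v := Nat.mul_le_mul_left _ hwv
      omega)
    have hkN : ∀ k, 1 ≤ k → k ≤ k₁ → k ≤ N := by
      intro k _ hk
      have h5 := (hmem l₀).1 hl₀
      have : k₁ ≤ k₁ * l₀ := Nat.le_mul_of_pos_right _ (by omega)
      omega
    have hsum : ‖∑ l ∈ S, e (m * (φ (k₁ * l) - φ (k₂ * l)) + ξ * (k₁ - k₂) * l)‖ ≤ W := by
      rw [hpq]
      refine hφ.norm_sum_dilate_sub_le hL hm hH h1 h2 h4 (N := N) (fun l h5 h6 => ?_) hY hY1 _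
      have : l ∈ S := by rw [hpq, Finset.mem_Ico]; exact ⟨h5, h6⟩
      rw [hmem] at this
      refine ⟨by omega, by omega, hP.trans ?_, by omega⟩
      exact_mod_cast this.2.1.le
    rw [e1, norm_mul, norm_mul, RCLike.norm_conj, pow_two]
    have hb1 := hb k₁ (by omega) (hkN k₁ (by omega) le_rfl)
    have hb2 := hb k₂ h1 (hkN k₂ h1 h2.le)
    gcongr
  refine (norm_sq_bilinear_le (Finset.Ioc L Q) hH hHR a' c ha'n (by positivity) hD hW).trans ?_
  calc A ^ 2 * ((Finset.Ioc L Q).card : ℝ) * (2 * R / H) * (R * (2 * L * A ^ 2 + H * (A ^ 2 * W)))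
      ≤ A ^ 2 * (2 * L) * (2 * R / H) * (R * (2 * L * A ^ 2 + H * (A ^ 2 * W))) := by gcongr
    _ = 8 * A ^ 4 * ((R * L) ^ 2 / H) + 4 * A ^ 4 * (R ^ 2 * L * W) := by field_simp; ring
    _ ≤ 8 * A ^ 4 * ((R * L) ^ 2 / H) + 8 * A ^ 4 * (R ^ 2 * L * W) := by gcongr; norm_num
    _ = _ := by ring

end Bilinear

/-! ### Dyadic summation, the divisor bound and Dirichlet convolutions -/

/-- Integer halving of Q reaches 0 after at most log₂ Q + 1 steps, each of which removes one block
(Q / 2, Q]. -/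
lemma norm_sum_Ioc_le_of_dyadic (g : ℕ → ℂ) {N : ℕ} {B : ℝ}
    (hg : ∀ Q ≤ N, ‖∑ n ∈ Finset.Ioc (Q / 2) Q, g n‖ ≤ B) :
    ∀ Q ≤ N, ‖∑ n ∈ Finset.Ioc 0 Q, g n‖ ≤ (Nat.log 2 N + 1) * B := by
  have hB : 0 ≤ B := (norm_nonneg _).trans (hg 0 (Nat.zero_le _))
  have key : ∀ Q ≤ N, ‖∑ n ∈ Finset.Ioc 0 Q, g n‖ ≤ (Nat.log 2 Q + 1) * B := by
    intro Q
    induction Q using Nat.strong_induction_on with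
    | _ Q ih =>
      intro hQ
      rcases Nat.lt_or_ge Q 2 with h2 | h2
      · have h3 := hg Q hQ
        have : Q / 2 = 0 := by omega
        rw [this] at h3
        refine h3.trans ?_
        have : (0 : ℝ) ≤ Nat.log 2 Q := by positivity
        nlinarith
      · rw [← Finset.sum_Ioc_consecutive g (Nat.zero_le (Q / 2)) (Nat.div_le_self Q 2)]
        refine (norm_add_le _ _).trans ?_
        have h3 := ih (Q / 2) (by omega) (by omega)
        have h4 := hg Q hQ
        rw [Nat.log_div_base] at h3
        have h5 : 1 ≤ Nat.log 2 Q := Nat.log_pos (by norm_num) h2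
        push_cast [Nat.cast_sub h5] at h3
        linarith
  intro Q hQ
  refine (key Q hQ).trans ?_
  have : (Nat.log 2 Q : ℝ) ≤ Nat.log 2 N := by exact_mod_cast Nat.log_mono_right hQ
  gcongr

/-- Bernoulli's inequality for (1 + t) ^ a with 1 + t = 2 ^ ε gives one constant for all p and a. -/
lemma exists_add_one_le_mul_rpow_pow {ε : ℝ} (hε : 0 < ε) :
    ∃ K : ℝ, 1 ≤ K ∧ ∀ p : ℕ, 2 ≤ p → ∀ a : ℕ, (a : ℝ) + 1 ≤ K * ((p : ℝ) ^ a) ^ ε := by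
  set t : ℝ := 2 ^ ε - 1 with ht
  have ht0 : 0 < t := by rw [ht, sub_pos]; exact Real.one_lt_rpow (by norm_num) hε
  refine ⟨max (1 : ℝ) (1 / t), le_max_left _ _, fun p hp a => ?_⟩
  have h1 : 1 + (a : ℝ) * t ≤ ((p : ℝ) ^ a) ^ ε := by
    calc 1 + (a : ℝ) * t ≤ (1 + t) ^ a := one_add_mul_le_pow (by linarith) a
      _ = ((2 : ℝ) ^ a) ^ ε := by
        rw [ht, add_sub_cancel, ← Real.rpow_natCast, ← Real.rpow_natCast, ← Real.rpow_mul (by norm_num),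
          ← Real.rpow_mul (by norm_num), mul_comm]
      _ ≤ _ := by
        have : (2 : ℝ) ≤ p := by exact_mod_cast hp
        gcongr
  have h2 : (1 : ℝ) ≤ max 1 (1 / t) := le_max_left _ _
  have h3 : 1 ≤ max 1 (1 / t) * t := by
    have : 1 / t * t = 1 := by field_simp
    exact this.symm.le.trans (mul_le_mul_of_nonneg_right (le_max_right _ _) ht0.le)
  calc (a : ℝ) + 1 ≤ max 1 (1 / t) * (1 + a * t) := by
        have : (0 : ℝ) ≤ a := by positivity
        nlinarith
    _ ≤ _ := by gcongr

/-- The quotient of the divisor function by n ^ ε factors over primes. A prime p ≥ 2 ^ (1 / ε)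
contributes at most 1, since a + 1 ≤ 2 ^ a ≤ p ^ (a ε). There are at most `P` smaller ones, and each
contributes at most K. -/
lemma exists_card_divisors_le {ε : ℝ} (hε : 0 < ε) :
    ∃ C : ℝ, 1 ≤ C ∧ ∀ n : ℕ, 1 ≤ n → (n.divisors.card : ℝ) ≤ C * (n : ℝ) ^ ε := by
  obtain ⟨K, hK1, hK⟩ := exists_add_one_le_mul_rpow_pow hε
  set P := ⌈(2 : ℝ) ^ (1 / ε)⌉₊ with hP
  refine ⟨K ^ P, one_le_pow₀ hK1, fun n hn => ?_⟩
  have hn0 : n ≠ 0 := by omega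
  rw [Nat.card_divisors hn0]
  have h1 : (n : ℝ) ^ ε = ∏ p ∈ n.primeFactors, ((p : ℝ) ^ n.factorization p) ^ ε := by
    rw [Real.finsetProd_rpow _ _ (fun p _ => by positivity)]
    congr 1
    have := Nat.prod_factorization_pow_eq_self hn0
    conv_lhs => rw [← this]
    rw [Finsupp.prod]
    push_cast
    rfl
  have h2 : ∀ p ∈ n.primeFactors, ((n.factorization p : ℝ) + 1) ≤
      (if p ∈ Finset.range P then K else 1) * ((p : ℝ) ^ n.factorization p) ^ ε := by
    intro p hp
    have hp2 := (Nat.prime_of_mem_primeFactors hp).two_le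
    split_ifs with h
    · exact hK p hp2 _
    · rw [Finset.mem_range, not_lt] at h
      have h3 : (2 : ℝ) ^ (1 / ε) ≤ p := (Nat.le_ceil _).trans (by exact_mod_cast h)
      have h4 : (2 : ℝ) ≤ (p : ℝ) ^ ε := by
        calc (2 : ℝ) = ((2 : ℝ) ^ (1 / ε)) ^ ε := by
              rw [← Real.rpow_mul (by norm_num), one_div_mul_cancel hε.ne', Real.rpow_one]
          _ ≤ _ := by gcongr
      rw [one_mul]
      calc (n.factorization p : ℝ) + 1 ≤ 2 ^ n.factorization p := by
            exact_mod_cast (Nat.lt_two_pow_self (n := n.factorization p))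
        _ ≤ ((p : ℝ) ^ ε) ^ n.factorization p := by gcongr
        _ = _ := by
          rw [← Real.rpow_natCast, ← Real.rpow_natCast, ← Real.rpow_mul (by positivity),
            ← Real.rpow_mul (by positivity), mul_comm]
  push_cast
  calc ∏ p ∈ n.primeFactors, ((n.factorization p : ℝ) + 1)
      ≤ ∏ p ∈ n.primeFactors,
        (if p ∈ Finset.range P then K else 1) * ((p : ℝ) ^ n.factorization p) ^ ε :=
        Finset.prod_le_prod (fun p _ => by positivity) h2
    _ = (∏ p ∈ n.primeFactors, if p ∈ Finset.range P then K else 1) * (n : ℝ) ^ ε := by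
        rw [Finset.prod_mul_distrib, h1]
    _ ≤ K ^ P * (n : ℝ) ^ ε := by
        gcongr
        rw [Finset.prod_ite, Finset.prod_const_one, mul_one, Finset.prod_const]
        refine pow_le_pow_right₀ hK1 ?_
        calc _ ≤ (Finset.range P).card :=
              Finset.card_le_card fun p hp => (Finset.mem_filter.1 hp).2
          _ = P := Finset.card_range P

open ArithmeticFunction in
lemma sum_Ioc_mul_arith (f g : ArithmeticFunction ℝ) (z : ℕ → ℂ) (P P' : ℕ) :
    ∑ n ∈ Finset.Ioc P P', (((f * g) n : ℝ) : ℂ) * z n =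
      ∑ k ∈ Finset.Ioc 0 P', ∑ l ∈ Finset.Ioc 0 P',
        if P < k * l ∧ k * l ≤ P' then (f k : ℂ) * (g l : ℂ) * z (k * l) else 0 := by
  rw [← Finset.sum_product']
  have h1 : ∀ n ∈ Finset.Ioc P P', (((f * g) n : ℝ) : ℂ) * z n =
      ∑ x ∈ Finset.Ioc 0 P' ×ˢ Finset.Ioc 0 P',
        if x.1 * x.2 = n then (f x.1 : ℂ) * (g x.2 : ℂ) * z (x.1 * x.2) else 0 := by
    intro n hn
    rw [Finset.mem_Ioc] at hn
    rw [mul_apply, ← Finset.sum_filter]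
    have : n.divisorsAntidiagonal =
        (Finset.Ioc 0 P' ×ˢ Finset.Ioc 0 P').filter fun x => x.1 * x.2 = n :=
      Nat.divisorsAntidiagonal_eq_prod_filter_of_le (by omega) hn.2
    rw [← this]
    push_cast
    rw [Finset.sum_mul]
    refine Finset.sum_congr rfl fun x hx => ?_
    rw [(Nat.mem_divisorsAntidiagonal.1 hx).1]
  rw [Finset.sum_congr rfl h1, Finset.sum_comm]
  refine Finset.sum_congr rfl fun x _ => ?_
  rw [Finset.sum_ite_eq]
  simp only [Finset.mem_Ioc]

/-! ### Vaughan's identity and its coefficients -/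

section Vaughan

open ArithmeticFunction
open scoped ArithmeticFunction.Moebius ArithmeticFunction.zeta

/-- The restriction of an arithmetic function to `n ≤ U`. -/
def lowPart (U : ℕ) (f : ArithmeticFunction ℝ) : ArithmeticFunction ℝ :=
  ⟨fun n => if n ≤ U then f n else 0, by simp⟩

/-- The restriction of an arithmetic function to `n > U`. -/
def highPart (U : ℕ) (f : ArithmeticFunction ℝ) : ArithmeticFunction ℝ :=
  ⟨fun n => if n ≤ U then 0 else f n, by simp⟩

lemma lowPart_apply (U : ℕ) (f : ArithmeticFunction ℝ) (n : ℕ) :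
    lowPart U f n = if n ≤ U then f n else 0 := rfl

lemma highPart_apply (U : ℕ) (f : ArithmeticFunction ℝ) (n : ℕ) :
    highPart U f n = if n ≤ U then 0 else f n := rfl

lemma lowPart_add_highPart (U : ℕ) (f : ArithmeticFunction ℝ) :
    lowPart U f + highPart U f = f := by
  ext n
  rw [ArithmeticFunction.add_apply, lowPart_apply, highPart_apply]
  split_ifs <;> simp

/-- The Möbius function with real values. -/
def moebiusReal : ArithmeticFunction ℝ := ((μ : ArithmeticFunction ℤ) : ArithmeticFunction ℝ)

lemma abs_moebiusReal_le (n : ℕ) : |moebiusReal n| ≤ 1 := by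
  rw [moebiusReal, intCoe_apply]
  exact_mod_cast abs_moebius_le_one

/-- Vaughan's identity. -/
lemma vaughan (U : ℕ) :
    Λ + (lowPart U moebiusReal * lowPart U Λ) * (ζ : ArithmeticFunction ℝ) =
      lowPart U Λ + lowPart U moebiusReal * ArithmeticFunction.log +
      highPart U Λ * ((ζ : ArithmeticFunction ℝ) * highPart U moebiusReal) := by
  have h1 : Λ * (ζ : ArithmeticFunction ℝ) = ArithmeticFunction.log := vonMangoldt_mul_zeta
  have h2 : (ζ : ArithmeticFunction ℝ) * moebiusReal = 1 := coe_zeta_mul_coe_moebius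
  have h3 := lowPart_add_highPart U Λ
  have h4 := lowPart_add_highPart U moebiusReal
  rw [← h1]
  generalize lowPart U Λ = a at *
  generalize highPart U Λ = b at *
  generalize lowPart U moebiusReal = c at *
  generalize highPart U moebiusReal = d at *
  generalize moebiusReal = M at *
  generalize (ζ : ArithmeticFunction ℝ) = Z at *
  generalize (Λ : ArithmeticFunction ℝ) = V at *
  subst h3
  rw [← h4] at h2
  -- With Λ = a + b and log = Λ * ζ substituted, the two sides differ by b (ζ * μ - 1).
  linear_combination (-b) * h2

lemma abs_zeta_mul_highPart_le (U n : ℕ) :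
    |((ζ : ArithmeticFunction ℝ) * highPart U moebiusReal) n| ≤ n.divisors.card := by
  rw [coe_zeta_mul_apply]
  refine (Finset.abs_sum_le_sum_abs _ _).trans ?_
  rw [← nsmul_one]
  refine Finset.sum_le_card_nsmul _ _ _ fun i _ => ?_
  rw [highPart_apply]
  split_ifs
  · simp
  · exact abs_moebiusReal_le i

lemma zeta_mul_highPart_eq_zero {U n : ℕ} (h : n ≤ U) :
    ((ζ : ArithmeticFunction ℝ) * highPart U moebiusReal) n = 0 := by
  rw [coe_zeta_mul_apply]
  refine Finset.sum_eq_zero fun i hi => ?_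
  rw [highPart_apply, if_pos ((Nat.divisor_le hi).trans h)]

/-- As |μ| ≤ 1, the convolution is dominated by the sum of Λ over the divisors of n, which is log n.
-/
lemma abs_low_mul_low_le (U n : ℕ) :
    |(lowPart U moebiusReal * lowPart U Λ) n| ≤ Real.log n := by
  rw [mul_apply]
  refine (Finset.abs_sum_le_sum_abs _ _).trans ?_
  rw [← vonMangoldt_sum, ← Nat.sum_divisorsAntidiagonal' (fun _ b => Λ b)]
  refine Finset.sum_le_sum fun x _ => ?_
  rw [abs_mul, lowPart_apply, lowPart_apply]
  have h0 : (0 : ℝ) ≤ Λ x.2 := vonMangoldt_nonneg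
  have h1 := abs_moebiusReal_le x.1
  split_ifs
  · rw [abs_of_nonneg h0]; nlinarith
  · simp [h0]
  · simp [h0]
  · simp [h0]

lemma low_mul_low_eq_zero {U n : ℕ} (h : U ^ 2 < n) :
    (lowPart U moebiusReal * lowPart U Λ) n = 0 := by
  rw [mul_apply]
  refine Finset.sum_eq_zero fun x hx => ?_
  rw [lowPart_apply, lowPart_apply]
  split_ifs with h1 h2
  · exfalso
    have h3 := (Nat.mem_divisorsAntidiagonal.1 hx).1
    have := Nat.mul_le_mul h1 h2
    rw [h3, ← pow_two] at this
    omega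
  · simp
  · simp
  · simp

end Vaughan

/-! ### Type I and Type II sums, and Λ over a dyadic block -/

section Bilinear

variable {φ φ₁ φ₂ φ₃ : ℝ → ℝ} {X y η : ℝ}

/-- The bound for the square of a dyadic Type II sum. -/
noncomputable def bilinearBound (A Y y η : ℝ) (N H m : ℕ) : ℝ :=
  8 * A ^ 4 * ((N : ℝ) ^ 2 / H + 264 * √(m * H) * (N : ℝ) ^ (7 / 4 : ℝ) * Y ^ ((y + 3 * η) / 2))

/-- The left side is (R L) · √(R L) · √R. Only the last factor uses R ≤ √N, that is, that k is the
shorter variable; this is the source of the exponent 7/4. -/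
lemma sq_mul_mul_sqrt_le {R L N : ℕ} (h1 : R * L ≤ N) (h2 : R ^ 2 ≤ N) :
    (R : ℝ) ^ 2 * L * √L ≤ (N : ℝ) ^ (7 / 4 : ℝ) := by
  have h1' : (R : ℝ) * L ≤ N := by exact_mod_cast h1
  have h2' : (R : ℝ) ≤ √N := by
    apply Real.le_sqrt_of_sq_le; exact_mod_cast h2
  have e1 : (R : ℝ) ^ 2 * L * √L = (R * L) * √(R * L) * √R := by
    rw [Real.sqrt_mul (by positivity)]
    have := Real.mul_self_sqrt (show (0 : ℝ) ≤ R by positivity)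
    linear_combination (-(R : ℝ) * L * √L) * this
  have e2 : (N : ℝ) ^ (7 / 4 : ℝ) = N * √N * √√N := by
    rcases Nat.eq_zero_or_pos N with h | h
    · subst h; simp
    · have hN : (0 : ℝ) < N := by exact_mod_cast h
      rw [Real.sqrt_eq_rpow, Real.sqrt_eq_rpow, ← Real.rpow_mul hN.le]
      nth_rewrite 2 [← Real.rpow_one (N : ℝ)]
      rw [← Real.rpow_add hN, ← Real.rpow_add hN]
      norm_num
  rw [e1, e2]
  gcongr

/-- The part of a Type II sum in which k ≤ Z ≤ √N, with l cut dyadically. In the block l > L the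
condition k l ≤ P' shortens the range of k to R = min Z (P' / L), so that R L ≤ N. -/
lemma IsPhase.norm_type_II_half_le (hφ : IsPhase φ φ₁ φ₂ φ₃ X y η) {U Z H P P' N m : ℕ}
    (hH : 1 ≤ H) (hHU : H ≤ U) (hZ : Z ^ 2 ≤ N) (hm : 1 ≤ m) (hP : X ≤ P)
    (hP' : P' ≤ N) (a b : ℕ → ℂ) {A : ℝ} (ha : ∀ l, 1 ≤ l → l ≤ N → ‖a l‖ ≤ A)
    (hb : ∀ k, 1 ≤ k → k ≤ N → ‖b k‖ ≤ A) (ha0 : ∀ l ≤ U, a l = 0) (hb0 : ∀ k ≤ U, b k = 0)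
    {Y : ℝ} (hY : 3 * (N : ℝ) ≤ Y) (hY1 : 1 ≤ Y) (ξ : ℝ) :
    ‖∑ l ∈ Finset.Ioc 0 P', ∑ k ∈ Finset.Ioc 0 Z,
        if P < k * l ∧ k * l ≤ P' then a l * b k * phase φ m ξ (k * l) else 0‖ ≤
      (Nat.log 2 N + 1) * √(bilinearBound A Y y η N H m) := by
  refine norm_sum_Ioc_le_of_dyadic (fun l => ∑ k ∈ Finset.Ioc 0 Z,
    if P < k * l ∧ k * l ≤ P' then a l * b k * phase φ m ξ (k * l) else 0) (fun Q hQ => ?_) P' hP'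
  set L := Q / 2 with hLdef
  rcases Nat.eq_zero_or_pos L with hL0 | hL1
  · rw [Finset.sum_eq_zero]
    · simp
    · intro l hl
      rw [Finset.mem_Ioc] at hl
      refine Finset.sum_eq_zero fun k _ => ?_
      rw [ha0 l (by omega)]
      simp
  set R := min Z (P' / L) with hR
  have hsub : ∀ l ∈ Finset.Ioc L Q, ∑ k ∈ Finset.Ioc 0 Z,
      (if P < k * l ∧ k * l ≤ P' then a l * b k * phase φ m ξ (k * l) else 0) =
      ∑ k ∈ Finset.Ioc 0 R,
      (if P < k * l ∧ k * l ≤ P' then a l * b k * phase φ m ξ (k * l) else 0) := by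
    intro l hl
    rw [Finset.mem_Ioc] at hl
    symm
    apply Finset.sum_subset
    · exact Finset.Ioc_subset_Ioc_right (min_le_left _ _)
    · intro k hk hk'
      rw [Finset.mem_Ioc] at hk hk'
      rw [if_neg]
      rintro ⟨-, h⟩
      have h1 : P' / L < k := by
        by_contra h2
        exact hk' ⟨hk.1, le_min hk.2 (not_lt.1 h2)⟩
      rw [Nat.div_lt_iff_lt_mul hL1] at h1
      have h2 : k * L ≤ k * l := Nat.mul_le_mul_left _ hl.1.le
      omega
  rw [Finset.sum_congr rfl hsub]
  -- If R < H then every k in range is at most H ≤ U, where b vanishes; otherwise blocks of length H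
  -- fit into the range of k.
  rcases lt_or_ge R H with hRH | hHR
  · rw [Finset.sum_eq_zero]
    · simp
    · intro l _
      refine Finset.sum_eq_zero fun k hk => ?_
      rw [Finset.mem_Ioc] at hk
      rw [hb0 k (by omega)]
      simp
  apply Real.le_sqrt_of_sq_le
  refine (hφ.norm_sq_type_II_le hL1 (by omega) hH hHR hm hP hP' a b ha hb hY hY1 ξ).trans ?_
  have hRL : R * L ≤ N := by
    calc R * L ≤ P' / L * L := Nat.mul_le_mul_right _ (min_le_right _ _)
      _ ≤ P' := Nat.div_mul_le_self _ _
      _ ≤ N := hP'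
  have hRZ : R ^ 2 ≤ N := (Nat.pow_le_pow_left (min_le_left _ _) 2).trans hZ
  have h1 := sq_mul_mul_sqrt_le hRL hRZ
  have hRL' : (R : ℝ) * L ≤ N := by exact_mod_cast hRL
  have hA : 0 ≤ A ^ 4 := by positivity
  rw [bilinearBound]
  have e1 : (R : ℝ) ^ 2 * L * (264 * √(m * H * L) * Y ^ ((y + 3 * η) / 2)) =
      264 * √(m * H) * ((R : ℝ) ^ 2 * L * √L) * Y ^ ((y + 3 * η) / 2) := by
    rw [Real.sqrt_mul (by positivity) (L : ℝ)]; ring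
  rw [e1]
  gcongr

open ArithmeticFunction
open scoped ArithmeticFunction.Moebius ArithmeticFunction.zeta

/-- Since k l ≤ N, one of k, l is at most Z, the integer part of √N. The terms with k ≤ Z and those
with k > Z (hence l ≤ Z) are two half sums; replacing a by `a'` in the second prevents double
counting. -/
lemma IsPhase.norm_type_II_le (hφ : IsPhase φ φ₁ φ₂ φ₃ X y η) {U H P P' N m : ℕ}
    (hH : 1 ≤ H) (hHU : H ≤ U) (hm : 1 ≤ m) (hP : X ≤ P)
    (hP' : P' ≤ N) (a b : ℕ → ℂ) {A : ℝ} (ha : ∀ l, 1 ≤ l → l ≤ N → ‖a l‖ ≤ A)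
    (hb : ∀ k, 1 ≤ k → k ≤ N → ‖b k‖ ≤ A) (ha0 : ∀ l ≤ U, a l = 0) (hb0 : ∀ k ≤ U, b k = 0)
    {Y : ℝ} (hY : 3 * (N : ℝ) ≤ Y) (hY1 : 1 ≤ Y) (ξ : ℝ) :
    ‖∑ k ∈ Finset.Ioc 0 P', ∑ l ∈ Finset.Ioc 0 P',
        if P < k * l ∧ k * l ≤ P' then a k * b l * phase φ m ξ (k * l) else 0‖ ≤
      2 * ((Nat.log 2 N + 1) * √(bilinearBound A Y y η N H m)) := by
  set Z := Nat.sqrt N with hZdef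
  have hZ : Z ^ 2 ≤ N := by rw [pow_two]; exact Nat.sqrt_le N
  have hZ' : N < (Z + 1) * (Z + 1) := Nat.lt_succ_sqrt N
  set a' : ℕ → ℂ := fun k => if k ≤ Z then 0 else a k with ha'
  rcases Nat.eq_zero_or_pos P' with h0 | h0
  · subst h0; simp; positivity
  have hA : 0 ≤ A := (norm_nonneg _).trans (ha 1 le_rfl (by omega))
  have h1 := hφ.norm_type_II_half_le hH hHU hZ hm hP hP' b a hb ha hb0 ha0 hY hY1 ξ
  have h2 := hφ.norm_type_II_half_le hH hHU hZ hm hP hP' a' b (A := A)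
    (fun l h1 h2 => by
      simp only [ha']
      split_ifs
      · simpa using hA
      · exact ha l h1 h2) hb
    (fun l hl => by simp only [ha']; split_ifs; exacts [rfl, ha0 l hl]) hb0 hY hY1 ξ
  have hsplit : ∑ k ∈ Finset.Ioc 0 P', ∑ l ∈ Finset.Ioc 0 P',
        (if P < k * l ∧ k * l ≤ P' then a k * b l * phase φ m ξ (k * l) else 0) =
      ∑ l ∈ Finset.Ioc 0 P', ∑ k ∈ Finset.Ioc 0 Z,
        (if P < k * l ∧ k * l ≤ P' then b l * a k * phase φ m ξ (k * l) else 0) +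
      ∑ l ∈ Finset.Ioc 0 P', ∑ k ∈ Finset.Ioc 0 Z,
        (if P < k * l ∧ k * l ≤ P' then a' l * b k * phase φ m ξ (k * l) else 0) := by
    have hlow : ∑ l ∈ Finset.Ioc 0 P', ∑ k ∈ Finset.Ioc 0 Z,
        (if P < k * l ∧ k * l ≤ P' then b l * a k * phase φ m ξ (k * l) else 0) =
        ∑ k ∈ Finset.Ioc 0 P', ∑ l ∈ Finset.Ioc 0 P',
        (if k ≤ Z then (if P < k * l ∧ k * l ≤ P' then a k * b l * phase φ m ξ (k * l) else 0)
          else 0) := by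
      rw [Finset.sum_comm' (s' := fun _ => Finset.Ioc 0 P') (t' := Finset.Ioc 0 P')
        (h := fun _ _ => Iff.rfl)]
      refine Finset.sum_congr rfl fun l hl => ?_
      rw [Finset.mem_Ioc] at hl
      have hfz : ∀ k, k ∉ Finset.Ioc 0 P' → k ∈ Finset.Ioc 0 Z →
          (if P < k * l ∧ k * l ≤ P' then b l * a k * phase φ m ξ (k * l) else 0) = 0 := by
        intro k hk hk'
        rw [Finset.mem_Ioc] at hk hk'
        rw [if_neg]
        rintro ⟨-, h⟩
        have : k ≤ k * l := Nat.le_mul_of_pos_right _ hl.1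
        omega
      have e1 : ∑ k ∈ Finset.Ioc 0 Z,
          (if P < k * l ∧ k * l ≤ P' then b l * a k * phase φ m ξ (k * l) else 0) =
          ∑ k ∈ (Finset.Ioc 0 P').filter (fun k => k ≤ Z),
          (if P < k * l ∧ k * l ≤ P' then b l * a k * phase φ m ξ (k * l) else 0) := by
        symm
        apply Finset.sum_subset
        · intro k hk
          rw [Finset.mem_filter, Finset.mem_Ioc] at hk
          exact Finset.mem_Ioc.2 ⟨hk.1.1, hk.2⟩
        · intro k hk hk'
          refine hfz k (fun h => hk' ?_) hk
          exact Finset.mem_filter.2 ⟨h, (Finset.mem_Ioc.1 hk).2⟩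
      rw [e1, Finset.sum_filter]
      refine Finset.sum_congr rfl fun k _ => ?_
      rw [mul_comm (b l)]
    have hhigh : ∑ l ∈ Finset.Ioc 0 P', ∑ k ∈ Finset.Ioc 0 Z,
        (if P < k * l ∧ k * l ≤ P' then a' l * b k * phase φ m ξ (k * l) else 0) =
        ∑ k ∈ Finset.Ioc 0 P', ∑ l ∈ Finset.Ioc 0 P',
        (if k ≤ Z then 0 else
          (if P < k * l ∧ k * l ≤ P' then a k * b l * phase φ m ξ (k * l) else 0)) := by
      refine Finset.sum_congr rfl fun k hk => ?_
      rw [Finset.mem_Ioc] at hk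
      by_cases hkZ : k ≤ Z
      · simp [ha', hkZ]
      · simp only [ha', hkZ, if_false]
        have hext : ∀ n, P' ≤ n ∨ Z ≤ n → ∑ l ∈ Finset.Ioc 0 (min P' Z),
            (if P < l * k ∧ l * k ≤ P' then a k * b l * phase φ m ξ (l * k) else 0) =
            ∑ l ∈ Finset.Ioc 0 n,
            (if P < l * k ∧ l * k ≤ P' then a k * b l * phase φ m ξ (l * k) else 0) := by
          intro n hn
          apply Finset.sum_subset
          · exact Finset.Ioc_subset_Ioc_right (by omega)
          · intro l hl hl'
            rw [Finset.mem_Ioc] at hl hl'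
            rw [if_neg]
            rintro ⟨-, h⟩
            have h3 : l ≤ l * k := Nat.le_mul_of_pos_right _ hk.1
            have h4 : Z + 1 ≤ l := by omega
            have := Nat.mul_le_mul h4 (by omega : Z + 1 ≤ k)
            omega
        rw [← hext Z (Or.inr le_rfl), hext P' (Or.inl le_rfl)]
        refine Finset.sum_congr rfl fun l _ => ?_
        rw [mul_comm l k]
    rw [hlow, hhigh, ← Finset.sum_add_distrib]
    refine Finset.sum_congr rfl fun k _ => ?_
    rw [← Finset.sum_add_distrib]
    refine Finset.sum_congr rfl fun l _ => ?_
    by_cases h : k ≤ Z <;> simp [h]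
  rw [hsplit]
  refine (norm_add_le _ _).trans ?_
  linarith

/-- For each k ≤ K the variable l runs over an interval, and its weight b is removed by summation by
parts. The van der Corput bound is independent of k, so the sum over k costs the factor K. -/
lemma IsPhase.norm_type_I_le (hφ : IsPhase φ φ₁ φ₂ φ₃ X y η) {K P P' m : ℕ}
    (hm : 1 ≤ m) (hP : X ≤ P) (hP' : P' ≤ 3 * P) (a b : ℕ → ℂ) {A V : ℝ}
    (ha : ∀ k, 1 ≤ k → k ≤ P' → ‖a k‖ ≤ A) (ha0 : ∀ k, K < k → a k = 0) (hA : 0 ≤ A)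
    (hb : ∀ p q, 1 ≤ p → p ≤ q → q ≤ P' + 1 →
      ‖b q‖ + ∑ n ∈ Finset.Ico p q, ‖b (n + 1) - b n‖ ≤ V) (hV : 0 ≤ V)
    {Y : ℝ} (hY : 9 * (P : ℝ) ≤ Y) (ξ : ℝ) :
    ‖∑ k ∈ Finset.Ioc 0 P', ∑ l ∈ Finset.Ioc 0 P',
        if P < k * l ∧ k * l ≤ P' then a k * b l * phase φ m ξ (k * l) else 0‖ ≤
      K * (A * (V * (132 * √m * Y ^ ((1 + y + 3 * η) / 2)))) := by
  have hP1 : (1 : ℝ) ≤ P := hφ.one_le.trans hP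
  have hY0 : (0 : ℝ) < Y := by linarith
  set B : ℝ := 132 * √m * Y ^ ((1 + y + 3 * η) / 2) with hB
  have hB0 : 0 ≤ B := by positivity
  have hk : ∀ k ∈ Finset.Ioc 0 P', ‖∑ l ∈ Finset.Ioc 0 P',
        if P < k * l ∧ k * l ≤ P' then a k * b l * phase φ m ξ (k * l) else 0‖ ≤
        if k ≤ K then A * (V * B) else 0 := by
    intro k hk
    rw [Finset.mem_Ioc] at hk
    split_ifs with hkK
    · set S := (Finset.Ioc 0 P').filter fun l => P < k * l ∧ k * l ≤ P' with hS
      have e1 : (∑ l ∈ Finset.Ioc 0 P',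
          if P < k * l ∧ k * l ≤ P' then a k * b l * phase φ m ξ (k * l) else 0) =
          a k * ∑ l ∈ S, b l * phase φ m ξ (k * l) := by
        rw [hS, Finset.sum_filter, Finset.mul_sum]
        refine Finset.sum_congr rfl fun l _ => ?_
        split_ifs
        · ring
        · simp
      have hmem : ∀ l, l ∈ S ↔ (0 < l ∧ l ≤ P') ∧ P < k * l ∧ k * l ≤ P' := fun l => by
        rw [hS, Finset.mem_filter, Finset.mem_Ioc]
      obtain ⟨p, q, hpq⟩ := exists_eq_Ico_of_convex S (by
        intro u hu v hv w huw hwv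
        rw [hmem] at hu hv ⊢
        have h5 : k * u ≤ k * w := Nat.mul_le_mul_left _ huw
        have h6 : k * w ≤ k * v := Nat.mul_le_mul_left _ hwv
        omega)
      rw [e1, norm_mul, hpq]
      have hsum : ‖∑ l ∈ Finset.Ico p q, b l * phase φ m ξ (k * l)‖ ≤ V * B := by
        rcases lt_or_ge p q with hlt | hge
        · have hp := (hmem p).1 (by rw [hpq, Finset.mem_Ico]; omega)
          have hq := (hmem (q - 1)).1 (by rw [hpq, Finset.mem_Ico]; omega)
          refine norm_sum_mul_le_of_variation b (fun l => phase φ m ξ (k * l)) hlt.le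
            (fun c hc1 hc2 => ?_) (hb p q (by omega) hlt.le (by omega))
          have := hφ.norm_sum_dilate_le (P := P) (a := p) (b := c) hP hk.1 hm (fun l h5 h6 => by
            have := (hmem l).1 (by rw [hpq, Finset.mem_Ico]; omega)
            omega) hY (ξ * k)
          refine le_trans (le_of_eq ?_) this
          congr 1
          refine Finset.sum_congr rfl fun l _ => ?_
          rw [phase]
          push_cast
          ring_nf
        · rw [Finset.Ico_eq_empty (by omega)]; simp; positivity
      have := ha k hk.1 hk.2
      gcongr
    · rw [ha0 k (by omega)]; simp
  refine (norm_sum_le_of_le _ hk).trans ?_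
  rw [← Finset.sum_filter, Finset.sum_const, nsmul_eq_mul]
  have : (((Finset.Ioc 0 P').filter fun k => k ≤ K).card : ℝ) ≤ K := by
    have h1 : ((Finset.Ioc 0 P').filter fun k => k ≤ K) ⊆ Finset.Ioc 0 K := fun k hk => by
      simp only [Finset.mem_filter, Finset.mem_Ioc] at hk ⊢
      omega
    have := Finset.card_le_card h1
    rw [Nat.card_Ioc] at this
    exact_mod_cast this
  gcongr

lemma variation_log_le {p q M : ℕ} (hp : 1 ≤ p) (hpq : p ≤ q) (hq : q ≤ M) :
    ‖((ArithmeticFunction.log q : ℝ) : ℂ)‖ + ∑ n ∈ Finset.Ico p q,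
      ‖((ArithmeticFunction.log (n + 1) : ℝ) : ℂ) - ((ArithmeticFunction.log n : ℝ) : ℂ)‖ ≤
      2 * Real.log M := by
  have h1 : ∀ n ∈ Finset.Ico p q,
      ‖((ArithmeticFunction.log (n + 1) : ℝ) : ℂ) - ((ArithmeticFunction.log n : ℝ) : ℂ)‖ =
      Real.log ((n + 1 : ℕ) : ℝ) - Real.log n := by
    intro n hn
    rw [Finset.mem_Ico] at hn
    rw [← Complex.ofReal_sub, Complex.norm_real, log_apply, log_apply, Real.norm_eq_abs,
      abs_of_nonneg]
    rw [sub_nonneg]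
    have : (0 : ℝ) < n := by exact_mod_cast (by omega : 0 < n)
    apply Real.log_le_log this
    push_cast; linarith
  rw [Finset.sum_congr rfl h1, Finset.sum_Ico_sub (fun n : ℕ => Real.log (n : ℝ)) hpq,
    Complex.norm_real, log_apply, Real.norm_eq_abs, abs_of_nonneg (Real.log_natCast_nonneg q)]
  have h2 := Real.log_natCast_nonneg p
  have h3 : Real.log q ≤ Real.log M := by
    apply Real.log_le_log
    · exact_mod_cast (by omega : 0 < q)
    · exact_mod_cast hq
  linarith

/-- The sum over prime powers in a short dyadic range. -/
lemma IsPhase.norm_sum_vonMangoldt_block_le (hφ : IsPhase φ φ₁ φ₂ φ₃ X y η) {U H P P' N m : ℕ}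
    (hH : 1 ≤ H) (hHU : H ≤ U) (hUP : U ≤ P) (hm : 1 ≤ m) (hP : X ≤ P) (hP' : P' ≤ 3 * P)
    (hP'N : P' ≤ N) {A : ℝ} (hA1 : 1 ≤ A) (hAlog : Real.log (N + 1 : ℕ) ≤ A)
    (hAdiv : ∀ n, 1 ≤ n → n ≤ N → (n.divisors.card : ℝ) ≤ A)
    {Y : ℝ} (hY : 3 * (N : ℝ) ≤ Y) (hY' : 9 * (P : ℝ) ≤ Y) (ξ : ℝ) :
    ‖∑ n ∈ Finset.Ioc P P', ((Λ n : ℝ) : ℂ) * phase φ m ξ n‖ ≤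
      2 * U ^ 2 * (A * (2 * A * (132 * √m * Y ^ ((1 + y + 3 * η) / 2)))) +
      2 * ((Nat.log 2 N + 1) * √(bilinearBound A Y y η N H m)) := by
  have hP1 : (1 : ℝ) ≤ P := hφ.one_le.trans hP
  have hY1 : (1 : ℝ) ≤ Y := by linarith
  have hlogle : ∀ n : ℕ, n ≤ N → Real.log n ≤ A := by
    intro n hn
    refine le_trans ?_ hAlog
    rcases Nat.eq_zero_or_pos n with h | h
    · subst h; simpa using Real.log_natCast_nonneg (N + 1)
    · apply Real.log_le_log
      · exact_mod_cast h
      · exact_mod_cast (by omega : n ≤ N + 1)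
  have hvaughan : ∀ n ∈ Finset.Ioc P P', ((Λ n : ℝ) : ℂ) * phase φ m ξ n =
      (((lowPart U moebiusReal * ArithmeticFunction.log) n : ℝ) : ℂ) * phase φ m ξ n -
      ((((lowPart U moebiusReal * lowPart U Λ) * (ζ : ArithmeticFunction ℝ)) n : ℝ) : ℂ) *
        phase φ m ξ n +
      (((highPart U Λ * ((ζ : ArithmeticFunction ℝ) * highPart U moebiusReal)) n : ℝ) : ℂ) *
        phase φ m ξ n := by
    intro n hn
    rw [Finset.mem_Ioc] at hn
    -- Here n > P ≥ U, so the term of Vaughan's identity with Λ restricted to [1, U] vanishes.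
    have h := DFunLike.congr_fun (vaughan U) n
    rw [ArithmeticFunction.add_apply, ArithmeticFunction.add_apply, ArithmeticFunction.add_apply,
      lowPart_apply, if_neg (by omega), zero_add] at h
    rw [← sub_mul, ← add_mul]
    congr 1
    rw [sub_add_eq_add_sub, eq_sub_iff_add_eq]
    exact_mod_cast h
  rw [Finset.sum_congr rfl hvaughan, Finset.sum_add_distrib, Finset.sum_sub_distrib,
    sum_Ioc_mul_arith, sum_Ioc_mul_arith, sum_Ioc_mul_arith]
  have h1 := hφ.norm_type_I_le (K := U) hm hP hP' (fun k => ((lowPart U moebiusReal k : ℝ) : ℂ))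
    (fun l => ((ArithmeticFunction.log l : ℝ) : ℂ)) (A := 1) (V := 2 * A)
    (fun k _ _ => by
      rw [Complex.norm_real, Real.norm_eq_abs, lowPart_apply]
      split_ifs
      · exact abs_moebiusReal_le k
      · simp)
    (fun k hk => by rw [lowPart_apply, if_neg (by omega)]; simp) zero_le_one
    (fun p q h1 h2 h3 => (variation_log_le h1 h2 (show q ≤ N + 1 by omega)).trans (by linarith))
    (by linarith) hY' ξ
  -- The convolution of two functions supported on [1, U] is supported on [1, U ^ 2]; its partner ζ
  -- is constant and has no variation.
  have h2 := hφ.norm_type_I_le (K := U ^ 2) hm hP hP'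
    (fun k => (((lowPart U moebiusReal * lowPart U Λ) k : ℝ) : ℂ))
    (fun l => (((ζ : ArithmeticFunction ℝ) l : ℝ) : ℂ)) (A := A) (V := 2 * A)
    (fun k _ hk => by
      rw [Complex.norm_real, Real.norm_eq_abs]
      exact (abs_low_mul_low_le U k).trans (hlogle k (by omega)))
    (fun k hk => by rw [low_mul_low_eq_zero hk]; simp) (by linarith)
    (fun p q h1 h2 h3 => by
      have hz : ∀ n : ℕ, 1 ≤ n → (((ζ : ArithmeticFunction ℝ) n : ℝ) : ℂ) = 1 := fun n hn => by
        rw [natCoe_apply, zeta_apply, if_neg (by omega)]; simp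
      rw [hz q (by omega), Finset.sum_eq_zero]
      · simp; linarith
      · intro n hn
        rw [Finset.mem_Ico] at hn
        rw [hz (n + 1) (by omega), hz n (by omega)]; simp)
    (by linarith) hY' ξ
  have h3 := hφ.norm_type_II_le hH hHU hm hP hP'N (fun k => ((highPart U Λ k : ℝ) : ℂ))
    (fun l => ((((ζ : ArithmeticFunction ℝ) * highPart U moebiusReal) l : ℝ) : ℂ)) (A := A)
    (fun k _ hk => by
      rw [Complex.norm_real, Real.norm_eq_abs, highPart_apply]
      split_ifs
      · simp; linarith
      · rw [abs_of_nonneg vonMangoldt_nonneg]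
        exact vonMangoldt_le_log.trans (hlogle k hk))
    (fun l hl hl' => by
      rw [Complex.norm_real, Real.norm_eq_abs]
      exact (abs_zeta_mul_highPart_le U l).trans (hAdiv l hl hl'))
    (fun k hk => by rw [highPart_apply, if_pos hk]; simp)
    (fun l hl => by rw [zeta_mul_highPart_eq_zero hl]; simp) hY hY1 ξ
  refine (norm_add_le _ _).trans ?_
  refine (add_le_add (norm_sub_le _ _) h3).trans ?_
  gcongr ?_ + _
  set B : ℝ := 132 * √m * Y ^ ((1 + y + 3 * η) / 2) with hB
  have hB0 : 0 ≤ B := by positivity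
  have hU1 : (1 : ℝ) ≤ U := by exact_mod_cast hH.trans hHU
  have h4 : (U : ℝ) * (1 * (2 * A * B)) ≤ U ^ 2 * (A * (2 * A * B)) := by
    gcongr
    nlinarith
  push_cast at h2
  linarith

end Bilinear

/-! ### Comparison of constants and logarithms with powers of N -/

lemma eventually_mul_rpow_le (C : ℝ) {a b : ℝ} (hab : a < b) :
    ∀ᶠ N : ℕ in atTop, C * (N : ℝ) ^ a ≤ (N : ℝ) ^ b := by
  have h1 : Tendsto (fun N : ℕ => (N : ℝ) ^ (b - a)) atTop atTop :=
    (tendsto_rpow_atTop (by linarith)).comp tendsto_natCast_atTop_atTop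
  filter_upwards [h1.eventually_ge_atTop C, eventually_gt_atTop 0] with N hN hN0
  have hN0' : (0 : ℝ) < N := by exact_mod_cast hN0
  calc C * (N : ℝ) ^ a ≤ (N : ℝ) ^ (b - a) * (N : ℝ) ^ a := by gcongr
    _ = (N : ℝ) ^ b := by rw [← Real.rpow_add hN0']; ring_nf

lemma eventually_const_le_rpow (C : ℝ) {b : ℝ} (hb : 0 < b) :
    ∀ᶠ N : ℕ in atTop, C ≤ (N : ℝ) ^ b := by
  simpa using eventually_mul_rpow_le C hb

lemma eventually_log_succ_le_rpow {b : ℝ} (hb : 0 < b) :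
    ∀ᶠ N : ℕ in atTop, Real.log (N + 1 : ℕ) ≤ (N : ℝ) ^ b := by
  have h := (isLittleO_log_rpow_atTop hb).bound (show (0 : ℝ) < 1 / 2 ^ b by positivity)
  have h2 : Tendsto (fun N : ℕ => ((N + 1 : ℕ) : ℝ)) atTop atTop :=
    tendsto_natCast_atTop_atTop.comp (tendsto_add_atTop_nat 1)
  filter_upwards [h2.eventually h, eventually_gt_atTop 0] with N hN hN0
  have hN0' : (1 : ℝ) ≤ N := by exact_mod_cast hN0
  rw [Real.norm_eq_abs, Real.norm_eq_abs, abs_of_nonneg (Real.log_natCast_nonneg _),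
    abs_of_nonneg (by positivity)] at hN
  refine hN.trans ?_
  rw [one_div, inv_mul_le_iff₀ (by positivity), ← Real.mul_rpow (by norm_num) (by positivity)]
  gcongr
  push_cast
  linarith

lemma eventually_natLog_le_rpow {b : ℝ} (hb : 0 < b) :
    ∀ᶠ N : ℕ in atTop, (Nat.log 2 N : ℝ) + 1 ≤ (N : ℝ) ^ b := by
  filter_upwards [eventually_log_succ_le_rpow (half_pos hb), eventually_const_le_rpow 2 (half_pos hb),
    eventually_mul_rpow_le 2 (half_lt_self hb), eventually_gt_atTop 0] with N h1 h2 h3 hN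
  have hN0 : (0 : ℝ) < N := by exact_mod_cast hN
  have h4 : (Nat.log 2 N : ℝ) * Real.log 2 ≤ Real.log (N + 1 : ℕ) := by
    rw [← Real.log_pow]
    apply Real.log_le_log (by positivity)
    have := Nat.pow_log_le_self 2 (show N ≠ 0 by omega)
    exact_mod_cast this.trans (Nat.le_succ N)
  have h5 := Real.log_two_gt_d9
  have h6 : (0 : ℝ) ≤ Nat.log 2 N := by positivity
  have e1 : (N : ℝ) ^ b = (N : ℝ) ^ (b / 2) * (N : ℝ) ^ (b / 2) := by
    rw [← Real.rpow_add hN0]; ring_nf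
  have h7 : (Nat.log 2 N : ℝ) ≤ 3 / 2 * (N : ℝ) ^ (b / 2) := by nlinarith
  have h8 : 2 * (N : ℝ) ^ (b / 2) ≤ (N : ℝ) ^ b := h3
  linarith

lemma le_floor_mul_two {t : ℝ} (ht : 1 ≤ t) : t / 2 ≤ ⌊t⌋₊ := by
  have h1 : 1 ≤ ⌊t⌋₊ := Nat.le_floor (by simpa using ht)
  have h2 : (1 : ℝ) ≤ ⌊t⌋₊ := by exact_mod_cast h1
  have := Nat.lt_floor_add_one t
  linarith

/-! ### Exponents, and the sum over Λ up to N -/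

section PrimeSum

open ArithmeticFunction

variable {φ φ₁ φ₂ φ₃ : ℝ → ℝ} {X y η : ℝ}

/-- U² gives 1/3, √m gives α and the van der Corput factor gives (1 + y) / 2, which adds up to 5/6 +
α + y/2; the rest is O(η). -/
lemma eventually_type_I_bound (y : ℝ) {η α b : ℝ} (hη : 0 < η) (h : 5 / 6 + α + y / 2 + 4 * η < b) :
    ∀ᶠ N : ℕ in atTop, ∀ m : ℕ, (m : ℝ) ≤ (N : ℝ) ^ (2 * α) → ∀ U : ℕ,
      (U : ℝ) ≤ (N : ℝ) ^ (1 / 6 : ℝ) →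
      2 * (U : ℝ) ^ 2 * ((N : ℝ) ^ η * (2 * (N : ℝ) ^ η *
        (132 * √m * (9 * (N : ℝ)) ^ ((1 + y + 3 * η) / 2)))) ≤ (N : ℝ) ^ b := by
  filter_upwards [eventually_mul_rpow_le (528 * 9 ^ ((1 + y + 3 * η) / 2)) h,
    eventually_gt_atTop 0] with N h1 hN m hm U hU
  have hN0 : (0 : ℝ) < N := by exact_mod_cast hN
  have hN1 : (1 : ℝ) ≤ N := by exact_mod_cast hN
  have hsm : √(m : ℝ) ≤ (N : ℝ) ^ α := by
    rw [Real.sqrt_le_left (by positivity), ← Real.rpow_natCast, ← Real.rpow_mul hN0.le]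
    refine hm.trans (le_of_eq ?_)
    push_cast; ring_nf
  have hU2 : (U : ℝ) ^ 2 ≤ (N : ℝ) ^ (1 / 3 : ℝ) := by
    calc (U : ℝ) ^ 2 ≤ ((N : ℝ) ^ (1 / 6 : ℝ)) ^ 2 := by gcongr
      _ = _ := by rw [← Real.rpow_natCast, ← Real.rpow_mul hN0.le]; norm_num
  rw [Real.mul_rpow (by norm_num) hN0.le]
  calc _ ≤ 2 * (N : ℝ) ^ (1 / 3 : ℝ) * ((N : ℝ) ^ η * (2 * (N : ℝ) ^ η *
        (132 * (N : ℝ) ^ α * (9 ^ ((1 + y + 3 * η) / 2) * (N : ℝ) ^ ((1 + y + 3 * η) / 2))))) := by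
        gcongr
    _ = 528 * 9 ^ ((1 + y + 3 * η) / 2) * ((N : ℝ) ^ (1 / 3 : ℝ) * (N : ℝ) ^ η * (N : ℝ) ^ η *
        (N : ℝ) ^ α * (N : ℝ) ^ ((1 + y + 3 * η) / 2)) := by ring
    _ = 528 * 9 ^ ((1 + y + 3 * η) / 2) *
        (N : ℝ) ^ (1 / 3 + η + η + α + (1 + y + 3 * η) / 2) := by
        rw [← Real.rpow_add hN0, ← Real.rpow_add hN0, ← Real.rpow_add hN0, ← Real.rpow_add hN0]
    _ ≤ 528 * 9 ^ ((1 + y + 3 * η) / 2) * (N : ℝ) ^ (5 / 6 + α + y / 2 + 4 * η) := by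
        refine mul_le_mul_of_nonneg_left (Real.rpow_le_rpow_of_exponent_le hN1 ?_) (by positivity)
        linarith
    _ ≤ _ := h1

/-- With H ≈ N ^ θ, the square root of the diagonal N² / H has exponent 1 - θ/2 and that of the
off-diagonal term has exponent 7/8 + α/2 + θ/4 + y/4, up to O(η). -/
lemma eventually_type_II_bound (y : ℝ) {η α θ b : ℝ} (hη : 0 < η) (hθ : 0 < θ)
    (h1 : 1 - θ / 2 + 3 * η < b) (h2 : 7 / 8 + α / 2 + θ / 4 + y / 4 + 4 * η < b) :
    ∀ᶠ N : ℕ in atTop, ∀ m : ℕ, (m : ℝ) ≤ (N : ℝ) ^ (2 * α) →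
      2 * ((N : ℝ) ^ η *
        √(bilinearBound ((N : ℝ) ^ η) (9 * N) y η N ⌊(N : ℝ) ^ θ⌋₊ m)) ≤ (N : ℝ) ^ b := by
  filter_upwards [eventually_mul_rpow_le 128
      (show 2 - θ + 4 * η < 2 * (b - η) by linarith),
    eventually_mul_rpow_le (64 * (264 * 9 ^ ((y + 3 * η) / 2)))
      (show 7 / 4 + α + θ / 2 + y / 2 + 3 * η / 2 + 4 * η < 2 * (b - η) by linarith),
    eventually_const_le_rpow 1 hθ,
    eventually_gt_atTop 0] with N h1 h2 hNθ hN m hm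
  have hN0 : (0 : ℝ) < N := by exact_mod_cast hN
  have hN1 : (1 : ℝ) ≤ N := by exact_mod_cast hN
  set H := ⌊(N : ℝ) ^ θ⌋₊ with hH
  have hH1 : (N : ℝ) ^ θ / 2 ≤ H := le_floor_mul_two hNθ
  have hH2 : (H : ℝ) ≤ (N : ℝ) ^ θ := Nat.floor_le (by positivity)
  have hHpos : (0 : ℝ) < H := lt_of_lt_of_le (by positivity) hH1
  have hsm : √((m : ℝ) * H) ≤ (N : ℝ) ^ (α + θ / 2) := by
    rw [Real.sqrt_le_left (by positivity), ← Real.rpow_natCast, ← Real.rpow_mul hN0.le]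
    calc (m : ℝ) * H ≤ (N : ℝ) ^ (2 * α) * (N : ℝ) ^ θ := by gcongr
      _ = _ := by rw [← Real.rpow_add hN0]; congr 1; push_cast; ring
  have hA : ((N : ℝ) ^ η) ^ 4 = (N : ℝ) ^ (4 * η) := by
    rw [← Real.rpow_natCast, ← Real.rpow_mul hN0.le]; congr 1; push_cast; ring
  have hsq : bilinearBound ((N : ℝ) ^ η) (9 * N) y η N H m ≤
      1 / 4 * (N : ℝ) ^ (2 * (b - η)) := by
    rw [bilinearBound, Real.mul_rpow (by norm_num) hN0.le, mul_add, hA]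
    have t1 : 8 * (N : ℝ) ^ (4 * η) * ((N : ℝ) ^ 2 / H) ≤ 16 * (N : ℝ) ^ (2 - θ + 4 * η) := by
      have : (N : ℝ) ^ 2 / H ≤ 2 * (N : ℝ) ^ (2 - θ) := by
        rw [div_le_iff₀ hHpos]
        calc (N : ℝ) ^ 2 = (N : ℝ) ^ (2 - θ) * (N : ℝ) ^ θ := by
              rw [← Real.rpow_add hN0]; norm_num
          _ = 2 * (N : ℝ) ^ (2 - θ) * ((N : ℝ) ^ θ / 2) := by ring
          _ ≤ _ := by gcongr
      calc _ ≤ 8 * (N : ℝ) ^ (4 * η) * (2 * (N : ℝ) ^ (2 - θ)) := by gcongr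
        _ = 16 * ((N : ℝ) ^ (2 - θ) * (N : ℝ) ^ (4 * η)) := by ring
        _ = _ := by rw [← Real.rpow_add hN0]
    have t2 : 8 * (N : ℝ) ^ (4 * η) * (264 * √((m : ℝ) * H) * (N : ℝ) ^ (7 / 4 : ℝ) *
        (9 ^ ((y + 3 * η) / 2) * (N : ℝ) ^ ((y + 3 * η) / 2))) ≤
        8 * (264 * 9 ^ ((y + 3 * η) / 2)) *
          (N : ℝ) ^ (7 / 4 + α + θ / 2 + y / 2 + 3 * η / 2 + 4 * η) := by
      calc _ ≤ 8 * (N : ℝ) ^ (4 * η) * (264 * (N : ℝ) ^ (α + θ / 2) * (N : ℝ) ^ (7 / 4 : ℝ) *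
          (9 ^ ((y + 3 * η) / 2) * (N : ℝ) ^ ((y + 3 * η) / 2))) := by gcongr
        _ = 8 * (264 * 9 ^ ((y + 3 * η) / 2)) * ((N : ℝ) ^ (7 / 4 : ℝ) * (N : ℝ) ^ (α + θ / 2) *
          (N : ℝ) ^ ((y + 3 * η) / 2) * (N : ℝ) ^ (4 * η)) := by ring
        _ = _ := by
          rw [← Real.rpow_add hN0, ← Real.rpow_add hN0, ← Real.rpow_add hN0]; congr 2; ring
    linarith
  calc _ ≤ 2 * ((N : ℝ) ^ η * √(1 / 4 * (N : ℝ) ^ (2 * (b - η)))) := by gcongr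
    _ = 2 * ((N : ℝ) ^ η * (1 / 2 * (N : ℝ) ^ (b - η))) := by
      rw [Real.sqrt_mul (by norm_num), Real.sqrt_eq_rpow ((N : ℝ) ^ _), ← Real.rpow_mul hN0.le,
        show √(1 / 4 : ℝ) = 1 / 2 by
          rw [show (1 / 4 : ℝ) = (1 / 2) ^ 2 by norm_num, Real.sqrt_sq (by norm_num)]]
      congr 4
      ring
    _ = (N : ℝ) ^ η * (N : ℝ) ^ (b - η) := by ring
    _ = _ := by rw [← Real.rpow_add hN0]; ring_nf

/-- Vaughan's cut is U ≈ N ^ (1/6) and the Cauchy–Schwarz blocks have length H ≈ N ^ θ; θ ≤ 1/6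
ensures H ≤ U. The three inequalities are the Type I, diagonal and off-diagonal conditions. -/
lemma IsPhase.eventually_norm_sum_vonMangoldt_le (hφ : IsPhase φ φ₁ φ₂ φ₃ X y η)
    {α β θ : ℝ} (hθ : 0 < θ) (hθ' : θ ≤ 1 / 6)
    (h1 : 5 / 6 + α + y / 2 + 5 * η < 1 - β) (h2 : 1 - θ / 2 + 4 * η < 1 - β)
    (h3 : 7 / 8 + α / 2 + θ / 4 + y / 4 + 5 * η < 1 - β) :
    ∀ᶠ N : ℕ in atTop, ∀ m : ℕ, 1 ≤ m → (m : ℝ) ≤ (N : ℝ) ^ (2 * α) → ∀ ξ : ℝ, ∀ P ≤ N,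
      ‖∑ n ∈ Finset.Ioc 0 P, ((Λ n : ℝ) : ℂ) * phase φ m ξ n‖ ≤ (N : ℝ) ^ (1 - β) := by
  have hη := hφ.η_pos
  have hy := hφ.y_nonneg
  have hX := hφ.one_le
  obtain ⟨C, hC1, hC⟩ := exists_card_divisors_le (half_pos hη)
  -- c is the least slack in the three inequalities; half of it absorbs the factor 2 when the Type I
  -- and Type II bounds are added.
  set c : ℝ := min (1 - β - 5 * η - (5 / 6 + α + y / 2)) (min (1 - β - (1 - θ / 2 + 4 * η))
    (1 - β - (7 / 8 + α / 2 + θ / 4 + y / 4 + 5 * η))) with hc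
  have hc1 : c ≤ 1 - β - 5 * η - (5 / 6 + α + y / 2) := min_le_left _ _
  have hc2 : c ≤ 1 - β - (1 - θ / 2 + 4 * η) := (min_le_right _ _).trans (min_le_left _ _)
  have hc3 : c ≤ 1 - β - (7 / 8 + α / 2 + θ / 4 + y / 4 + 5 * η) :=
    (min_le_right _ _).trans (min_le_right _ _)
  have hc0 : 0 < c := by
    rw [hc]; refine lt_min (by linarith) (lt_min (by linarith) (by linarith))
  filter_upwards [eventually_type_I_bound y (α := α) (b := 1 - β - η - c / 2) hη (by linarith),
    eventually_type_II_bound y (α := α) (b := 1 - β - η - c / 2) hη hθ (by linarith) (by linarith),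
    eventually_mul_rpow_le 2 (show 1 - β - η - c / 2 < 1 - β - η by linarith),
    eventually_log_succ_le_rpow hη, eventually_natLog_le_rpow hη,
    eventually_mul_rpow_le C (half_lt_self hη), eventually_const_le_rpow 1 hθ,
    eventually_const_le_rpow X (show (0 : ℝ) < 1 / 6 by norm_num),
    eventually_mul_rpow_le 4 (show 1 / 6 + η < 1 - β - η by linarith),
    eventually_gt_atTop 0] with N hI hII hsum hlog hnlog hdiv hNθ hNX htriv hN m hm hmα ξ P hPN
  have hN0 : (0 : ℝ) < N := by exact_mod_cast hN
  have hN1 : (1 : ℝ) ≤ N := by exact_mod_cast hN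
  set U := ⌊(N : ℝ) ^ (1 / 6 : ℝ)⌋₊ with hU
  set H := ⌊(N : ℝ) ^ θ⌋₊ with hH
  have hUle : (U : ℝ) ≤ (N : ℝ) ^ (1 / 6 : ℝ) := Nat.floor_le (by positivity)
  have hH1 : 1 ≤ H := Nat.le_floor (by simpa using hNθ)
  have hHU : H ≤ U := Nat.floor_le_floor (Real.rpow_le_rpow_of_exponent_le hN1 hθ')
  have hblock : ∀ Q ≤ N, ‖∑ n ∈ Finset.Ioc (Q / 2) Q, ((Λ n : ℝ) : ℂ) * phase φ m ξ n‖ ≤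
      (N : ℝ) ^ (1 - β - η) := by
    intro Q hQ
    -- Vaughan's identity is applied only to blocks beyond U; the shorter blocks have O(N ^ (1/6))
    -- terms and are bounded trivially.
    by_cases hcase : (N : ℝ) ^ (1 / 6 : ℝ) ≤ (Q / 2 : ℕ)
    · have hUQ : U ≤ Q / 2 := by exact_mod_cast hUle.trans hcase
      have hQ1 : 1 ≤ Q / 2 := hH1.trans (hHU.trans hUQ)
      have hQ2 : ((Q / 2 : ℕ) : ℝ) ≤ N := by exact_mod_cast (Nat.div_le_self Q 2).trans hQ
      have := hφ.norm_sum_vonMangoldt_block_le hH1 hHU hUQ hm (hNX.trans hcase)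
        (P' := Q) (by omega) hQ (A := (N : ℝ) ^ η) (Real.one_le_rpow hN1 hη.le) hlog
        (fun n hn hnN => (hC n hn).trans (le_trans (by gcongr) hdiv))
        (Y := 9 * N) (by linarith) (by linarith) ξ
      refine this.trans ?_
      have t1 := hI m hmα U hUle
      have t2 := hII m hmα
      have t3 : 2 * (((Nat.log 2 N : ℝ) + 1) * √(bilinearBound ((N : ℝ) ^ η) (9 * N) y η N H m)) ≤
          2 * ((N : ℝ) ^ η * √(bilinearBound ((N : ℝ) ^ η) (9 * N) y η N H m)) := by gcongr
      linarith
    · rw [not_le] at hcase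
      refine le_trans ?_ htriv
      refine (norm_sum_le _ _).trans ?_
      calc ∑ n ∈ Finset.Ioc (Q / 2) Q, ‖((Λ n : ℝ) : ℂ) * phase φ m ξ n‖
          ≤ ∑ n ∈ Finset.Ioc (Q / 2) Q, (N : ℝ) ^ η := by
            refine Finset.sum_le_sum fun n hn => ?_
            rw [Finset.mem_Ioc] at hn
            rw [norm_mul, norm_phase, mul_one, Complex.norm_real, Real.norm_eq_abs,
              abs_of_nonneg vonMangoldt_nonneg]
            refine vonMangoldt_le_log.trans (le_trans ?_ hlog)
            apply Real.log_le_log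
            · exact_mod_cast (by omega : 0 < n)
            · exact_mod_cast (by omega : n ≤ N + 1)
        _ = ((Q - Q / 2 : ℕ) : ℝ) * (N : ℝ) ^ η := by
            rw [Finset.sum_const, nsmul_eq_mul, Nat.card_Ioc]
        _ ≤ (4 * (N : ℝ) ^ (1 / 6 : ℝ)) * (N : ℝ) ^ η := by
            gcongr
            have h4 : ((Q - Q / 2 : ℕ) : ℝ) ≤ ((Q / 2 + 1 : ℕ) : ℝ) := by
              exact_mod_cast (by omega)
            push_cast at h4 hcase
            have : (1 : ℝ) ≤ (N : ℝ) ^ (1 / 6 : ℝ) := Real.one_le_rpow hN1 (by norm_num)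
            linarith
        _ = 4 * (N : ℝ) ^ (1 / 6 + η) := by rw [mul_assoc, ← Real.rpow_add hN0]
  refine (norm_sum_Ioc_le_of_dyadic _ hblock P hPN).trans ?_
  calc ((Nat.log 2 N : ℝ) + 1) * (N : ℝ) ^ (1 - β - η) ≤ (N : ℝ) ^ η * (N : ℝ) ^ (1 - β - η) := by
        gcongr
    _ = _ := by rw [← Real.rpow_add hN0]; ring_nf

end PrimeSum

/-! ### From Λ to primes in a residue class -/

section PrimeSum

open ArithmeticFunction

/-- `log n` for the primes `n ≡ a mod q`, and `0` otherwise. -/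
noncomputable def primeWeight (a q : ℤ) (n : ℕ) : ℝ :=
  if n.Prime ∧ (n : ℤ) ≡ a [ZMOD q] then Real.log n else 0

lemma abs_primeWeight_le (a q : ℤ) (n : ℕ) : |primeWeight a q n| ≤ Real.log n := by
  rw [primeWeight]
  split_ifs
  · rw [abs_of_nonneg (Real.log_natCast_nonneg n)]
  · simpa using Real.log_natCast_nonneg n

/-- The proper prime powers contribute at most Chebyshev's ψ - θ, which is O(√N log N). -/
lemma norm_sum_prime_phase_le {φ : ℝ → ℝ} {m P N : ℕ} {ξ T : ℝ} (hPN : P ≤ N)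
    (hT : ‖∑ n ∈ Finset.Ioc 0 P, ((Λ n : ℝ) : ℂ) * phase φ m ξ n‖ ≤ T) :
    ‖∑ n ∈ Finset.Ioc 0 P, (((if n.Prime then Real.log n else 0 : ℝ)) : ℂ) * phase φ m ξ n‖ ≤
      T + 2 * √N * Real.log N := by
  set v : ℕ → ℝ := fun n => if n.Prime then Real.log n else 0 with hv
  have hvL : ∀ n, v n ≤ Λ n := fun n => by
    simp only [hv]
    split_ifs with h
    · rw [vonMangoldt_apply_prime h]
    · exact vonMangoldt_nonneg
  have h1 : ∑ n ∈ Finset.Ioc 0 P, (Λ n - v n) ≤ 2 * √N * Real.log N := by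
    rcases Nat.eq_zero_or_pos P with h0 | h0
    · subst h0; simp
      exact mul_nonneg (by positivity) (Real.log_natCast_nonneg N)
    · have h2 := Chebyshev.psi_sub_theta_le (x := (P : ℝ)) (by exact_mod_cast h0)
      rw [Chebyshev.psi, Chebyshev.theta, Nat.floor_natCast, Finset.sum_filter,
        ← Finset.sum_sub_distrib] at h2
      refine h2.trans ?_
      have hP0 : (0 : ℝ) < P := by exact_mod_cast h0
      have hPN' : (P : ℝ) ≤ N := by exact_mod_cast hPN
      have := Real.log_natCast_nonneg P
      have := Real.log_le_log hP0 hPN'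
      gcongr
  have h2 : ∑ n ∈ Finset.Ioc 0 P, ((v n : ℝ) : ℂ) * phase φ m ξ n =
      ∑ n ∈ Finset.Ioc 0 P, ((Λ n : ℝ) : ℂ) * phase φ m ξ n -
      ∑ n ∈ Finset.Ioc 0 P, ((Λ n - v n : ℝ) : ℂ) * phase φ m ξ n := by
    rw [← Finset.sum_sub_distrib]
    refine Finset.sum_congr rfl fun n _ => ?_
    push_cast; ring
  rw [h2]
  refine (norm_sub_le _ _).trans (add_le_add hT (le_trans ?_ h1))
  refine norm_sum_le_of_le _ fun n _ => ?_
  rw [norm_mul, norm_phase, mul_one, Complex.norm_real, Real.norm_eq_abs, abs_of_nonneg]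
  linarith [hvL n]

lemma sum_e_mul_div_eq {q : ℕ} (hq : 1 ≤ q) (d : ℤ) :
    ∑ s ∈ Finset.range q, e (s * d / q) = if (q : ℤ) ∣ d then (q : ℂ) else 0 := by
  have hq0 : (q : ℝ) ≠ 0 := by positivity
  have hpow : ∀ s : ℕ, e (s * d / q) = e (d / q) ^ s := by
    intro s
    induction s with
    | zero => simp
    | succ s ih =>
      rw [pow_succ, ← ih, ← e_add]; congr 1; push_cast; ring
  simp_rw [hpow]
  split_ifs with h
  · obtain ⟨c, rfl⟩ := h
    have : ((((q : ℤ) * c : ℤ) : ℝ)) / q = (c : ℝ) := by push_cast; field_simp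
    rw [this, e_int]; simp
  · have hne : e (d / q) ≠ 1 := by
      intro h1
      rw [e, Complex.exp_eq_one_iff] at h1
      obtain ⟨n, hn⟩ := h1
      have h2 : (2 * Real.pi * Complex.I : ℂ) ≠ 0 := Complex.two_pi_I_ne_zero
      have h3 : (((d : ℝ) / q : ℝ) : ℂ) = n := by
        apply mul_right_cancel₀ h2
        rw [← hn]; ring
      have h4 : (d : ℝ) / q = n := by exact_mod_cast h3
      rw [div_eq_iff hq0] at h4
      exact h ⟨n, by rw [mul_comm]; exact_mod_cast h4⟩
    rw [geom_sum_eq hne, ← hpow]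
    have : ((q : ℕ) : ℝ) * d / q = (d : ℝ) := by field_simp
    rw [this, e_int]; simp

/-- The residue class is detected by averaging the characters s ↦ e(s (n - a) / r), each of which
changes ξ into ξ + s / r. As the hypothesis holds for all ξ, the average costs nothing and the bound
is uniform in q. -/
lemma norm_sum_primeWeight_phase_le {φ : ℝ → ℝ} {m P : ℕ} {T : ℝ}
    (hT : ∀ ξ, ‖∑ n ∈ Finset.Ioc 0 P, (((if n.Prime then Real.log n else 0 : ℝ)) : ℂ) *
      phase φ m ξ n‖ ≤ T) (a : ℤ) {q : ℤ} (hq : 1 ≤ q) (ξ : ℝ) :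
    ‖∑ n ∈ Finset.Ioc 0 P, ((primeWeight a q n : ℝ) : ℂ) * phase φ m ξ n‖ ≤ T := by
  obtain ⟨r, rfl⟩ : ∃ r : ℕ, q = r := ⟨q.toNat, by omega⟩
  have hr : 1 ≤ r := by omega
  have hr0 : (r : ℂ) ≠ 0 := by exact_mod_cast (by omega : r ≠ 0)
  have h1 : (r : ℂ) * ∑ n ∈ Finset.Ioc 0 P, ((primeWeight a r n : ℝ) : ℂ) * phase φ m ξ n =
      ∑ s ∈ Finset.range r, e (-(s * a / r)) * ∑ n ∈ Finset.Ioc 0 P,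
        (((if n.Prime then Real.log n else 0 : ℝ)) : ℂ) * phase φ m (ξ + s / r) n := by
    simp_rw [Finset.mul_sum]
    rw [Finset.sum_comm]
    refine Finset.sum_congr rfl fun n _ => ?_
    have h2 : ∀ s : ℕ, e (-(s * a / r)) * ((((if n.Prime then Real.log n else 0 : ℝ)) : ℂ) *
        phase φ m (ξ + s / r) n) = e (s * ((n - a : ℤ)) / r) *
        ((((if n.Prime then Real.log n else 0 : ℝ)) : ℂ) * phase φ m ξ n) := by
      intro s
      have : e (-(s * a / r)) * phase φ m (ξ + s / r) n =
          e (s * ((n - a : ℤ)) / r) * phase φ m ξ n := by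
        rw [phase, phase, ← e_add, ← e_add]; congr 1; push_cast; ring
      linear_combination (((if n.Prime then Real.log n else 0 : ℝ)) : ℂ) * this
    simp_rw [h2]
    rw [← Finset.sum_mul, sum_e_mul_div_eq hr, primeWeight]
    have h3 : (n : ℤ) ≡ a [ZMOD r] ↔ (r : ℤ) ∣ n - a := by
      rw [Int.modEq_comm, Int.modEq_iff_dvd]
    by_cases h4 : n.Prime <;> by_cases h5 : (r : ℤ) ∣ n - a <;> simp [h3, h4, h5]
  have h2 : ‖(r : ℂ) * ∑ n ∈ Finset.Ioc 0 P, ((primeWeight a r n : ℝ) : ℂ) * phase φ m ξ n‖ ≤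
      r * T := by
    rw [h1]
    refine (norm_sum_le_of_le _ (fun s _ => ?_)).trans_eq
      (by rw [Finset.sum_const, Finset.card_range, nsmul_eq_mul])
    rw [norm_mul, norm_e, one_mul]
    exact hT _
  rw [norm_mul, Complex.norm_natCast] at h2
  exact le_of_mul_le_mul_left h2 (by exact_mod_cast hr)

/-- The negative frequency reduces to the positive one by complex conjugation and ξ ↦ -ξ. -/
lemma norm_sum_Ico_primeWeight_le {φ : ℝ → ℝ} {m N : ℕ} {T : ℝ}
    (hT : ∀ ξ, ∀ P ≤ N, ‖∑ n ∈ Finset.Ioc 0 P, ((Λ n : ℝ) : ℂ) * phase φ m ξ n‖ ≤ T)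
    (a : ℤ) {q : ℤ} (hq : 1 ≤ q) (ξ : ℝ) {c d : ℕ} (hc : 1 ≤ c) (hcd : c ≤ d) (hd : d ≤ N + 1) :
    ‖∑ n ∈ Finset.Ico c d, ((primeWeight a q n : ℝ) : ℂ) * e (ξ * n) * e (m * φ n)‖ ≤
        2 * (T + 2 * √N * Real.log N) ∧
    ‖∑ n ∈ Finset.Ico c d, ((primeWeight a q n : ℝ) : ℂ) * e (ξ * n) * e (-(m * φ n))‖ ≤
        2 * (T + 2 * √N * Real.log N) := by
  have key : ∀ ξ : ℝ, ‖∑ n ∈ Finset.Ico c d,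
      ((primeWeight a q n : ℝ) : ℂ) * e (ξ * n) * e (m * φ n)‖ ≤
        2 * (T + 2 * √N * Real.log N) := by
    intro ξ
    have h1 : ∀ P ≤ N, ‖∑ n ∈ Finset.Ioc 0 P, ((primeWeight a q n : ℝ) : ℂ) * phase φ m ξ n‖ ≤
        T + 2 * √N * Real.log N := fun P hP =>
      norm_sum_primeWeight_phase_le (fun ξ => norm_sum_prime_phase_le hP (hT ξ P hP)) a hq ξ
    have h2 : ∑ n ∈ Finset.Ico c d, ((primeWeight a q n : ℝ) : ℂ) * e (ξ * n) * e (m * φ n) =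
        ∑ n ∈ Finset.Ioc 0 (d - 1), ((primeWeight a q n : ℝ) : ℂ) * phase φ m ξ n -
        ∑ n ∈ Finset.Ioc 0 (c - 1), ((primeWeight a q n : ℝ) : ℂ) * phase φ m ξ n := by
      rw [eq_sub_iff_add_eq, add_comm,
        ← Finset.sum_Ioc_consecutive _ (Nat.zero_le (c - 1)) (by omega : c - 1 ≤ d - 1)]
      congr 1
      refine Finset.sum_congr ?_ fun n _ => ?_
      · ext n; simp only [Finset.mem_Ico, Finset.mem_Ioc]; omega
      · rw [phase, e_add]; ring
    rw [h2]
    refine (norm_sub_le _ _).trans ?_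
    linarith [h1 (d - 1) (by omega), h1 (c - 1) (by omega)]
  refine ⟨key ξ, ?_⟩
  rw [← RCLike.norm_conj, map_sum]
  have := key (-ξ)
  refine le_trans (le_of_eq ?_) this
  congr 1
  refine Finset.sum_congr rfl fun n _ => ?_
  rw [map_mul, map_mul, conj_e, conj_e, Complex.conj_ofReal, neg_neg, neg_mul]

end PrimeSum

/-! ### Fourier approximation of the sawtooth function -/

section Sawtooth

/-- The sawtooth function. -/
noncomputable def saw (x : ℝ) : ℝ := Int.fract x - 1 / 2

/-- The periodic second Bernoulli function. -/
noncomputable def bern (x : ℝ) : ℝ := Int.fract x ^ 2 - Int.fract x + 1 / 6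

lemma hasSum_bern (x : ℝ) :
    HasSum (fun n : ℕ => 1 / (n : ℝ) ^ 2 * Real.cos (2 * Real.pi * n * x)) (Real.pi ^ 2 * bern x) := by
  have h := hasSum_one_div_nat_pow_mul_cos (k := 1) one_ne_zero (x := Int.fract x)
    ⟨Int.fract_nonneg x, (Int.fract_lt_one x).le⟩
  have hb : (Polynomial.map (algebraMap ℚ ℝ) (Polynomial.bernoulli (2 * 1))).eval (Int.fract x) =
      bern x := by
    rw [bern, Polynomial.bernoulli]
    simp [Finset.sum_range_succ, Polynomial.eval_add, bernoulli_one, bernoulli_two]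
    ring
  rw [hb] at h
  convert! h using 1
  · ext n
    congr 1
    have : 2 * Real.pi * n * x = 2 * Real.pi * n * Int.fract x + ((n * ⌊x⌋ : ℤ) : ℝ) * (2 * Real.pi) := by
      conv_lhs => rw [← Int.fract_add_floor x]
      push_cast; ring
    rw [this, Real.cos_add_int_mul_two_pi]
  · norm_num [Nat.factorial]
    left; ring

/-- The average of the sawtooth function over `[x, x + δ]`. -/
noncomputable def sawAvg (δ x : ℝ) : ℝ := (bern (x + δ) - bern x) / (2 * δ)

lemma fract_add_eq {x δ : ℝ} (hδ : 0 ≤ δ) (h : Int.fract x + δ < 1) :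
    Int.fract (x + δ) = Int.fract x + δ := by
  rw [Int.fract_eq_iff]
  refine ⟨by linarith [Int.fract_nonneg x], h, ⌊x⌋, ?_⟩
  linarith [Int.fract_add_floor x]

lemma fract_add_eq_sub_one {x δ : ℝ} (hδ : δ < 1) (h : 1 ≤ Int.fract x + δ) :
    Int.fract (x + δ) = Int.fract x + δ - 1 := by
  rw [Int.fract_eq_iff]
  refine ⟨by linarith, by linarith [Int.fract_lt_one x], ⌊x⌋ + 1, ?_⟩
  push_cast
  linarith [Int.fract_add_floor x]

/-- Half of `bern` is an antiderivative of `saw`, so the average differs from saw(x) by δ / 2 unless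
[x, x + δ] meets the next integer, which is the exceptional case. -/
lemma abs_saw_sub_sawAvg_le {δ : ℝ} (hδ : 0 < δ) (hδ1 : δ < 1) (x : ℝ) :
    |saw x - sawAvg δ x| ≤ δ + if 1 - δ ≤ Int.fract x then 1 else 0 := by
  rw [saw, sawAvg, bern, bern]
  have h0 := Int.fract_nonneg x
  have h1 := Int.fract_lt_one x
  split_ifs with h
  · rw [fract_add_eq_sub_one hδ1 (by linarith)]
    set f := Int.fract x
    have e1 : ((f + δ - 1) ^ 2 - (f + δ - 1) + 1 / 6 - (f ^ 2 - f + 1 / 6)) / (2 * δ) =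
        (1 - δ) * ((2 - δ - 2 * f) / (2 * δ)) := by field_simp; ring
    rw [e1]
    have h2 : (2 - δ - 2 * f) / (2 * δ) ≤ 1 / 2 := by rw [div_le_iff₀ (by positivity)]; linarith
    have h3 : -(1 / 2) ≤ (2 - δ - 2 * f) / (2 * δ) := by rw [le_div_iff₀ (by positivity)]; linarith
    rw [abs_le]
    constructor <;> nlinarith
  · rw [fract_add_eq hδ.le (by linarith)]
    set f := Int.fract x
    have e1 : f - 1 / 2 - ((f + δ) ^ 2 - (f + δ) + 1 / 6 - (f ^ 2 - f + 1 / 6)) / (2 * δ) =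
        -(δ / 2) := by field_simp; ring
    rw [e1, abs_neg, abs_of_pos (by positivity)]
    linarith

/-- Passing from x to x - ψ lowers the fractional part by ψ, and then adds 1 exactly if it was less
than ψ. This turns membership in B into sawtooth values. -/
lemma indicator_eq_saw {x ψ : ℝ} (h0 : 0 < ψ) (h1 : ψ < 1) :
    (if Int.fract x < ψ then (1 : ℝ) else 0) = ψ + saw (x - ψ) - saw x := by
  rw [saw, saw]
  split_ifs with h
  · have : Int.fract (x - ψ) = Int.fract x - ψ + 1 := by
      rw [Int.fract_eq_iff]
      refine ⟨by linarith [Int.fract_nonneg x], by linarith, ⌊x⌋ - 1, ?_⟩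
      push_cast
      linarith [Int.fract_add_floor x]
    rw [this]; ring
  · have : Int.fract (x - ψ) = Int.fract x - ψ := by
      rw [Int.fract_eq_iff]
      refine ⟨by linarith, by linarith [Int.fract_lt_one x], ⌊x⌋, ?_⟩
      linarith [Int.fract_add_floor x]
    rw [this]; ring

/-- The Fourier coefficients of `sawAvg δ`. -/
noncomputable def sawCoeff (δ : ℝ) (m : ℕ) : ℂ :=
  (e (m * δ) - 1) / ((4 * Real.pi ^ 2 * δ * (m : ℝ) ^ 2 : ℝ) : ℂ)

lemma norm_sawCoeff_le {δ : ℝ} (hδ : 0 < δ) (m : ℕ) :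
    ‖sawCoeff δ m‖ ≤ 1 / (2 * δ) * ((m : ℝ) ^ 2)⁻¹ := by
  rw [sawCoeff, norm_div, Complex.norm_real, Real.norm_eq_abs, abs_of_nonneg (by positivity)]
  have h1 : ‖e (m * δ) - 1‖ ≤ 2 := (norm_sub_le _ _).trans (by simp; norm_num)
  rcases Nat.eq_zero_or_pos m with h | h
  · subst h; simp
  have hm : (0 : ℝ) < m := by exact_mod_cast h
  have hpi : 1 ≤ Real.pi ^ 2 := by nlinarith [Real.pi_gt_three]
  calc ‖e (m * δ) - 1‖ / (4 * Real.pi ^ 2 * δ * (m : ℝ) ^ 2) ≤ 2 / (4 * 1 * δ * (m : ℝ) ^ 2) := by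
        gcongr
    _ = _ := by field_simp; ring

/-- The Fourier polynomial of degree `K` of `sawAvg δ`. -/
noncomputable def sawPoly (δ : ℝ) (K : ℕ) (x : ℝ) : ℂ :=
  ∑ m ∈ Finset.Ioc 0 K, (sawCoeff δ m * e (m * x) + (starRingEnd ℂ) (sawCoeff δ m) * e (-(m * x)))

lemma sawPoly_term_eq {δ : ℝ} (hδ : 0 < δ) (m : ℕ) (x : ℝ) :
    sawCoeff δ m * e (m * x) + (starRingEnd ℂ) (sawCoeff δ m) * e (-(m * x)) =
      (((1 / (m : ℝ) ^ 2 * Real.cos (2 * Real.pi * m * (x + δ)) -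
        1 / (m : ℝ) ^ 2 * Real.cos (2 * Real.pi * m * x)) / (Real.pi ^ 2 * (2 * δ)) : ℝ) : ℂ) := by
  rcases Nat.eq_zero_or_pos m with h | h
  · subst h; simp [sawCoeff]
  have hm : (0 : ℝ) < m := by exact_mod_cast h
  have hpi := Real.pi_pos
  rw [← conj_e, ← map_mul, Complex.add_conj]
  have h1 : sawCoeff δ m * e (m * x) =
      (((1 / (4 * Real.pi ^ 2 * δ * (m : ℝ) ^ 2)) : ℝ) : ℂ) * (e (m * (x + δ)) - e (m * x)) := by
    have : e (m * (x + δ)) = e (m * x) * e (m * δ) := by rw [← e_add]; ring_nf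
    rw [sawCoeff, this]
    push_cast
    ring
  have h2 : ∀ t : ℝ, (e (m * t)).re = Real.cos (2 * Real.pi * m * t) := fun t => by
    rw [e_eq_exp_ofReal, Complex.exp_ofReal_mul_I_re]; ring_nf
  rw [h1, Complex.re_ofReal_mul, Complex.sub_re, h2, h2]
  congr 1
  field_simp
  ring

/-- Averaging makes the coefficients O(1 / (δ m²)), hence summable; the tail beyond K is O(1 / (δ
K)). -/
lemma norm_sawAvg_sub_sawPoly_le {δ : ℝ} (hδ : 0 < δ) {K : ℕ} (hK : 1 ≤ K) (x : ℝ) :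
    ‖((sawAvg δ x : ℝ) : ℂ) - sawPoly δ K x‖ ≤ 1 / (δ * K) := by
  set u : ℕ → ℂ := fun m =>
    sawCoeff δ m * e (m * x) + (starRingEnd ℂ) (sawCoeff δ m) * e (-(m * x)) with hu
  have hsum : HasSum u ((sawAvg δ x : ℝ) : ℂ) := by
    have h1 := ((hasSum_bern (x + δ)).sub (hasSum_bern x)).div_const (Real.pi ^ 2 * (2 * δ))
    have h2 : (Real.pi ^ 2 * bern (x + δ) - Real.pi ^ 2 * bern x) / (Real.pi ^ 2 * (2 * δ)) =
        sawAvg δ x := by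
      have := Real.pi_pos
      rw [sawAvg]; field_simp
    rw [h2] at h1
    have h3 := (Complex.hasSum_ofReal (f := fun m : ℕ =>
      (1 / (m : ℝ) ^ 2 * Real.cos (2 * Real.pi * m * (x + δ)) -
        1 / (m : ℝ) ^ 2 * Real.cos (2 * Real.pi * m * x)) / (Real.pi ^ 2 * (2 * δ)))).2 h1
    convert! h3 using 1
    ext m
    exact sawPoly_term_eq hδ m x
  have hun : ∀ m, ‖u m‖ ≤ 1 / δ * ((m : ℝ) ^ 2)⁻¹ := fun m => by
    simp only [hu]
    refine (norm_add_le _ _).trans ?_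
    rw [norm_mul, norm_mul, norm_e, norm_e, RCLike.norm_conj, mul_one]
    have h1 := norm_sawCoeff_le hδ m
    have : 1 / δ * ((m : ℝ) ^ 2)⁻¹ = 2 * (1 / (2 * δ) * ((m : ℝ) ^ 2)⁻¹) := by field_simp
    linarith
  have hlim : Tendsto (fun J => ∑ m ∈ Finset.range (J + 1), u m - sawPoly δ K x) atTop
      (𝓝 (((sawAvg δ x : ℝ) : ℂ) - sawPoly δ K x)) :=
    ((hsum.tendsto_sum_nat.comp (tendsto_add_atTop_nat 1))).sub_const _
  refine le_of_tendsto hlim.norm ?_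
  filter_upwards [eventually_ge_atTop K] with J hJ
  have h0 : u 0 = 0 := by simp [hu, sawCoeff]
  have h1 : ∑ m ∈ Finset.range (J + 1), u m - sawPoly δ K x = ∑ m ∈ Finset.Ioc K J, u m := by
    rw [Finset.range_eq_Ico, ← Finset.sum_Ico_consecutive u (Nat.zero_le 1) (by omega)]
    simp only [Nat.Ico_zero_eq_range, Finset.sum_range_one, h0, zero_add]
    change _ - ∑ m ∈ Finset.Ioc 0 K, u m = _
    rw [sub_eq_iff_eq_add, add_comm (∑ m ∈ Finset.Ioc K J, u m),
      Finset.sum_Ioc_consecutive u (Nat.zero_le K) hJ]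
    refine Finset.sum_congr ?_ fun _ _ => rfl
    ext m; simp only [Finset.mem_Ico, Finset.mem_Ioc]; omega
  rw [h1]
  refine (norm_sum_le_of_le _ fun m _ => hun m).trans ?_
  rw [← Finset.mul_sum]
  have h2 := sum_Ioc_inv_sq_le_sub (α := ℝ) (show K ≠ 0 by omega) hJ
  have h3 : (0 : ℝ) ≤ (J : ℝ)⁻¹ := by positivity
  calc 1 / δ * ∑ m ∈ Finset.Ioc K J, ((m : ℝ) ^ 2)⁻¹ ≤ 1 / δ * (K : ℝ)⁻¹ := by
        gcongr; linarith
    _ = _ := by rw [one_div, one_div, mul_inv]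

/-- The number of terms of a sequence close to an integer from below. -/
lemma card_fract_near_one_le (x : ℕ → ℝ) {M c d : ℕ} (hM : 1 ≤ M) (hcd : c ≤ d) {E : ℝ}
    (hE0 : 0 ≤ E)
    (hE : ∀ j : ℕ, 1 ≤ j → j < M → ‖∑ n ∈ Finset.Ico c d, e (j * x n)‖ ≤ E) :
    ∑ n ∈ Finset.Ico c d, (if 1 - 1 / (8 * (M : ℝ)) ≤ Int.fract (x n) then (1 : ℝ) else 0) ≤
      4 * ((d - c : ℝ) / M + E) := by
  have hM0 : (0 : ℝ) < M := by exact_mod_cast hM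
  -- If x n is within 1 / (8 M) below an integer, all e(j x n) with j < M have real part at least
  -- 1/2, so the sum over j has norm at least M / 2. The square is opened afterwards, and the
  -- differences of two j are frequencies below M.
  have h1 : ∀ n ∈ Finset.Ico c d,
      (if 1 - 1 / (8 * (M : ℝ)) ≤ Int.fract (x n) then (1 : ℝ) else 0) ≤
      4 / (M : ℝ) ^ 2 * ‖∑ j ∈ Finset.range M, e (j * x n)‖ ^ 2 := by
    intro n _
    split_ifs with h
    · set t : ℝ := 1 - Int.fract (x n) with ht
      have ht0 : 0 ≤ t := by rw [ht]; linarith [Int.fract_lt_one (x n)]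
      have ht1 : t ≤ 1 / (8 * (M : ℝ)) := by rw [ht]; linarith
      have hre : ∀ j ∈ Finset.range M, (1 / 2 : ℝ) ≤ (e (j * x n)).re := by
        intro j hj
        have hj' : (j : ℝ) ≤ M := by exact_mod_cast (Finset.mem_range.1 hj).le
        have e1 : (j : ℝ) * x n = -(j * t) - ((-(j * (⌊x n⌋ + 1)) : ℤ) : ℝ) := by
          push_cast
          rw [ht]
          linear_combination (-(j : ℝ)) * (Int.fract_add_floor (x n))
        rw [e1, e_sub_int, e_eq_exp_ofReal, Complex.exp_ofReal_mul_I_re]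
        refine le_trans ?_ (Real.one_sub_sq_div_two_le_cos)
        have hjt : (j : ℝ) * t ≤ 1 / 8 := by
          calc (j : ℝ) * t ≤ M * (1 / (8 * (M : ℝ))) := by gcongr
            _ = 1 / 8 := by field_simp
        have hjt0 : 0 ≤ (j : ℝ) * t := by positivity
        have hpi := Real.pi_lt_d2
        have hpi0 := Real.pi_pos
        have h5 : 2 * Real.pi * (j * t) ≤ 1 := by nlinarith
        have h6 : 0 ≤ 2 * Real.pi * (j * t) := by positivity
        nlinarith
      have hsum : (M : ℝ) / 2 ≤ ‖∑ j ∈ Finset.range M, e (j * x n)‖ := by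
        refine le_trans ?_ (Complex.re_le_norm _)
        rw [Complex.re_sum]
        have := Finset.card_nsmul_le_sum _ _ _ hre
        rw [Finset.card_range, nsmul_eq_mul] at this
        linarith
      calc (1 : ℝ) = 4 / (M : ℝ) ^ 2 * ((M : ℝ) / 2) ^ 2 := by field_simp; norm_num
        _ ≤ _ := by gcongr
    · positivity
  refine (Finset.sum_le_sum h1).trans ?_
  rw [← Finset.mul_sum]
  have h2 := sum_norm_sq_sum_le (Finset.Ico c d) (Finset.range M) (fun j n => e (j * x n))
  have hcard : ((Finset.Ico c d).card : ℝ) = d - c := by rw [Nat.card_Ico, Nat.cast_sub hcd]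
  have hoff : ∀ j₁ ∈ Finset.range M, ∀ j₂ ∈ Finset.range M, j₁ ≠ j₂ →
      ‖∑ n ∈ Finset.Ico c d, e (j₁ * x n) * (starRingEnd ℂ) (e (j₂ * x n))‖ ≤ E := by
    have key : ∀ j₁ < M, ∀ j₂ < j₁,
        ‖∑ n ∈ Finset.Ico c d, e (j₁ * x n) * (starRingEnd ℂ) (e (j₂ * x n))‖ ≤ E := by
      intro j₁ h1 j₂ h2
      refine le_trans (le_of_eq ?_) (hE (j₁ - j₂) (by omega) (by omega))
      congr 1
      refine Finset.sum_congr rfl fun n _ => ?_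
      rw [conj_e, ← e_add, Nat.cast_sub h2.le]; congr 1; ring
    intro j₁ h1 j₂ h2 hne
    rw [Finset.mem_range] at h1 h2
    rcases lt_or_gt_of_ne hne with h | h
    · rw [← RCLike.norm_conj, map_sum]
      simp_rw [map_mul, Complex.conj_conj, mul_comm ((starRingEnd ℂ) _)]
      exact key j₂ h2 j₁ h
    · exact key j₁ h1 j₂ h
  have h3 : ∑ n ∈ Finset.Ico c d, ‖∑ j ∈ Finset.range M, e (j * x n)‖ ^ 2 ≤
      M * ((d - c : ℝ) + M * E) := by
    refine h2.trans ?_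
    have := Finset.sum_le_card_nsmul (Finset.range M) (fun j₁ => ∑ j₂ ∈ Finset.range M,
      ‖∑ n ∈ Finset.Ico c d, e (j₁ * x n) * (starRingEnd ℂ) (e (j₂ * x n))‖)
      ((d - c : ℝ) + M * E) (fun j₁ hj₁ => by
        rw [← Finset.add_sum_erase _ _ hj₁]
        refine add_le_add ?_ ?_
        · refine (norm_sum_le _ _).trans ?_
          simp [Nat.cast_sub hcd]
        · refine (Finset.sum_le_card_nsmul _ _ E fun j₂ hj₂ => ?_).trans ?_
          · rw [Finset.mem_erase] at hj₂
            exact hoff j₁ hj₁ j₂ hj₂.2 hj₂.1.symm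
          · rw [nsmul_eq_mul]
            refine mul_le_mul_of_nonneg_right ?_ hE0
            have : ((Finset.range M).erase j₁).card ≤ M :=
              Finset.card_erase_le.trans (Finset.card_range M).le
            exact_mod_cast this)
    rwa [Finset.card_range, nsmul_eq_mul] at this
  calc 4 / (M : ℝ) ^ 2 * ∑ n ∈ Finset.Ico c d, ‖∑ j ∈ Finset.range M, e (j * x n)‖ ^ 2
      ≤ 4 / (M : ℝ) ^ 2 * (M * ((d - c : ℝ) + M * E)) := by gcongr
    _ = _ := by field_simp

end Sawtooth

/-! ### Removing the weight 1/ψ, and assembling the sawtooth sum -/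

section Weight

lemma norm_e_sub_one_mul_inv_le (μ : ℝ) {u : ℝ} (hu : 0 < u) :
    ‖(e (μ * u) - 1) * ((u⁻¹ : ℝ) : ℂ)‖ ≤ 2 * Real.pi * |μ| := by
  rw [norm_mul, Complex.norm_real, Real.norm_eq_abs, abs_of_pos (inv_pos.2 hu),
    ← div_eq_mul_inv, div_le_iff₀ hu]
  refine (norm_e_sub_one_le _).trans ?_
  rw [abs_mul, abs_of_pos hu]
  linarith

/-- The function t ↦ (e(μt) - 1) / t varies by O(|μ|) times the variation of log t, so along a
decreasing ψ its total variation is O(|μ| log(1 / ψ)) and does not involve a power of 1 / ψ. -/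
lemma norm_quotient_sub_le (μ : ℝ) {u v : ℝ} (hv : 0 < v) (hvu : v ≤ u) :
    ‖(e (μ * v) - 1) * ((v⁻¹ : ℝ) : ℂ) - (e (μ * u) - 1) * ((u⁻¹ : ℝ) : ℂ)‖ ≤
      4 * Real.pi * |μ| * (Real.log u - Real.log v) := by
  have hu : 0 < u := hv.trans_le hvu
  have hpi := Real.pi_pos
  have e1 : (e (μ * v) - 1) * ((v⁻¹ : ℝ) : ℂ) - (e (μ * u) - 1) * ((u⁻¹ : ℝ) : ℂ) =
      (e (μ * v) - e (μ * u)) * ((u⁻¹ : ℝ) : ℂ) + (e (μ * v) - 1) * ((v⁻¹ - u⁻¹ : ℝ) : ℂ) := by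
    push_cast; ring
  have h1 : ‖(e (μ * v) - e (μ * u)) * ((u⁻¹ : ℝ) : ℂ)‖ ≤ 2 * Real.pi * |μ| * ((u - v) / u) := by
    rw [norm_mul, Complex.norm_real, Real.norm_eq_abs, abs_of_pos (inv_pos.2 hu)]
    have := norm_e_sub_e_le (μ * v) (μ * u)
    rw [← mul_sub, abs_mul, abs_sub_comm v u, abs_of_nonneg (sub_nonneg.2 hvu)] at this
    calc _ ≤ 2 * Real.pi * (|μ| * (u - v)) * u⁻¹ := by gcongr
      _ = _ := by ring
  have h2 : ‖(e (μ * v) - 1) * ((v⁻¹ - u⁻¹ : ℝ) : ℂ)‖ ≤ 2 * Real.pi * |μ| * ((u - v) / u) := by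
    have h3 : 0 ≤ v⁻¹ - u⁻¹ := by rw [sub_nonneg]; gcongr
    rw [norm_mul, Complex.norm_real, Real.norm_eq_abs, abs_of_nonneg h3]
    have := norm_e_sub_one_le (μ * v)
    rw [abs_mul, abs_of_pos hv] at this
    calc _ ≤ 2 * Real.pi * (|μ| * v) * (v⁻¹ - u⁻¹) := by gcongr
      _ = _ := by field_simp
  have h3 : (u - v) / u ≤ Real.log u - Real.log v := by
    have := Real.log_le_sub_one_of_pos (div_pos hv hu)
    rw [Real.log_div hv.ne' hu.ne'] at this
    have e2 : (u - v) / u = 1 - v / u := by field_simp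
    linarith
  rw [e1]
  calc _ ≤ 2 * Real.pi * |μ| * ((u - v) / u) + 2 * Real.pi * |μ| * ((u - v) / u) :=
        (norm_add_le _ _).trans (add_le_add h1 h2)
    _ = 4 * Real.pi * |μ| * ((u - v) / u) := by ring
    _ ≤ _ := by gcongr

lemma variation_quotient_le {ψ : ℕ → ℝ} {c d : ℕ} (hcd : c ≤ d)
    (hpos : ∀ n, c ≤ n → n ≤ d → 0 < ψ n) (hhalf : ∀ n, c ≤ n → n ≤ d → ψ n ≤ 1 / 2)
    (hanti : ∀ n, c ≤ n → n < d → ψ (n + 1) ≤ ψ n) (μ : ℝ) :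
    ‖(e (μ * ψ d) - 1) * (((ψ d)⁻¹ : ℝ) : ℂ)‖ + ∑ n ∈ Finset.Ico c d,
      ‖(e (μ * ψ (n + 1)) - 1) * (((ψ (n + 1))⁻¹ : ℝ) : ℂ) -
        (e (μ * ψ n) - 1) * (((ψ n)⁻¹ : ℝ) : ℂ)‖ ≤
      2 * Real.pi * |μ| * (1 + 2 * -Real.log (ψ d)) := by
  have h1 := norm_e_sub_one_mul_inv_le μ (hpos d hcd le_rfl)
  have hpi := Real.pi_pos
  have h2 : ∑ n ∈ Finset.Ico c d, ‖(e (μ * ψ (n + 1)) - 1) * (((ψ (n + 1))⁻¹ : ℝ) : ℂ) -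
        (e (μ * ψ n) - 1) * (((ψ n)⁻¹ : ℝ) : ℂ)‖ ≤
      ∑ n ∈ Finset.Ico c d, (4 * Real.pi * |μ| * -Real.log (ψ (n + 1)) -
        4 * Real.pi * |μ| * -Real.log (ψ n)) := by
    refine Finset.sum_le_sum fun n hn => ?_
    rw [Finset.mem_Ico] at hn
    refine (norm_quotient_sub_le μ (hpos (n + 1) (by omega) (by omega))
      (hanti n hn.1 hn.2)).trans (le_of_eq ?_)
    ring
  rw [Finset.sum_Ico_sub (fun n => 4 * Real.pi * |μ| * -Real.log (ψ n)) hcd] at h2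
  have h3 : 0 ≤ 4 * Real.pi * |μ| * -Real.log (ψ c) := by
    have := Real.log_nonpos (hpos c le_rfl hcd).le ((hhalf c le_rfl hcd).trans (by norm_num))
    have : 0 ≤ -Real.log (ψ c) := by linarith
    positivity
  linarith

/-- In the difference of the two polynomials the m-th term carries (e(∓m ψ) - 1) / ψ, of size and
variation O(m) up to a logarithm. Against a coefficient O(1 / (δ m²)) this leaves 1 / (δ m), and the
sum over m gives only log K. -/
lemma norm_sum_sawPoly_le {ψ x : ℕ → ℝ} {v : ℕ → ℂ} {c d K : ℕ} {δ B : ℝ} (hδ : 0 < δ)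
    (hK : 1 ≤ K) (hcd : c ≤ d) (hpos : ∀ n, c ≤ n → n ≤ d → 0 < ψ n)
    (hhalf : ∀ n, c ≤ n → n ≤ d → ψ n ≤ 1 / 2)
    (hanti : ∀ n, c ≤ n → n < d → ψ (n + 1) ≤ ψ n)
    (hB : ∀ m : ℕ, 1 ≤ m → m ≤ K → ∀ b, c ≤ b → b ≤ d →
      ‖∑ n ∈ Finset.Ico c b, v n * e (m * x n)‖ ≤ B ∧
      ‖∑ n ∈ Finset.Ico c b, v n * e (-(m * x n))‖ ≤ B) :
    ‖∑ n ∈ Finset.Ico c d, v n * (((ψ n)⁻¹ : ℝ) : ℂ) *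
        (sawPoly δ K (x n - ψ n) - sawPoly δ K (x n))‖ ≤
      2 * Real.pi / δ * (1 + 2 * -Real.log (ψ d)) * (1 + Real.log K) * B := by
  set V : ℝ := 1 + 2 * -Real.log (ψ d) with hV
  have hpi := Real.pi_pos
  have hV0 : 0 ≤ V := by
    have := Real.log_nonpos (hpos d hcd le_rfl).le ((hhalf d hcd le_rfl).trans (by norm_num))
    rw [hV]; linarith
  have hB0 : 0 ≤ B := (norm_nonneg _).trans (hB 1 le_rfl hK c le_rfl hcd).1
  have hexp : ∑ n ∈ Finset.Ico c d, v n * (((ψ n)⁻¹ : ℝ) : ℂ) *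
        (sawPoly δ K (x n - ψ n) - sawPoly δ K (x n)) =
      ∑ m ∈ Finset.Ioc 0 K, (sawCoeff δ m * ∑ n ∈ Finset.Ico c d,
          ((e (-m * ψ n) - 1) * (((ψ n)⁻¹ : ℝ) : ℂ)) * (v n * e (m * x n)) +
        (starRingEnd ℂ) (sawCoeff δ m) * ∑ n ∈ Finset.Ico c d,
          ((e (m * ψ n) - 1) * (((ψ n)⁻¹ : ℝ) : ℂ)) * (v n * e (-(m * x n)))) := by
    simp_rw [sawPoly, ← Finset.sum_sub_distrib, Finset.mul_sum, ← Finset.sum_add_distrib]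
    rw [Finset.sum_comm]
    refine Finset.sum_congr rfl fun m _ => Finset.sum_congr rfl fun n _ => ?_
    have h1 : e (m * (x n - ψ n)) = e (m * x n) * e (-m * ψ n) := by
      rw [← e_add]; ring_nf
    have h2 : e (-(m * (x n - ψ n))) = e (-(m * x n)) * e (m * ψ n) := by
      rw [← e_add]; ring_nf
    rw [h1, h2]
    ring
  rw [hexp]
  have hterm : ∀ m ∈ Finset.Ioc 0 K, ‖sawCoeff δ m * ∑ n ∈ Finset.Ico c d,
          ((e (-m * ψ n) - 1) * (((ψ n)⁻¹ : ℝ) : ℂ)) * (v n * e (m * x n)) +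
        (starRingEnd ℂ) (sawCoeff δ m) * ∑ n ∈ Finset.Ico c d,
          ((e (m * ψ n) - 1) * (((ψ n)⁻¹ : ℝ) : ℂ)) * (v n * e (-(m * x n)))‖ ≤
      2 * Real.pi / δ * V * B * ((m : ℝ))⁻¹ := by
    intro m hm
    rw [Finset.mem_Ioc] at hm
    have hm0 : (0 : ℝ) < m := by exact_mod_cast hm.1
    have h1 := norm_sum_mul_le_of_variation
      (fun n => (e (-m * ψ n) - 1) * (((ψ n)⁻¹ : ℝ) : ℂ)) (fun n => v n * e (m * x n)) hcd
      (fun b h1 h2 => (hB m hm.1 hm.2 b h1 h2).1)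
      (variation_quotient_le hcd hpos hhalf hanti (-m))
    have h2 := norm_sum_mul_le_of_variation
      (fun n => (e (m * ψ n) - 1) * (((ψ n)⁻¹ : ℝ) : ℂ)) (fun n => v n * e (-(m * x n))) hcd
      (fun b h1 h2 => (hB m hm.1 hm.2 b h1 h2).2)
      (variation_quotient_le hcd hpos hhalf hanti m)
    rw [abs_neg, abs_of_pos hm0] at h1
    rw [abs_of_pos hm0] at h2
    refine (norm_add_le _ _).trans ?_
    rw [norm_mul, norm_mul, RCLike.norm_conj]
    have h3 := norm_sawCoeff_le hδ m
    calc _ ≤ 1 / (2 * δ) * ((m : ℝ) ^ 2)⁻¹ * (2 * Real.pi * m * V * B) +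
        1 / (2 * δ) * ((m : ℝ) ^ 2)⁻¹ * (2 * Real.pi * m * V * B) := by gcongr
      _ = _ := by field_simp; ring
  refine (norm_sum_le_of_le _ hterm).trans ?_
  rw [← Finset.mul_sum]
  have hharm : ∑ m ∈ Finset.Ioc 0 K, ((m : ℝ))⁻¹ ≤ 1 + Real.log K := by
    have h1 := harmonic_le_one_add_log K
    rw [harmonic_eq_sum_Icc] at h1
    push_cast at h1
    refine le_trans (le_of_eq ?_) h1
    refine Finset.sum_congr ?_ fun _ _ => rfl
    ext m; simp only [Finset.mem_Icc, Finset.mem_Ioc]; omega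
  calc _ ≤ 2 * Real.pi / δ * V * B * (1 + Real.log K) := by gcongr
    _ = _ := by ring

/-- The smoothing length is δ = 1 / (8 M). The first term is the Fourier part. In the second, where
ψ⁻¹ is bounded by Ψ, are the errors δ and 1 / (δ K) and the count of n with φ(n) or φ(n) - ψ(n) just
below an integer. -/
lemma norm_sum_saw_sub_le {ψ x : ℕ → ℝ} {v : ℕ → ℂ} {c d K M : ℕ} {A B E Ψ : ℝ}
    (hcd : c ≤ d) (hK : 1 ≤ K) (hM : 1 ≤ M) (hpos : ∀ n, c ≤ n → n ≤ d → 0 < ψ n)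
    (hhalf : ∀ n, c ≤ n → n ≤ d → ψ n ≤ 1 / 2)
    (hanti : ∀ n, c ≤ n → n < d → ψ (n + 1) ≤ ψ n)
    (hΨ : ∀ n, c ≤ n → n < d → (ψ n)⁻¹ ≤ Ψ) (hΨ0 : 0 ≤ Ψ)
    (hv : ∀ n, c ≤ n → n < d → ‖v n‖ ≤ A) (hA0 : 0 ≤ A)
    (hB : ∀ m : ℕ, 1 ≤ m → m ≤ K → ∀ b, c ≤ b → b ≤ d →
      ‖∑ n ∈ Finset.Ico c b, v n * e (m * x n)‖ ≤ B ∧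
      ‖∑ n ∈ Finset.Ico c b, v n * e (-(m * x n))‖ ≤ B)
    (hE : ∀ j : ℕ, 1 ≤ j → j < M → ∀ b, c ≤ b → b ≤ d →
      ‖∑ n ∈ Finset.Ico c b, e (j * x n)‖ ≤ E) (hE0 : 0 ≤ E) :
    ‖∑ n ∈ Finset.Ico c d, v n * (((ψ n)⁻¹ : ℝ) : ℂ) *
        ((saw (x n - ψ n) - saw (x n) : ℝ) : ℂ)‖ ≤
      16 * Real.pi * M * (1 + 2 * -Real.log (ψ d)) * (1 + Real.log K) * B +
      A * Ψ * ((d - c : ℝ) * (1 / (4 * M) + 16 * M / K + 8 / M) + 24 * M * E) := by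
  have hM0 : (0 : ℝ) < M := by exact_mod_cast hM
  have hM1 : (1 : ℝ) ≤ M := by exact_mod_cast hM
  have hK0 : (0 : ℝ) < K := by exact_mod_cast hK
  have hpi := Real.pi_pos
  set δ : ℝ := 1 / (8 * M) with hδdef
  have hδ : 0 < δ := by positivity
  have hδ1 : δ < 1 := by rw [hδdef, div_lt_one (by positivity)]; linarith
  have happrox : ∀ t : ℝ, ‖((saw t : ℝ) : ℂ) - sawPoly δ K t‖ ≤
      δ + 1 / (δ * K) + if 1 - δ ≤ Int.fract t then 1 else 0 := by
    intro t
    have h1 := abs_saw_sub_sawAvg_le hδ hδ1 t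
    have h2 := norm_sawAvg_sub_sawPoly_le hδ hK t
    have e1 : ((saw t : ℝ) : ℂ) - sawPoly δ K t =
        ((saw t - sawAvg δ t : ℝ) : ℂ) + (((sawAvg δ t : ℝ) : ℂ) - sawPoly δ K t) := by
      push_cast; ring
    rw [e1]
    refine (norm_add_le _ _).trans ?_
    rw [Complex.norm_real, Real.norm_eq_abs]
    linarith
  have hmain := norm_sum_sawPoly_le hδ hK hcd hpos hhalf hanti hB
  have e2 : 2 * Real.pi / δ = 16 * Real.pi * M := by rw [hδdef]; field_simp; ring
  rw [e2] at hmain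
  have hcount1 := card_fract_near_one_le x hM hcd hE0 (fun j h1 h2 => hE j h1 h2 d hcd le_rfl)
  -- For the shifted sequence the factor e(-j ψ n) is removed by summation by parts: its last value
  -- and variation total at most 1 + π j ≤ 5 M.
  have hcount2 := card_fract_near_one_le (fun n => x n - ψ n) hM hcd (E := 5 * M * E)
    (by positivity) (fun j h1 h2 => by
      have hj0 : (1 : ℝ) ≤ j := by exact_mod_cast h1
      have hjM : (j : ℝ) ≤ M := by exact_mod_cast h2.le
      have e3 : ∑ n ∈ Finset.Ico c d, e (j * (x n - ψ n)) =
          ∑ n ∈ Finset.Ico c d, e (-(j * ψ n)) * e (j * x n) :=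
        Finset.sum_congr rfl fun n _ => by rw [← e_add]; ring_nf
      rw [e3]
      refine norm_sum_mul_le_of_variation (fun n => e (-(j * ψ n))) (fun n => e (j * x n)) hcd
        (fun b hb1 hb2 => hE j h1 h2 b hb1 hb2) ?_
      have h3 : ∑ n ∈ Finset.Ico c d, ‖e (-(j * ψ (n + 1))) - e (-(j * ψ n))‖ ≤
          ∑ n ∈ Finset.Ico c d, (-(2 * Real.pi * j * ψ (n + 1)) - -(2 * Real.pi * j * ψ n)) := by
        refine Finset.sum_le_sum fun n hn => ?_
        rw [Finset.mem_Ico] at hn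
        refine (norm_e_sub_e_le _ _).trans (le_of_eq ?_)
        have h4 := hanti n hn.1 hn.2
        have h5 : (j : ℝ) * (ψ n - ψ (n + 1)) ≥ 0 := by
          apply mul_nonneg <;> linarith
        rw [show -(j * ψ (n + 1)) - -(j * ψ n) = (j : ℝ) * (ψ n - ψ (n + 1)) by ring,
          abs_of_nonneg h5]
        ring
      rw [Finset.sum_Ico_sub (fun n => -(2 * Real.pi * j * ψ n)) hcd] at h3
      rw [norm_e]
      have h6 := hhalf c le_rfl hcd
      have h7 := (hpos d hcd le_rfl).le
      have h8 := Real.pi_lt_d2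
      have h9 : 2 * Real.pi * j * ψ c ≤ 2 * Real.pi * j * (1 / 2) := by gcongr
      have h10 : 0 ≤ 2 * Real.pi * j * ψ d := by positivity
      have h11 : Real.pi * j ≤ 3.15 * j := by gcongr
      linarith)
  have hsplit : ∑ n ∈ Finset.Ico c d, v n * (((ψ n)⁻¹ : ℝ) : ℂ) *
        ((saw (x n - ψ n) - saw (x n) : ℝ) : ℂ) =
      ∑ n ∈ Finset.Ico c d, v n * (((ψ n)⁻¹ : ℝ) : ℂ) *
        (sawPoly δ K (x n - ψ n) - sawPoly δ K (x n)) +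
      ∑ n ∈ Finset.Ico c d, v n * (((ψ n)⁻¹ : ℝ) : ℂ) *
        ((((saw (x n - ψ n) : ℝ) : ℂ) - sawPoly δ K (x n - ψ n)) -
          (((saw (x n) : ℝ) : ℂ) - sawPoly δ K (x n))) := by
    rw [← Finset.sum_add_distrib]
    refine Finset.sum_congr rfl fun n _ => ?_
    push_cast; ring
  rw [hsplit]
  refine (norm_add_le _ _).trans (add_le_add hmain ?_)
  have herr : ∀ n ∈ Finset.Ico c d, ‖v n * (((ψ n)⁻¹ : ℝ) : ℂ) *
        ((((saw (x n - ψ n) : ℝ) : ℂ) - sawPoly δ K (x n - ψ n)) -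
          (((saw (x n) : ℝ) : ℂ) - sawPoly δ K (x n)))‖ ≤
      A * Ψ * (2 * (δ + 1 / (δ * K)) + (if 1 - δ ≤ Int.fract (x n - ψ n) then (1 : ℝ) else 0) +
        (if 1 - δ ≤ Int.fract (x n) then (1 : ℝ) else 0)) := by
    intro n hn
    rw [Finset.mem_Ico] at hn
    have hψ := hpos n hn.1 hn.2.le
    rw [norm_mul, norm_mul, Complex.norm_real, Real.norm_eq_abs, abs_of_pos (inv_pos.2 hψ)]
    have h1 := hv n hn.1 hn.2
    have h2 := hΨ n hn.1 hn.2
    have h3 := (norm_sub_le (((saw (x n - ψ n) : ℝ) : ℂ) - sawPoly δ K (x n - ψ n))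
      (((saw (x n) : ℝ) : ℂ) - sawPoly δ K (x n)))
    have h4 := happrox (x n - ψ n)
    have h5 := happrox (x n)
    have h6 : 0 < (ψ n)⁻¹ := inv_pos.2 hψ
    gcongr
    linarith
  refine (norm_sum_le_of_le _ herr).trans ?_
  rw [← Finset.mul_sum, Finset.sum_add_distrib, Finset.sum_add_distrib, Finset.sum_const,
    Nat.card_Ico, nsmul_eq_mul, Nat.cast_sub hcd]
  have hAΨ : 0 ≤ A * Ψ := by positivity
  refine mul_le_mul_of_nonneg_left ?_ hAΨ
  have e4 : 2 * (δ + 1 / (δ * K)) = 1 / (4 * M) + 16 * M / K := by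
    rw [hδdef]; field_simp; ring
  rw [e4]
  have h7 : M * E ≥ E := by nlinarith
  have e5 : (d - c : ℝ) * (1 / (4 * M) + 16 * M / K + 8 / M) =
    (d - c : ℝ) * (1 / (4 * M) + 16 * M / K) + 8 * ((d - c : ℝ) / M) := by ring
  rw [e5]
  linarith

end Weight

/-- The same test with k = 1 and ξ = 0, over all integers, serves to count the n near the jumps of
the sawtooth. -/
lemma IsPhase.norm_sum_Ico_e_le {φ φ₁ φ₂ φ₃ : ℝ → ℝ} {X y η : ℝ}
    (hφ : IsPhase φ φ₁ φ₂ φ₃ X y η) {N j c d : ℕ} (hj : 1 ≤ j) (hc : X ≤ c) (hcd : c ≤ d)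
    (hd : d ≤ N + 1) :
    ‖∑ n ∈ Finset.Ico c d, e (j * φ n)‖ ≤
      (Nat.log 2 N + 1) * (132 * √j * (9 * (N : ℝ)) ^ ((1 + y + 3 * η) / 2)) := by
  have hX := hφ.one_le
  have hc1 : 1 ≤ c := by exact_mod_cast hX.trans hc
  set g : ℕ → ℂ := fun n => if c ≤ n then e (j * φ n) else 0 with hg
  have hsum : ∑ n ∈ Finset.Ico c d, e (j * φ n) = ∑ n ∈ Finset.Ioc 0 (d - 1), g n := by
    simp only [hg]
    rw [← Finset.sum_filter]
    refine Finset.sum_congr ?_ fun _ _ => rfl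
    ext n; simp only [Finset.mem_filter, Finset.mem_Ico, Finset.mem_Ioc]; omega
  rw [hsum]
  refine norm_sum_Ioc_le_of_dyadic g (fun Q hQ => ?_) (d - 1) (by omega)
  have hblock : ∑ n ∈ Finset.Ioc (Q / 2) Q, g n =
      ∑ n ∈ Finset.Ico (max c (Q / 2 + 1)) (Q + 1), e (j * φ n) := by
    simp only [hg]
    rw [← Finset.sum_filter]
    refine Finset.sum_congr ?_ fun _ _ => rfl
    ext n; simp only [Finset.mem_filter, Finset.mem_Ico, Finset.mem_Ioc]; omega
  rw [hblock]
  rcases lt_or_ge Q c with hQc | hQc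
  · rw [Finset.Ico_eq_empty (by omega)]; simp; positivity
  have hP : X ≤ ((max c (Q / 2) : ℕ) : ℝ) := hc.trans (by exact_mod_cast le_max_left _ _)
  have hPN : max c (Q / 2) ≤ N := by omega
  have := hφ.norm_sum_dilate_le (P := max c (Q / 2)) (k := 1) (m := j)
    (a := max c (Q / 2 + 1)) (b := Q + 1) hP le_rfl hj (fun l h1 h2 => by omega)
    (Y := 9 * N) (by gcongr) 0
  simpa using this


/-! ### Regular variation of the inverse function and of the weight -/

section Growth

/-- If `u D'(u) / D(u) → ρ` then `D` grows like `u ^ ρ` up to `u ^ ε`. -/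
lemma eventually_rpow_bounds {D D' : ℝ → ℝ} {ρ : ℝ}
    (hD : ∀ᶠ u in atTop, HasDerivAt D (D' u) u) (hpos : ∀ᶠ u in atTop, 0 < D u)
    (hlim : Tendsto (fun u => u * D' u / D u) atTop (𝓝 ρ)) {ε : ℝ} (hε : 0 < ε) :
    ∀ᶠ u in atTop, u ^ (ρ - ε) ≤ D u ∧ D u ≤ u ^ (ρ + ε) := by
  have h1 := hlim.eventually (Ioo_mem_nhds (show ρ - ε / 2 < ρ by linarith)
    (show ρ < ρ + ε / 2 by linarith))
  obtain ⟨X, hX⟩ := eventually_atTop.1 (((hD.and hpos).and h1).and (eventually_ge_atTop 1))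
  have hX1 : 1 ≤ X := (hX X le_rfl).2
  have hder : ∀ s : ℝ, ∀ u, X ≤ u → HasDerivAt (fun u => Real.log (D u) - s * Real.log u)
      (D' u / D u - s * u⁻¹) u := fun s u hu => by
    have h := hX u hu
    exact (h.1.1.1.log h.1.1.2.ne').sub ((Real.hasDerivAt_log (by linarith)).const_mul s)
  -- The derivative of log D(u) - s log u is (u D' / D - s) / u, of constant sign for s = ρ ∓ ε/2;
  -- the other ε/2 absorbs the value at X.
  have hmono : MonotoneOn (fun u => Real.log (D u) - (ρ - ε / 2) * Real.log u) (Set.Ici X) := by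
    apply monotoneOn_of_deriv_nonneg (convex_Ici X)
    · exact fun u hu => (hder _ u hu).continuousAt.continuousWithinAt
    · intro u hu
      rw [interior_Ici] at hu
      exact (hder _ u (le_of_lt hu)).differentiableAt.differentiableWithinAt
    · intro u hu
      rw [interior_Ici] at hu
      rw [(hder _ u (le_of_lt hu)).deriv]
      have h := hX u (le_of_lt hu)
      have hu0 : 0 < u := by linarith [h.2]
      have h2 : D' u / D u = u * D' u / D u * u⁻¹ := by field_simp
      rw [h2, ← sub_mul]
      exact mul_nonneg (by linarith [h.1.2.1]) (by positivity)
  have hanti : AntitoneOn (fun u => Real.log (D u) - (ρ + ε / 2) * Real.log u) (Set.Ici X) := by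
    apply antitoneOn_of_deriv_nonpos (convex_Ici X)
    · exact fun u hu => (hder _ u hu).continuousAt.continuousWithinAt
    · intro u hu
      rw [interior_Ici] at hu
      exact (hder _ u (le_of_lt hu)).differentiableAt.differentiableWithinAt
    · intro u hu
      rw [interior_Ici] at hu
      rw [(hder _ u (le_of_lt hu)).deriv]
      have h := hX u (le_of_lt hu)
      have hu0 : 0 < u := by linarith [h.2]
      have h2 : D' u / D u = u * D' u / D u * u⁻¹ := by field_simp
      rw [h2, ← sub_mul]
      exact mul_nonpos_of_nonpos_of_nonneg (by linarith [h.1.2.2]) (by positivity)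
  have hlog := Real.tendsto_log_atTop.const_mul_atTop (half_pos hε)
  filter_upwards [eventually_ge_atTop X,
    hlog.eventually_ge_atTop (-(Real.log (D X) - (ρ - ε / 2) * Real.log X)),
    hlog.eventually_ge_atTop (Real.log (D X) - (ρ + ε / 2) * Real.log X)] with u hu hl1 hl2
  have h := hX u hu
  have hu0 : 0 < u := by linarith [h.2]
  have h3 := hmono (Set.mem_Ici.2 le_rfl) (Set.mem_Ici.2 hu) hu
  have h4 := hanti (Set.mem_Ici.2 le_rfl) (Set.mem_Ici.2 hu) hu
  simp only at h3 h4
  constructor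
  · rw [← Real.log_le_log_iff (by positivity) h.1.1.2, Real.log_rpow hu0]
    linarith
  · rw [← Real.log_le_log_iff h.1.1.2 (by positivity), Real.log_rpow hu0]
    linarith

end Growth

section Regular

/-- The derivative data of `h` in the class `𝓡_c` near infinity. -/
lemma RegClass.exists_derivs {x₀ c : ℝ} (hx₀ : 1 ≤ x₀) (hc : 1 ≤ c) {h : ℝ → ℝ}
    (hh : h ∈ RegClass x₀ c) :
    ∃ θ θ₁ θ₂ : ℝ → ℝ,
      (∀ y, x₀ < y → HasDerivAt h (h y * θ y / y) y) ∧
      (∀ y, x₀ < y → HasDerivAt θ (θ₁ y) y) ∧ (∀ y, x₀ < y → HasDerivAt θ₁ (θ₂ y) y) ∧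
      (∀ y, x₀ ≤ y → y ≤ h y) ∧
      Tendsto θ atTop (𝓝 c) ∧ Tendsto (fun y => y * θ₁ y) atTop (𝓝 0) ∧
      ((∀ᶠ y in atTop, 0 < θ y - 1 + y * θ₁ y / θ y) ∧
        Tendsto (fun y => y * θ₁ y / (θ y - 1 + y * θ₁ y / θ y)) atTop (𝓝 0) ∧
        Tendsto (fun y => y ^ 2 * θ₂ y / (θ y - 1 + y * θ₁ y / θ y)) atTop (𝓝 0)) := by
  obtain ⟨-, -, ℓ, hℓ, hform⟩ := hh
  have main : ∀ ϑ : ℝ → ℝ, ContDiffOn ℝ 2 ϑ (Set.Ici x₀) → IsExpIntegral x₀ ϑ ℓ →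
      (∀ y, x₀ < y → HasDerivAt h (h y * (c + ϑ y) / y) y) ∧
      (∀ y, x₀ < y → HasDerivAt (fun y => c + ϑ y) (deriv ϑ y) y) ∧
      (∀ y, x₀ < y → HasDerivAt (deriv ϑ) (iteratedDeriv 2 ϑ y) y) := by
    intro ϑ hϑ hexp
    have hcd : ∀ y, x₀ < y → ContDiffAt ℝ 2 ϑ y := fun y hy => hϑ.contDiffAt (Ici_mem_nhds hy)
    have hd1 : ∀ y, x₀ < y → HasDerivAt ϑ (deriv ϑ y) y := fun y hy =>
      ((hcd y hy).differentiableAt (by norm_num)).hasDerivAt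
    refine ⟨fun y hy => ?_, fun y hy => (hd1 y hy).const_add c, fun y hy => ?_⟩
    · have hy0 : 0 < y := by linarith
      have hcont : ContinuousOn (fun t => ϑ t / t) (Set.Ici x₀) :=
        hϑ.continuousOn.div continuousOn_id (fun t ht => by
          have : x₀ ≤ t := ht
          show t ≠ 0
          linarith)
      have hint : IntervalIntegrable (fun t => ϑ t / t) MeasureTheory.volume x₀ y := by
        apply ContinuousOn.intervalIntegrable
        rw [Set.uIcc_of_le hy.le]
        exact hcont.mono fun t ht => ht.1
      have hI : HasDerivAt (fun x => ∫ t in x₀..x, ϑ t / t) (ϑ y / y) y := by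
        apply intervalIntegral.integral_hasDerivAt_right hint
        · exact hcont.stronglyMeasurableAtFilter_nhdsWithin measurableSet_Ici y |>.filter_mono
            (by rw [nhdsWithin_eq_nhds.2 (Ici_mem_nhds hy)])
        · exact hcont.continuousAt (Ici_mem_nhds hy)
      have h1 := (Real.hasDerivAt_rpow_const (p := c) (Or.inl hy0.ne')).mul hI.exp
      have heq : h =ᶠ[𝓝 y] fun x => x ^ c * Real.exp (∫ t in x₀..x, ϑ t / t) := by
        filter_upwards [Ici_mem_nhds hy] with x hx
        rw [hform x hx, hexp x hx]
      refine (h1.congr_of_eventuallyEq heq).congr_deriv ?_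
      rw [heq.eq_of_nhds]
      have : y ^ c = y ^ (c - 1) * y := by rw [← Real.rpow_add_one hy0.ne']; ring_nf
      rw [this]
      field_simp
    · have h2 := hcd y hy
      have h3 : DifferentiableAt ℝ (deriv ϑ) y := by
        exact (ContDiffAt.derivWithin (m := 1) h2 (by norm_num)).differentiableAt (by norm_num)
      have : iteratedDeriv 2 ϑ y = deriv (deriv ϑ) y := by
        rw [show (2 : ℕ) = 1 + 1 from rfl, iteratedDeriv_succ, iteratedDeriv_one]
      rw [this]
      exact h3.hasDerivAt
  have hge : (∀ x, x₀ ≤ x → 1 ≤ ℓ x) → ∀ y, x₀ ≤ y → y ≤ h y := by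
    intro hℓ1 y hy
    have hy1 : 1 ≤ y := hx₀.trans hy
    rw [hform y hy]
    calc y = y ^ (1 : ℝ) * 1 := by rw [Real.rpow_one, mul_one]
      _ ≤ y ^ c * ℓ y := by
        gcongr
        exact hℓ1 y hy
  rcases hℓ with ⟨hc1, hℓ1, ϑ, hϑ, hexp, t0, t1, t2⟩ | ⟨hc1, ⟨hℓ1, ⟨ϑ, hϑ, hexp, hpos, -, t0, t1, t2, -⟩, -⟩⟩
  · obtain ⟨m1, m2, m3⟩ := main ϑ hϑ hexp
    have tθ : Tendsto (fun y => c + ϑ y) atTop (𝓝 c) := by simpa using t0.const_add c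
    -- This quantity is y h''(y) / h'(y). For c > 1 its limit c - 1 is positive, so dividing by it
    -- is harmless.
    have tA : Tendsto (fun y => c + ϑ y - 1 + y * deriv ϑ y / (c + ϑ y)) atTop (𝓝 (c - 1)) := by
      have := (tθ.sub_const 1).add (t1.div tθ (by linarith))
      simpa using this
    have hc0 : c - 1 ≠ 0 := by linarith
    refine ⟨fun y => c + ϑ y, deriv ϑ, iteratedDeriv 2 ϑ, m1, m2, m3, hge hℓ1, tθ, t1, ?_, ?_, ?_⟩
    · exact tA.eventually (lt_mem_nhds (by linarith))
    · have := t1.div tA hc0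
      rwa [zero_div] at this
    · have := t2.div tA hc0
      rwa [zero_div] at this
  · subst hc1
    obtain ⟨m1, m2, m3⟩ := main ϑ hϑ hexp
    have tθ : Tendsto (fun y => 1 + ϑ y) atTop (𝓝 1) := by simpa using t0.const_add 1
    have hϑpos : ∀ᶠ y in atTop, 0 < ϑ y := by
      filter_upwards [eventually_ge_atTop x₀] with y hy using hpos y hy
    have tq : Tendsto (fun y => 1 + y * deriv ϑ y / ϑ y / (1 + ϑ y)) atTop (𝓝 1) := by
      have := (t1.div tθ one_ne_zero).const_add 1
      simpa using this
    -- For c = 1 the same quantity tends to 0, but it is ϑ times a factor tending to 1; this is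
    -- where the limits relative to ϑ in `SlowClassZero` are needed.
    have hfac : ∀ᶠ y in atTop, 1 + ϑ y - 1 + y * deriv ϑ y / (1 + ϑ y) =
        ϑ y * (1 + y * deriv ϑ y / ϑ y / (1 + ϑ y)) := by
      filter_upwards [hϑpos] with y hy
      have : 1 + ϑ y ≠ 0 := by linarith
      field_simp
      ring
    have t1' : Tendsto (fun y => y * deriv ϑ y) atTop (𝓝 0) := by
      have := t1.mul t0
      rw [mul_zero] at this
      refine this.congr' ?_
      filter_upwards [hϑpos] with y hy
      field_simp
    refine ⟨fun y => 1 + ϑ y, deriv ϑ, iteratedDeriv 2 ϑ, m1, m2, m3, hge hℓ1, tθ, t1', ?_, ?_, ?_⟩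
    · filter_upwards [hfac, hϑpos, tq.eventually (lt_mem_nhds zero_lt_one)] with y h1 h2 h3
      rw [h1]; positivity
    · have := t1.div tq one_ne_zero
      rw [zero_div] at this
      refine this.congr' ?_
      filter_upwards [hfac] with y h1
      rw [h1, ← div_div]; rfl
    · have := t2.div tq one_ne_zero
      rw [zero_div] at this
      refine this.congr' ?_
      filter_upwards [hfac] with y h1
      rw [h1, ← div_div]; rfl

end Regular

section Inverse

lemma eventually_atTop_eventually_nhds {p : ℝ → Prop} (h : ∀ᶠ u in atTop, p u) :
    ∀ᶠ u in atTop, ∀ᶠ v in 𝓝 u, p v := by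
  obtain ⟨X, hX⟩ := eventually_atTop.1 h
  filter_upwards [eventually_gt_atTop X] with u hu
  filter_upwards [Ici_mem_nhds hu] with v hv using hX v hv

/-- As y ≤ h y, the intermediate value theorem puts [h y, ∞) into the range of h. Continuity of the
inverse then comes from monotonicity and from its image being a neighbourhood. -/
lemma inverseOf_spec {x₀ : ℝ} {h : ℝ → ℝ} (hmono : StrictMonoOn h (Set.Ici x₀))
    (hcont : ContinuousOn h (Set.Ioi x₀)) (hge : ∀ y, x₀ ≤ y → y ≤ h y) :
    Tendsto (inverseOf x₀ h) atTop atTop ∧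
      ∀ᶠ u in atTop, h (inverseOf x₀ h u) = u ∧ ContinuousAt (inverseOf x₀ h) u := by
  set φ := inverseOf x₀ h with hφ
  have hex : ∀ y, x₀ < y → ∀ u, h y ≤ u → ∃ z, y ≤ z ∧ h z = u := by
    intro y hy u hu
    have hyu : y ≤ u := (hge y hy.le).trans hu
    have hsub : Set.Icc y u ⊆ Set.Ioi x₀ := fun t ht => hy.trans_le ht.1
    obtain ⟨z, hz, hzu⟩ := intermediate_value_Icc hyu (hcont.mono hsub)
      (show u ∈ Set.Icc (h y) (h u) from ⟨hu, hge u (hy.le.trans hyu)⟩)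
    exact ⟨z, hz.1, hzu⟩
  have hspec : ∀ y, x₀ < y → ∀ u, h y ≤ u → y ≤ φ u ∧ h (φ u) = u := by
    intro y hy u hu
    obtain ⟨z, hz, hzu⟩ := hex y hy u hu
    have hmem : ∃ a ∈ Set.Ici x₀, h a = u := ⟨z, hy.le.trans hz, hzu⟩
    have h1 : φ u ∈ Set.Ici x₀ := Function.invFunOn_mem hmem
    have h2 : h (φ u) = u := Function.invFunOn_eq hmem
    refine ⟨?_, h2⟩
    have h3 : φ u = z := hmono.injOn h1 (hy.le.trans hz) (h2.trans hzu.symm)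
    rw [h3]; exact hz
  have hleft : ∀ y, x₀ ≤ y → φ (h y) = y := by
    intro y hy
    have hmem : ∃ a ∈ Set.Ici x₀, h a = h y := ⟨y, hy, rfl⟩
    exact hmono.injOn (Function.invFunOn_mem hmem) hy (Function.invFunOn_eq hmem)
  -- Continuity of h is assumed on the open half-line only, hence the base point x₀ + 1.
  have hlt : x₀ < x₀ + 1 := by linarith
  constructor
  · refine tendsto_atTop.2 fun b => ?_
    filter_upwards [eventually_ge_atTop (h (max b (x₀ + 1)))] with u hu
    exact (le_max_left _ _).trans (hspec _ (hlt.trans_le (le_max_right _ _)) u hu).1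
  · filter_upwards [eventually_gt_atTop (h (x₀ + 1))] with u hu
    refine ⟨(hspec _ hlt u hu.le).2, ?_⟩
    have hm : StrictMonoOn φ (Set.Ici (h (x₀ + 1))) := by
      intro a ha b hb hab
      have h1 := hspec _ hlt a ha
      have h2 := hspec _ hlt b hb
      refine (hmono.lt_iff_lt (hlt.le.trans h1.1) (hlt.le.trans h2.1)).1 ?_
      rw [h1.2, h2.2]; exact hab
    refine hm.continuousAt_of_image_mem_nhds (Ici_mem_nhds hu) ?_
    have h3 : x₀ + 1 < φ u := by
      have h4 := hm (Set.mem_Ici.2 le_rfl) hu.le hu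
      rwa [hleft _ hlt.le] at h4
    refine mem_of_superset (Ici_mem_nhds h3) fun y hy => ?_
    exact ⟨h y, hmono.monotoneOn hlt.le (hlt.le.trans hy) hy, hleft y (hlt.le.trans hy)⟩

/-- The inverse of a function in `𝓡_c` is regularly varying with its first two derivatives. -/
lemma RegClass.exists_inverse_derivs {x₀ c : ℝ} (hx₀ : 1 ≤ x₀) (hc : 1 ≤ c) {h : ℝ → ℝ}
    (hh : h ∈ RegClass x₀ c) :
    ∃ D₁ D₂ D₃ : ℝ → ℝ,
      (∀ᶠ u in atTop, HasDerivAt (inverseOf x₀ h) (D₁ u) u) ∧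
      (∀ᶠ u in atTop, HasDerivAt D₁ (D₂ u) u) ∧ (∀ᶠ u in atTop, HasDerivAt D₂ (D₃ u) u) ∧
      (∀ᶠ u in atTop, 0 < D₁ u) ∧ (∀ᶠ u in atTop, D₂ u < 0) ∧
      Tendsto (fun u => u * D₂ u / D₁ u) atTop (𝓝 (1 / c - 1)) ∧
      Tendsto (fun u => u * D₃ u / D₂ u) atTop (𝓝 (1 / c - 2)) := by
  obtain ⟨θ, θ₁, θ₂, e0, e1, e2, hge, tθ, t1, Apos, tA1, tA2⟩ := RegClass.exists_derivs hx₀ hc hh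
  have hcont : ContinuousOn h (Set.Ioi x₀) := fun y hy =>
    (e0 y hy).continuousAt.continuousWithinAt
  obtain ⟨tφ, hφ⟩ := inverseOf_spec hh.1 hcont hge
  set φ := inverseOf x₀ h
  have hc0 : c ≠ 0 := by linarith
  -- A y = y h''(y) / h'(y). Differentiating h(φ(u)) = u gives φ' = φ / (u θ(φ)) and u φ'' / φ' =
  -- -A(φ) / θ(φ). For c = 1 this tends to 0, so the sign of φ'' comes from A > 0 and its growth
  -- from y A' / A → 0.
  set A : ℝ → ℝ := fun y => θ y - 1 + y * θ₁ y / θ y with hA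
  set A' : ℝ → ℝ := fun y =>
    θ₁ y + ((1 * θ₁ y + y * θ₂ y) * θ y - y * θ₁ y * θ₁ y) / θ y ^ 2 with hA'
  have tA : Tendsto A atTop (𝓝 (c - 1)) := by
    have := (tθ.sub_const 1).add (t1.div tθ hc0)
    simpa using this
  have θpos : ∀ᶠ y in atTop, 0 < θ y := tθ.eventually (lt_mem_nhds (by linarith))
  have eA : ∀ᶠ y in atTop, HasDerivAt A (A' y) y := by
    filter_upwards [θpos, eventually_gt_atTop x₀] with y hy hy1
    exact ((e1 y hy1).sub_const 1).add
      (((hasDerivAt_id y).mul (e2 y hy1)).div (e1 y hy1) hy.ne')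
  have tB : Tendsto (fun y => y * A' y / A y) atTop (𝓝 0) := by
    have := ((tA1.add (tA1.div tθ hc0)).add (tA2.div tθ hc0)).sub
      ((t1.mul tA1).div (tθ.pow 2) (pow_ne_zero 2 hc0))
    simp only [zero_div, mul_zero, add_zero, sub_zero] at this
    refine this.congr' ?_
    filter_upwards [θpos, Apos] with y hy hy2
    have hy3 : A y ≠ 0 := hy2.ne'
    change y * θ₁ y / A y + y * θ₁ y / A y / θ y + y ^ 2 * θ₂ y / A y / θ y -
      y * θ₁ y * (y * θ₁ y / A y) / θ y ^ 2 = _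
    simp only [hA']
    field_simp
    ring
  have ev : ∀ᶠ u in atTop, 0 < u ∧ 0 < φ u ∧ 0 < θ (φ u) ∧ 0 < A (φ u) ∧
      HasDerivAt φ (φ u / (u * θ (φ u))) u ∧
      HasDerivAt (fun u => θ (φ u)) (θ₁ (φ u) * (φ u / (u * θ (φ u)))) u ∧
      HasDerivAt (fun u => A (φ u)) (A' (φ u) * (φ u / (u * θ (φ u)))) u := by
    filter_upwards [eventually_gt_atTop 0, tφ.eventually_gt_atTop 0, tφ.eventually θpos,
      tφ.eventually Apos, tφ.eventually_gt_atTop x₀, eventually_atTop_eventually_nhds hφ,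
      tφ.eventually eA, hφ] with u h1 h2 h3 h4 h5 h6 h7 h8
    have hd : HasDerivAt φ (φ u / (u * θ (φ u))) u := by
      have := HasDerivAt.of_local_left_inverse h8.2 (e0 _ h5)
        (by rw [h8.1]; positivity) (h6.mono fun v hv => hv.1)
      refine this.congr_deriv ?_
      rw [h8.1, inv_div]
    exact ⟨h1, h2, h3, h4, hd, (e1 _ h5).comp u hd, h7.comp u hd⟩
  have sT := tθ.comp tφ
  have sA := tA.comp tφ
  have sB := tB.comp tφ
  have s1 := t1.comp tφ
  have tR : Tendsto (fun u => -(A (φ u) / θ (φ u))) atTop (𝓝 (1 / c - 1)) := by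
    have := (sA.div sT hc0).neg
    have h2 : -((c - 1) / c) = 1 / c - 1 := by field_simp; ring
    rw [h2] at this
    exact this
  -- The third function is D₂ / u times a bracket, so that u D₃ / D₂ is the bracket, with limit 1 /
  -- c - 2.
  refine ⟨fun u => φ u / (u * θ (φ u)), fun u => -(φ u * A (φ u)) / (u * θ (φ u)) ^ 2,
    fun u => -(φ u * A (φ u)) / (u * θ (φ u)) ^ 2 / u * (1 / θ (φ u)
      + φ u * A' (φ u) / A (φ u) / θ (φ u) - 2 - 2 * (φ u * θ₁ (φ u)) / θ (φ u) ^ 2),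
    ?_, ?_, ?_, ?_, ?_, ?_, ?_⟩
  · filter_upwards [ev] with u hu using hu.2.2.2.2.1
  · filter_upwards [ev] with u ⟨h1, h2, h3, h4, d1, d2, d3⟩
    have h5 : u * θ (φ u) ≠ 0 := by positivity
    refine (d1.div ((hasDerivAt_id u).mul d2) h5).congr_deriv ?_
    simp only [hA, id, Pi.mul_apply]
    field_simp
    ring
  · filter_upwards [ev] with u ⟨h1, h2, h3, h4, d1, d2, d3⟩
    have h5 : (u * θ (φ u)) ^ 2 ≠ 0 := by positivity
    refine ((d1.mul d3).neg.div (((hasDerivAt_id u).mul d2).pow 2) h5).congr_deriv ?_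
    simp only [id, Pi.mul_apply, Pi.pow_apply, Pi.neg_apply]
    have := h4.ne'
    field_simp
    ring
  · filter_upwards [ev] with u ⟨h1, h2, h3, h4, d1, d2, d3⟩
    positivity
  · filter_upwards [ev] with u ⟨h1, h2, h3, h4, d1, d2, d3⟩
    rw [neg_div]
    exact neg_neg_of_pos (by positivity)
  · refine tR.congr' ?_
    filter_upwards [ev] with u ⟨h1, h2, h3, h4, d1, d2, d3⟩
    field_simp
  · have hlim := ((((tendsto_const_nhds (x := (1 : ℝ))).div sT hc0).add (sB.div sT hc0)).sub_const
      2).sub ((s1.const_mul 2).div (sT.pow 2) (pow_ne_zero 2 hc0))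
    simp only [zero_div, mul_zero, add_zero, sub_zero] at hlim
    refine hlim.congr' ?_
    filter_upwards [ev] with u ⟨h1, h2, h3, h4, d1, d2, d3⟩
    have := h4.ne'
    have h6 : -(φ u * A (φ u)) / (u * θ (φ u)) ^ 2 ≠ 0 := by
      rw [neg_div]
      exact (neg_neg_of_pos (by positivity)).ne
    simp only [Function.comp, Pi.div_apply]
    field_simp

/-- The inverse of a function in `𝓡_c` satisfies the hypotheses of the exponential sum
estimates. -/
lemma RegClass.exists_isPhase {x₀ c : ℝ} (hx₀ : 1 ≤ x₀) (hc : 1 ≤ c) {h : ℝ → ℝ}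
    (hh : h ∈ RegClass x₀ c) {η : ℝ} (hη : 0 < η) (hη1 : η ≤ 1) :
    ∃ φ₁ φ₂ φ₃ : ℝ → ℝ, ∃ X : ℝ, IsPhase (inverseOf x₀ h) φ₁ φ₂ φ₃ X (1 - 1 / c) η := by
  obtain ⟨D₁, D₂, D₃, d1, d2, d3, -, p2, -, t3⟩ := RegClass.exists_inverse_derivs hx₀ hc hh
  have hc1 : 1 / c ≤ 1 := by rw [div_le_one (by linarith)]; exact hc
  have hcpos : 0 < 1 / c := by positivity
  have hb := eventually_rpow_bounds (D := fun u => -D₂ u) (D' := fun u => -D₃ u)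
    (ρ := 1 / c - 2) (d3.mono fun u hu => hu.neg) (p2.mono fun u hu => by linarith)
    (t3.congr fun u => by rw [mul_neg, neg_div_neg_eq]) (half_pos hη)
  -- The derivative of u² φ'' is u φ'' times this factor, whose limit 1 / c is positive for c = 1
  -- too.
  have tG : Tendsto (fun u => 2 + u * D₃ u / D₂ u) atTop (𝓝 (1 / c)) := by
    have := t3.const_add 2
    simpa using this
  have g1 := tG.eventually (lt_mem_nhds (show 1 / c / 2 < 1 / c by linarith))
  have g2 := tG.eventually (gt_mem_nhds (show 1 / c < 2 by linarith))
  have hr := tendsto_rpow_atTop (half_pos hη)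
  obtain ⟨X, hX⟩ := eventually_atTop.1 (((((((d1.and d2).and d3).and p2).and hb).and
    (g1.and g2)).and ((hr.eventually_ge_atTop 2).and (hr.eventually_ge_atTop (2 * c)))).and
      (eventually_ge_atTop 1))
  have hX1 : 1 ≤ X := (hX X le_rfl).2
  refine ⟨D₁, D₂, D₃, X, ⟨hX1, by linarith, hη, hη1, fun u hu => (hX u hu).1.1.1.1.1.1.1,
    fun u hu => (hX u hu).1.1.1.1.1.1.2, fun u hu => (hX u hu).1.1.1.1.1.2, fun u hu => ?_,
    fun u hu => ?_, fun u hu => ?_, fun u hu => ?_⟩⟩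
  all_goals
    have hu1 : 1 ≤ u := hX1.trans hu
    have hu0 : 0 < u := by linarith
    obtain ⟨⟨⟨⟨-, hp⟩, hlo, hup⟩, hg1, hg2⟩, hr1, hr2⟩ := (hX u hu).1
  · exact (Real.rpow_le_rpow_of_exponent_le hu1 (by linarith)).trans hlo
  · exact hup.trans (Real.rpow_le_rpow_of_exponent_le hu1 (by linarith))
  · have hfac : -(2 * u * D₂ u + u ^ 2 * D₃ u) = u * -D₂ u * (2 + u * D₃ u / D₂ u) := by
      have := hp.ne
      field_simp
    rw [hfac]
    calc u ^ (-(1 - 1 / c) - η) = u ^ (1 : ℝ) * u ^ (1 / c - 2 - η / 2) * u ^ (-(η / 2)) := by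
          rw [← Real.rpow_add hu0, ← Real.rpow_add hu0]; ring_nf
      _ ≤ u * -D₂ u * (1 / c / 2) := by
          rw [Real.rpow_one]
          have h5 : u ^ (-(η / 2)) ≤ 1 / c / 2 := by
            rw [Real.rpow_neg hu0.le]
            calc (u ^ (η / 2))⁻¹ ≤ (2 * c)⁻¹ := inv_anti₀ (by linarith) hr2
              _ = 1 / c / 2 := by field_simp
          have h6 : 0 ≤ u ^ (1 / c - 2 - η / 2) := by positivity
          gcongr
          exact mul_nonneg hu0.le (by linarith)
      _ ≤ _ := by
          have : 0 ≤ u * -D₂ u := mul_nonneg hu0.le (by linarith)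
          gcongr
  · have hfac : -(2 * u * D₂ u + u ^ 2 * D₃ u) = u * -D₂ u * (2 + u * D₃ u / D₂ u) := by
      have := hp.ne
      field_simp
    rw [hfac]
    calc u * -D₂ u * (2 + u * D₃ u / D₂ u) ≤ u * -D₂ u * u ^ (η / 2) := by
          have : 0 ≤ u * -D₂ u := mul_nonneg hu0.le (by linarith)
          gcongr
          linarith
      _ ≤ u ^ (1 : ℝ) * u ^ (1 / c - 2 + η / 2) * u ^ (η / 2) := by
          rw [Real.rpow_one]
          gcongr
      _ = u ^ (1 / c - 1 + η) := by
          rw [← Real.rpow_add hu0, ← Real.rpow_add hu0]; ring_nf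
      _ ≤ u ^ η := Real.rpow_le_rpow_of_exponent_le hu1 (by linarith)

/-- An admissible weight is eventually decreasing and not too small. -/
lemma AdmissibleWeight.eventually_bounds {x₀ c : ℝ} (hx₀ : 1 ≤ x₀) (hc : 1 ≤ c) {h ψ : ℝ → ℝ}
    (hh : h ∈ RegClass x₀ c) (hψ : AdmissibleWeight (inverseOf x₀ h) ψ) {ε : ℝ} (hε : 0 < ε) :
    ∃ X : ℝ, 1 ≤ X ∧ AntitoneOn ψ (Set.Ici X) ∧
      ∀ u, X ≤ u → u ^ (-(1 - 1 / c) - ε) ≤ ψ u := by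
  obtain ⟨D₁, D₂, D₃, d1, d2, -, p1, p2, t2, -⟩ := RegClass.exists_inverse_derivs hx₀ hc hh
  obtain ⟨hψ0, hψ1, q1, q2, -⟩ := hψ
  set φ := inverseOf x₀ h
  have hb := eventually_rpow_bounds d2 p1 t2 (half_pos hε)
  have e1 : ∀ᶠ u in atTop, deriv φ u = D₁ u := d1.mono fun u hu => hu.deriv
  have e2 : ∀ᶠ u in atTop, iteratedDeriv 2 φ u = D₂ u := by
    have hev : ∀ᶠ u in atTop, ∀ᶠ v in 𝓝 u, deriv φ v = D₁ v := eventually_atTop_eventually_nhds e1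
    filter_upwards [hev, d2] with u hu hu2
    rw [show (2 : ℕ) = 1 + 1 from rfl, iteratedDeriv_succ, iteratedDeriv_one]
    rw [EventuallyEq.deriv_eq (f := D₁) hu]
    exact hu2.deriv
  have r1 : ∀ᶠ u in atTop, 1 / 2 < ψ u / deriv φ u :=
    q1.eventually (lt_mem_nhds (by norm_num))
  have r2 : ∀ᶠ u in atTop, 0 < deriv ψ u / iteratedDeriv 2 φ u :=
    q2.eventually (lt_mem_nhds (by norm_num))
  have hr := tendsto_rpow_atTop (half_pos hε)
  obtain ⟨X, hX⟩ := eventually_atTop.1 ((((((hb.and e1).and e2).and (p1.and p2)).and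
    (r1.and r2)).and (hr.eventually_ge_atTop 2)).and (eventually_gt_atTop 1))
  have hX1 : 1 < X := (hX X le_rfl).2
  have hdiff : ∀ u, X ≤ u → DifferentiableAt ℝ ψ u := fun u hu =>
    (hψ1.contDiffAt (Ici_mem_nhds (hX1.trans_le hu))).differentiableAt (by norm_num)
  refine ⟨X, hX1.le, ?_, fun u hu => ?_⟩
  · apply antitoneOn_of_deriv_nonpos (convex_Ici X)
    · exact fun u hu => (hdiff u hu).continuousAt.continuousWithinAt
    · intro u hu
      rw [interior_Ici] at hu
      exact (hdiff u (le_of_lt hu)).differentiableWithinAt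
    · intro u hu
      rw [interior_Ici] at hu
      -- The quotient ψ' / φ'' is positive near infinity and φ'' < 0, so ψ' cannot be positive.
      obtain ⟨⟨⟨⟨⟨-, -⟩, h2⟩, -, h3⟩, -, h4⟩, -⟩ := (hX u (le_of_lt hu)).1
      rw [h2] at h4
      by_contra hcon
      push Not at hcon
      exact absurd h4 (not_lt.2 (div_nonpos_of_nonneg_of_nonpos hcon.le h3.le))
  · obtain ⟨⟨⟨⟨⟨⟨h1, -⟩, h2⟩, -⟩, hp, -⟩, h4, -⟩, hr1⟩ := (hX u hu).1
    have hu0 : 0 < u := by linarith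
    rw [h2, lt_div_iff₀ hp] at h4
    have h5 : u ^ (-(ε / 2)) ≤ 1 / 2 := by
      rw [Real.rpow_neg hu0.le, one_div]
      exact inv_anti₀ (by norm_num) hr1
    calc u ^ (-(1 - 1 / c) - ε) = u ^ (-(ε / 2)) * u ^ (1 / c - 1 - ε / 2) := by
          rw [← Real.rpow_add hu0]; ring_nf
      _ ≤ 1 / 2 * D₁ u := by gcongr
      _ ≤ ψ u := h4.le

end Inverse

/-! ### Choice of the parameters and conclusion -/

section Final

/-- The weighted sawtooth sum which measures the discrepancy of the primes in `B`. -/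
lemma IsPhase.exists_eventually_norm_saw_sum_le {φ φ₁ φ₂ φ₃ ψ : ℝ → ℝ} {X x y χ ε : ℝ}
    (hφ : IsPhase φ φ₁ φ₂ φ₃ X y ε) (hε : ε ≤ 1 / 10000) (hx : 0 ≤ x) (hχ : 0 < χ)
    (hcond : 16 * y + 17 * x + 31 * χ ≤ 1) {c : ℕ} (hc : X ≤ c)
    (hψ : ∀ u : ℝ, c ≤ u → 0 < ψ u ∧ ψ u ≤ 1 / 2) (hanti : AntitoneOn ψ (Set.Ici (c : ℝ)))
    (hlow : ∀ u : ℝ, c ≤ u → u ^ (-x - ε) ≤ ψ u) :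
    ∃ C : ℝ, ∀ᶠ N : ℕ in atTop, ∀ a q : ℤ, 1 ≤ q → ∀ ξ : ℝ,
      ‖∑ n ∈ Finset.Ico c (N + 1), (((primeWeight a q n : ℝ) : ℂ) * e (ξ * n)) *
        (((ψ n)⁻¹ : ℝ) : ℂ) * ((saw (φ n - ψ n) - saw (φ n) : ℝ) : ℂ)‖ ≤
        C * (N : ℝ) ^ (1 - χ - ε) := by
  have hε0 := hφ.η_pos
  have hy := hφ.y_nonneg
  have hX := hφ.one_le
  have hc1 : 1 ≤ c := by exact_mod_cast hX.trans hc
  -- With M ≈ N ^ α and K ≈ N ^ (2 α), the smoothing errors are N ^ (1 + x - α) and the Fourier part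
  -- is N ^ (1 + α - β), both up to N ^ (2 ε). These choices make each N ^ (1 - χ - 2 ε).
  set α := x + χ + 4 * ε with hα
  set β := x + 2 * χ + 8 * ε with hβ
  set p := (1 + y + 3 * ε) / 2 with hp
  -- The summands come from `t1` (Fourier part), `t3` (smoothing and length terms) and `t4`
  -- (exponential sums in the count).
  refine ⟨128 * Real.pi + 73 + 24 * 2 * 132 * 2 * 9, ?_⟩
  -- θ = 2 β + 10 ε meets the diagonal condition. The off-diagonal one becomes 16 x + 28 χ + 2 y +
  -- 172 ε < 1; by `hcond` the first three terms are at most 16/17, and ε ≤ 1/10000 fits into the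
  -- rest.
  filter_upwards [hφ.eventually_norm_sum_vonMangoldt_le (α := α) (β := β)
      (θ := 2 * β + 10 * ε) (by linarith) (by linarith) (by linarith) (by linarith) (by linarith),
    eventually_log_succ_le_rpow hε0, eventually_log_succ_le_rpow (half_pos hε0),
    eventually_mul_rpow_le 3 (half_lt_self hε0),
    eventually_const_le_rpow 1 (half_pos hε0), eventually_natLog_le_rpow hε0,
    eventually_mul_rpow_le 2 (show 1 / 2 + ε < 1 - β by linarith),
    eventually_const_le_rpow 1 (show 0 < α by linarith),
    eventually_const_le_rpow 1 (show 0 < 2 * α by linarith), eventually_ge_atTop c]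
    with N hT hlogε hlogε2 h3 hone hnlog hsq hNα hN2α hcN a q hq ξ
  set r : ℝ := (N : ℝ) with hr
  have hN1 : (1 : ℝ) ≤ r := Nat.one_le_cast.2 (hc1.trans hcN)
  have hr0 : 0 < r := by linarith
  set M := ⌈r ^ α⌉₊ with hM
  set K := ⌊r ^ (2 * α)⌋₊ with hK
  have hM1 : r ^ α ≤ M := Nat.le_ceil _
  have hM2 : (M : ℝ) ≤ 2 * r ^ α := by
    have := Nat.ceil_lt_add_one (show 0 ≤ r ^ α by positivity)
    linarith
  have hK1 : r ^ (2 * α) / 2 ≤ K := le_floor_mul_two hN2α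
  have hK2 : (K : ℝ) ≤ r ^ (2 * α) := Nat.floor_le (by positivity)
  have hMpos : 1 ≤ M := by exact_mod_cast hNα.trans hM1
  have hKpos : 1 ≤ K := Nat.one_le_floor_iff _ |>.2 hN2α
  have hKr : (1 : ℝ) ≤ K := by exact_mod_cast hKpos
  have hlog0 : 0 ≤ Real.log (N + 1 : ℕ) := Real.log_natCast_nonneg _
  have hrlog : Real.log r ≤ Real.log (N + 1 : ℕ) := by
    apply Real.log_le_log hr0
    push_cast; linarith
  have hlogK : 1 + Real.log K ≤ r ^ ε := by
    have h1 : Real.log K ≤ 2 * α * Real.log r := by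
      rw [← Real.log_rpow hr0]
      exact Real.log_le_log (by linarith) hK2
    have h2 : 2 * α * Real.log r ≤ 1 * Real.log (N + 1 : ℕ) :=
      mul_le_mul (by linarith) hrlog (Real.log_nonneg hN1) zero_le_one
    linarith
  have hcd : (c : ℝ) ≤ (N + 1 : ℕ) := by exact_mod_cast hcN.trans (Nat.le_succ _)
  have hlogψ : 1 + 2 * -Real.log (ψ (N + 1 : ℕ)) ≤ r ^ ε := by
    have h0 : (0 : ℝ) < (N + 1 : ℕ) := by positivity
    have h1 := Real.log_le_log (by positivity) (hlow _ hcd)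
    rw [Real.log_rpow h0] at h1
    have h2 : (x + ε) * Real.log (N + 1 : ℕ) ≤ 1 * Real.log (N + 1 : ℕ) := by
      gcongr; linarith
    linarith
  have hsqrt : √r = r ^ (1 / 2 : ℝ) := Real.sqrt_eq_rpow r
  have hB : 2 * (r ^ (1 - β) + 2 * √r * Real.log r) ≤ 4 * r ^ (1 - β) := by
    have : √r * Real.log r ≤ r ^ (1 / 2 + ε) := by
      rw [Real.rpow_add hr0, hsqrt]
      gcongr
      linarith
    linarith
  have hE : ∀ j : ℕ, 1 ≤ j → j < M → ∀ b, c ≤ b → b ≤ N + 1 →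
      ‖∑ n ∈ Finset.Ico c b, e (j * φ n)‖ ≤ r ^ ε * (132 * (2 * r ^ (α / 2)) * (9 * r ^ p)) := by
    intro j hj hjM b hb hbN
    refine (hφ.norm_sum_Ico_e_le hj hc hb hbN).trans ?_
    rw [mul_assoc (132 : ℝ), mul_assoc (132 : ℝ)]
    gcongr
    · rw [Real.sqrt_le_left (by positivity)]
      have h1 : (j : ℝ) ≤ M := by exact_mod_cast hjM.le
      have h2 : (2 * r ^ (α / 2)) ^ 2 = 4 * r ^ α := by
        rw [mul_pow, ← Real.rpow_natCast (r ^ (α / 2)), ← Real.rpow_mul hr0.le, Nat.cast_ofNat,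
          div_mul_cancel₀ α two_ne_zero]
        norm_num
      rw [h2]
      have : 0 ≤ r ^ α := by positivity
      linarith
    · rw [Real.mul_rpow (by norm_num) hr0.le]
      gcongr
      calc (9 : ℝ) ^ p ≤ 9 ^ (1 : ℝ) :=
            Real.rpow_le_rpow_of_exponent_le (by norm_num) (by linarith)
        _ = 9 := Real.rpow_one _
  have main := norm_sum_saw_sub_le (ψ := fun n : ℕ => ψ n) (x := fun n : ℕ => φ n)
    (v := fun n : ℕ => ((primeWeight a q n : ℝ) : ℂ) * e (ξ * n)) (c := c) (d := N + 1)
    (A := r ^ ε) (B := 4 * r ^ (1 - β)) (Ψ := r ^ (x + ε))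
    (hcN.trans (Nat.le_succ _)) hKpos hMpos
    (fun n hn _ => (hψ n (by exact_mod_cast hn)).1) (fun n hn _ => (hψ n (by exact_mod_cast hn)).2)
    (fun n hn _ => hanti (Set.mem_Ici.2 (by exact_mod_cast hn))
      (Set.mem_Ici.2 (by exact_mod_cast hn.trans (Nat.le_succ n))) (by push_cast; linarith))
    (fun n hn hnN => by
      have hn1 : (1 : ℝ) ≤ n := by exact_mod_cast hc1.trans hn
      have hn0 : (0 : ℝ) < n := by linarith
      have h1 := hlow n (by exact_mod_cast hn)
      have hnr : (n : ℝ) ≤ r := Nat.cast_le.2 (Nat.lt_succ_iff.1 hnN)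
      calc (ψ n)⁻¹ ≤ ((n : ℝ) ^ (-x - ε))⁻¹ := inv_anti₀ (by positivity) h1
        _ = (n : ℝ) ^ (x + ε) := by rw [← Real.rpow_neg hn0.le]; ring_nf
        _ ≤ r ^ (x + ε) := Real.rpow_le_rpow hn0.le hnr (by linarith))
    (by positivity)
    (fun n hn hnN => by
      rw [norm_mul, norm_e, mul_one, Complex.norm_real, Real.norm_eq_abs]
      refine (abs_primeWeight_le a q n).trans (le_trans ?_ hlogε)
      have : 0 < n := hc1.trans hn
      exact Real.log_le_log (by exact_mod_cast this) (by exact_mod_cast hnN.le))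
    (by positivity)
    (fun m hm hmK b hb hbN => by
      have := norm_sum_Ico_primeWeight_le (fun ξ P hP => hT m hm
        ((Nat.cast_le.2 hmK).trans hK2) ξ P hP) a hq ξ hc1 hb hbN
      exact ⟨this.1.trans hB, this.2.trans hB⟩)
    hE (by positivity)
  refine main.trans ?_
  have hMr : (0 : ℝ) < M := by exact_mod_cast hMpos
  have t1 : 16 * Real.pi * M * (1 + 2 * -Real.log (ψ (N + 1 : ℕ))) * (1 + Real.log K) *
      (4 * r ^ (1 - β)) ≤ 128 * Real.pi * r ^ (1 - χ - ε) := by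
    have h0 : 0 ≤ 1 + Real.log K := by linarith [Real.log_nonneg hKr]
    have h1 : 0 ≤ 1 + 2 * -Real.log (ψ (N + 1 : ℕ)) := by
      have h2 := hψ _ hcd
      linarith [Real.log_nonpos h2.1.le (by linarith)]
    calc _ ≤ 16 * Real.pi * (2 * r ^ α) * r ^ ε * r ^ ε * (4 * r ^ (1 - β)) := by gcongr
      _ = 128 * Real.pi * (r ^ α * r ^ ε * r ^ ε * r ^ (1 - β)) := by ring
      _ = 128 * Real.pi * r ^ (α + ε + ε + (1 - β)) := by
        rw [Real.rpow_add hr0 (α + ε + ε), Real.rpow_add hr0 (α + ε), Real.rpow_add hr0 α]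
      _ ≤ _ := by
        gcongr
        linarith
  have t2 : 1 / (4 * (M : ℝ)) + 16 * M / K + 8 / M ≤ 73 * r ^ (-α) := by
    have h1 : (1 : ℝ) / M ≤ r ^ (-α) := by
      rw [Real.rpow_neg hr0.le, one_div]
      exact inv_anti₀ (by positivity) hM1
    have h2 : 16 * (M : ℝ) / K ≤ 64 * r ^ (-α) := by
      calc 16 * (M : ℝ) / K ≤ 16 * (2 * r ^ α) / (r ^ (2 * α) / 2) := by gcongr
        _ = 64 * r ^ (-α) := by
          rw [two_mul α, Real.rpow_add hr0 α α, Real.rpow_neg hr0.le]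
          have h0 : r ^ α ≠ 0 := by positivity
          generalize r ^ α = z at h0 ⊢
          field_simp
          norm_num
    have h3 : 1 / (4 * (M : ℝ)) ≤ 1 / M := by
      apply one_div_le_one_div_of_le hMr; linarith
    have h4 : 8 / (M : ℝ) = 8 * (1 / M) := by ring
    linarith
  have t3 : r ^ ε * r ^ (x + ε) * ((((N + 1 : ℕ) : ℝ) - c) *
      (1 / (4 * (M : ℝ)) + 16 * M / K + 8 / M)) ≤ 73 * r ^ (1 - χ - ε) := by
    have h1 : ((N + 1 : ℕ) : ℝ) - c ≤ r := by
      have : (1 : ℝ) ≤ c := by exact_mod_cast hc1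
      push_cast; linarith
    calc _ ≤ r ^ ε * r ^ (x + ε) * (r ^ (1 : ℝ) * (73 * r ^ (-α))) := by
          rw [Real.rpow_one]
          gcongr
      _ = 73 * (r ^ ε * r ^ (x + ε) * r ^ (1 : ℝ) * r ^ (-α)) := by ring
      _ = 73 * r ^ (ε + (x + ε) + 1 + -α) := by
        rw [Real.rpow_add hr0 (ε + (x + ε) + 1), Real.rpow_add hr0 (ε + (x + ε)),
          Real.rpow_add hr0 ε]
      _ ≤ _ := by
        gcongr
        linarith
  have t4 : r ^ ε * r ^ (x + ε) * (24 * M * (r ^ ε * (132 * (2 * r ^ (α / 2)) * (9 * r ^ p)))) ≤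
      24 * 2 * 132 * 2 * 9 * r ^ (1 - χ - ε) := by
    calc _ ≤ r ^ ε * r ^ (x + ε) *
          (24 * (2 * r ^ α) * (r ^ ε * (132 * (2 * r ^ (α / 2)) * (9 * r ^ p)))) := by gcongr
      _ = 24 * 2 * 132 * 2 * 9 *
          (r ^ ε * r ^ (x + ε) * r ^ α * r ^ ε * r ^ (α / 2) * r ^ p) := by ring
      _ = 24 * 2 * 132 * 2 * 9 * r ^ (ε + (x + ε) + α + ε + α / 2 + p) := by
        rw [Real.rpow_add hr0 (ε + (x + ε) + α + ε + α / 2),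
          Real.rpow_add hr0 (ε + (x + ε) + α + ε), Real.rpow_add hr0 (ε + (x + ε) + α),
          Real.rpow_add hr0 (ε + (x + ε)), Real.rpow_add hr0 ε]
      _ ≤ _ := by
        gcongr
        linarith
  rw [mul_add (r ^ ε * r ^ (x + ε)), add_mul, add_mul]
  linarith

open Classical in
lemma primeExpSum_eq (S : Set ℕ) (w : ℝ → ℝ) (N : ℕ) (a q : ℤ) (ξ : ℝ) :
    primeExpSum S w N a q ξ = ∑ n ∈ Finset.Ico 1 (N + 1),
      (((primeWeight a q n : ℝ) : ℂ) * e (ξ * n)) * ((if n ∈ S then w n else 0 : ℝ) : ℂ) := by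
  rw [primeExpSum, Finset.sum_filter]
  refine Finset.sum_congr (by ext; simp) fun n _ => ?_
  have he : Complex.exp (2 * Real.pi * Complex.I * n * ξ) = e (ξ * n) := by
    rw [e]; push_cast; ring_nf
  rw [he, primeWeight]
  by_cases h1 : n.Prime ∧ (n : ℤ) ≡ a [ZMOD q]
  · by_cases h2 : n ∈ S
    · simp only [h1, h2, and_self, if_true]
      push_cast; ring
    · simp [h2]
  · rw [if_neg h1, if_neg fun h => h1 ⟨h.1, h.2.2⟩]
    simp

open Classical in
lemma primeExpSum_sub_eq (S : Set ℕ) (w : ℝ → ℝ) (N : ℕ) (a q : ℤ) (ξ : ℝ) :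
    primeExpSum S w N a q ξ - primeExpSum Set.univ (fun _ => 1) N a q ξ =
      ∑ n ∈ Finset.Ico 1 (N + 1), (((primeWeight a q n : ℝ) : ℂ) * e (ξ * n)) *
        (((if n ∈ S then w n else 0) - 1 : ℝ) : ℂ) := by
  rw [primeExpSum_eq, primeExpSum_eq, ← Finset.sum_sub_distrib]
  refine Finset.sum_congr rfl fun n _ => ?_
  simp only [Set.mem_univ, if_true]
  push_cast; ring

lemma norm_primeWeight_mul_le (a q : ℤ) (ξ : ℝ) {n : ℕ} {S : Set ℕ} [Decidable (n ∈ S)] {w : ℝ}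
    (hw : 0 < w) :
    ‖(((primeWeight a q n : ℝ) : ℂ) * e (ξ * n)) * (((if n ∈ S then w else 0) - 1 : ℝ) : ℂ)‖ ≤
      Real.log n * (w + 1) := by
  rw [norm_mul, norm_mul, norm_e, mul_one, Complex.norm_real, Complex.norm_real]
  refine mul_le_mul (abs_primeWeight_le a q n) ?_ (norm_nonneg _) (Real.log_natCast_nonneg n)
  rw [Real.norm_eq_abs, abs_le]
  split_ifs <;> constructor <;> linarith

end Final
end PSRoth

theorem lemma1p7
    (c₁ c₂ : ℝ) (hc₁ : 1 ≤ c₁) (hc₁' : c₁ < 16 / 15) (hc₂ : 1 ≤ c₂) (hc₂' : c₂ < 17 / 16)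
    (x₁ x₂ : ℝ) (hx₁ : 1 ≤ x₁) (hx₂ : 1 ≤ x₂)
    (h₁ h₂ : ℝ → ℝ) (hh₁ : h₁ ∈ PSRoth.RegClass x₁ c₁) (hh₂ : h₂ ∈ PSRoth.RegClass x₂ c₂)
    (ψ : ℝ → ℝ) (hψ : PSRoth.AdmissibleWeight (PSRoth.inverseOf x₂ h₂) ψ)
    (χ : ℝ) (hχ : 0 < χ)
    (hcond : 16 * (1 - 1 / c₁) + 17 * (1 - 1 / c₂) + 31 * χ ≤ 1) :
    ∃ χ' : ℝ, 0 < χ' ∧ ∃ C : ℝ, ∀ (N : ℕ) (a q : ℤ) (ξ : ℝ),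
      0 ≤ a → a ≤ q - 1 → IsCoprime a q →
        ‖PSRoth.primeExpSum (PSRoth.setB x₁ h₁ ψ) (fun x => (ψ x)⁻¹) N a q ξ
            - PSRoth.primeExpSum Set.univ (fun _ => 1) N a q ξ‖
          ≤ C * (N : ℝ) ^ (1 - χ - χ') := by
  classical
  have hε : (0 : ℝ) < 1 / 10000 := by norm_num
  obtain ⟨φ₁, φ₂, φ₃, X, hφ⟩ := PSRoth.RegClass.exists_isPhase hx₁ hc₁ hh₁ hε (by norm_num)
  obtain ⟨Y, hY1, hanti, hlow⟩ := PSRoth.AdmissibleWeight.eventually_bounds hx₂ hc₂ hh₂ hψ hε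
  have hx : 0 ≤ 1 - 1 / c₂ := by
    rw [sub_nonneg, div_le_one (by linarith)]; exact hc₂
  -- Beyond c the phase bounds hold, ψ is decreasing and not too small, and n lies in the domain of
  -- the inverse of h₁.
  set c := ⌈max (max X Y) (h₁ x₁)⌉₊ with hc
  have hcle : max (max X Y) (h₁ x₁) ≤ c := Nat.le_ceil _
  have hcX : X ≤ c := ((le_max_left _ _).trans (le_max_left _ _)).trans hcle
  have hcY : Y ≤ c := ((le_max_right _ _).trans (le_max_left _ _)).trans hcle
  have hch : h₁ x₁ ≤ c := (le_max_right _ _).trans hcle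
  have hc1 : 1 ≤ c := by exact_mod_cast hY1.trans hcY
  have hc1r : (1 : ℝ) ≤ c := by exact_mod_cast hc1
  have hy := hφ.y_nonneg
  obtain ⟨C, hC⟩ := hφ.exists_eventually_norm_saw_sum_le le_rfl hx hχ hcond hcX
    (fun u hu => hψ.1 u (hc1r.trans hu)) (hanti.mono fun u hu => hcY.trans hu)
    (fun u hu => hlow u (hcY.trans hu))
  obtain ⟨N₀, hN₀⟩ := eventually_atTop.1 (hC.and (eventually_ge_atTop c))
  have hcN₀ : c ≤ N₀ := (hN₀ N₀ le_rfl).2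
  have hterm : ∀ n : ℕ, 1 ≤ n → 0 ≤ Real.log n * ((ψ n)⁻¹ + 1) := fun n hn => by
    have h1 := (hψ.1 n (by exact_mod_cast hn)).1
    have := Real.log_natCast_nonneg n
    positivity
  -- D bounds the contribution of n ≤ N₀ trivially and uniformly in a, q, ξ; it covers both small N
  -- and the initial range n < c for large N.
  set D := ∑ n ∈ Finset.Ico 1 (N₀ + 1), Real.log n * ((ψ n)⁻¹ + 1) with hD
  have hD0 : 0 ≤ D := Finset.sum_nonneg fun n hn => hterm n (Finset.mem_Ico.1 hn).1
  have htriv : ∀ (a q : ℤ) (ξ : ℝ) (b : ℕ), b ≤ N₀ + 1 →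
      ‖∑ n ∈ Finset.Ico 1 b, (((PSRoth.primeWeight a q n : ℝ) : ℂ) * PSRoth.e (ξ * n)) *
        (((if n ∈ PSRoth.setB x₁ h₁ ψ then (ψ n)⁻¹ else 0) - 1 : ℝ) : ℂ)‖ ≤ D := by
    intro a q ξ b hb
    refine (norm_sum_le_of_le _ fun n hn => PSRoth.norm_primeWeight_mul_le a q ξ ?_).trans
      (Finset.sum_le_sum_of_subset_of_nonneg (Finset.Ico_subset_Ico_right hb)
        fun n hn _ => hterm n (Finset.mem_Ico.1 hn).1)
    exact inv_pos.2 (hψ.1 n (by exact_mod_cast (Finset.mem_Ico.1 hn).1)).1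
  refine ⟨1 / 10000, hε, D + |C|, fun N a q ξ ha haq _ => ?_⟩
  have hq : 1 ≤ q := by linarith
  rw [PSRoth.primeExpSum_sub_eq]
  rcases Nat.eq_zero_or_pos N with rfl | hN
  · simp only [zero_add, Finset.Ico_self, Finset.sum_empty, norm_zero]
    positivity
  -- `hcond` forces χ ≤ 1/31, so the exponent is positive and the bounded contribution D is
  -- absorbed.
  have hpow : 1 ≤ (N : ℝ) ^ (1 - χ - 1 / 10000) :=
    Real.one_le_rpow (by exact_mod_cast hN) (by linarith)
  rw [add_mul]
  rcases le_total N N₀ with hNN | hNN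
  · calc _ ≤ D := htriv a q ξ (N + 1) (by omega)
      _ ≤ D * (N : ℝ) ^ (1 - χ - 1 / 10000) := le_mul_of_one_le_right hD0 hpow
      _ ≤ _ := le_add_of_nonneg_right (by positivity)
  · rw [← Finset.sum_Ico_consecutive _ hc1 (show c ≤ N + 1 by omega)]
    refine (norm_add_le _ _).trans (add_le_add
      ((htriv a q ξ c (by omega)).trans (le_mul_of_one_le_right hD0 hpow)) ?_)
    refine le_trans (le_of_eq ?_) (((hN₀ N hNN).1 a q hq ξ).trans
      (mul_le_mul_of_nonneg_right (le_abs_self C) (by positivity)))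
    congr 1
    refine Finset.sum_congr rfl fun n hn => ?_
    have hcn : (c : ℝ) ≤ n := by exact_mod_cast (Finset.mem_Ico.1 hn).1
    obtain ⟨hp0, hp1⟩ := hψ.1 n (hc1r.trans hcn)
    rw [mul_assoc (_ * _)]
    congr 1
    rw [← Complex.ofReal_mul]
    congr 1
    have hmem : n ∈ PSRoth.setB x₁ h₁ ψ ↔ Int.fract (PSRoth.inverseOf x₁ h₁ n) < ψ n :=
      and_iff_right (hch.trans hcn)
    have hind := PSRoth.indicator_eq_saw (x := PSRoth.inverseOf x₁ h₁ n) hp0 (by linarith)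
    have h5 : PSRoth.saw (PSRoth.inverseOf x₁ h₁ n - ψ n) - PSRoth.saw (PSRoth.inverseOf x₁ h₁ n) =
        (if Int.fract (PSRoth.inverseOf x₁ h₁ n) < ψ n then (1 : ℝ) else 0) - ψ n := by
      rw [hind]; ring
    rw [h5, mul_sub, inv_mul_cancel₀ hp0.ne']
    simp only [hmem]
    split_ifs <;> simp
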